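/- Let $n\ge 1$ and $k\ge 0$ be integers, $\lambda,\mu\in\mathbb R$ and $\delta=\mu-\lambda$. Let $\mathfrak{sl}_{n+1}$ be the Lie algebra of projective vector fields on $\mathbb R^n$, spanned over $\mathbb{R}$ by the fields $\partial_j$, $x^i\partial_j$ and $x^i\sum_j x^j\partial_j$. A vector field $X$ acts - on the $\lambda$-densities $\mathcal F^\lambda=C^\infty(\mathbb R^n)$ by $\ell^\lambda_X=X+\lambda\,\mathrm{Div}(X)$; - on the space $\mathcal D^{\lambda,\mu}$ of differential operators $\mathcal F^\lambda\to\mathcal F^\mu$ by $A\mapsto \ell^\mu_XA-A\ell^\lambda_X$; - on the space $\mathcal S^\delta_k$ of smooth functions on $T^*\mathbb R^n$ that are homogeneous polynomials of degree $k$ in the fibre coordinates $p_i$ by $L^\delta_X=X^i\partial_i-p_j(\partial_iX^j)\partial_{p_i}+\delta\,\mathrm{Div}(X)$; - on sections of the homogeneous bundle $\mathbb R^n\times V$ associated with a finite-dimensional real representation $\rho$ of $\mathfrak{gl}_n$ on $V$ by $s\mapsto X^i\partial_is-(\partial_iX^j)\rho(E_{ji})s$; - on the space $\bar{\mathcal S}^\lambda_h$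 of smooth functions on $T\mathbb R^n$ that are homogeneous polynomials of degree $h$ in the fibre coordinates $\bar p^i$ by $X^i\partial_i+\bar p^i(\partial_iX^j)\partial_{\bar p^j}+\lambda\,\mathrm{Div}(X)$. Projectively invariant (or equivariant) means commuting with the action of $\mathfrak{sl}_{n+1}$. A projectively equivariant quantization on $\mathcal S^\delta_k$ is an $\mathfrak{sl}_{n+1}$-equivariant linear map $\mathcal Q^{\lambda,\mu}:\mathcal S^\delta_k\to\mathcal D^{\lambda,\mu}$ such that, for every $P\in\mathcal S^\delta_k$, the operator $\mathcal Q^{\lambda,\mu}(P)$ has order at most $k$ and $k$-th order principal symbol $P$. Let $D=\partial_i\partial_{p_i}$ be the divergence operator on symbols and $\bar G=\bar p^i\partial_i$. **Theorem.** 1. There is exactly one projectively equivariant quantization on $\mathcal S^\delta_k$ if and only if there is no non-zero projectively invariant differential operator $\mathcal S^\delta_k\to\mathcal S^\delta_{k-l}$ with $1\le l\le k$. 2. Suppose that, for some $1\le l\le k$, there is a non-zero projectively invariant differential operator $A:\mathcal S^\delta_k\to\mathcal S^\delta_{k-l}$. Then every such $A$ is a non-zero constant multiple of $D^l$. Moreover,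 the following are equivalent: - a projectively equivariant quantization on $\mathcal S^\delta_k$ exists; - for some integer $h$ with $k-l<h\le k$ there is a projectively invariant differential operator of order exactly $h$ from $\mathcal F^\lambda$ to sections of a homogeneous bundle as above; - $\lambda=\frac{1-h}{n+1}$ for some integer $h$ with $k-l<h\le k$. 3. For every integer $h\ge1$ the following are equivalent: - there is a projectively invariant differential operator of order exactly $h$ from $\mathcal F^\lambda$ to sections of a homogeneous bundle as above; - there is such an operator with values in the sections of a homogeneous bundle for which $\rho$ is irreducible; - the operator $\bar G^h:\mathcal F^\lambda\to\bar{\mathcal S}^\lambda_h$ is projectively invariant; - $\lambda=\frac{1-h}{n+1}$. -/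

import Mathlib

open scoped ContDiff

noncomputable section

namespace ProjQuant

/-- The algebra `C^∞(ℝⁿ)` of smooth real functions on `ℝⁿ`. -/
def smoothSubalgebra (n : ℕ) : Subalgebra ℝ ((Fin n → ℝ) → ℝ) where
  carrier := {f | ContDiff ℝ ∞ f}
  mul_mem' {f g} hf hg := by
    change ContDiff ℝ ∞ (fun x => f x * g x)
    exact ContDiff.mul (by exact hf) (by exact hg)
  add_mem' {f g} hf hg := by
    change ContDiff ℝ ∞ (fun x => f x + g x)
    exact ContDiff.add (by exact hf) (by exact hg)
  algebraMap_mem' c := by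
    change ContDiff ℝ ∞ (fun _ => c)
    exact contDiff_const

/-- The type of smooth real functions on `ℝⁿ`. -/
def Smooth (n : ℕ) : Type := ↥(smoothSubalgebra n)

instance (n : ℕ) : CommRing (Smooth n) := inferInstanceAs (CommRing ↥(smoothSubalgebra n))

instance (n : ℕ) : Algebra ℝ (Smooth n) := inferInstanceAs (Algebra ℝ ↥(smoothSubalgebra n))

theorem Smooth.ext {n : ℕ} {f g : Smooth n} (h : ∀ x, f.1 x = g.1 x) : f = g :=
  Subtype.ext (funext h)

theorem Smooth.contDiff {n : ℕ} (f : Smooth n) : ContDiff ℝ ∞ f.1 := f.2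

theorem Smooth.differentiableAt {n : ℕ} (f : Smooth n) (x : Fin n → ℝ) :
    DifferentiableAt ℝ f.1 x :=
  (f.contDiff.differentiable (by simp)).differentiableAt

/-- The partial derivative `∂_i` acting on `C^∞(ℝⁿ)`. -/
def pd {n : ℕ} (i : Fin n) : Smooth n →ₗ[ℝ] Smooth n where
  toFun f := ⟨fun x => fderiv ℝ f.1 x (Pi.single i 1),
    (ContDiff.fderiv_right (m := ∞) f.contDiff (by simp)).clm_apply contDiff_const⟩
  map_add' f g := by
    refine Smooth.ext fun x => ?_
    change fderiv ℝ (f.1 + g.1) x _ = fderiv ℝ f.1 x _ + fderiv ℝ g.1 x _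
    rw [fderiv_add (f.differentiableAt x) (g.differentiableAt x)]
    rfl
  map_smul' c f := by
    refine Smooth.ext fun x => ?_
    change fderiv ℝ (c • f.1) x _ = c • fderiv ℝ f.1 x _
    rw [fderiv_const_smul (f.differentiableAt x)]
    rfl

/-- The coordinate function `x^i`. -/
def coord {n : ℕ} (i : Fin n) : Smooth n :=
  ⟨fun x => x i, by
    change ContDiff ℝ ∞ (fun x : Fin n → ℝ => x i)
    exact contDiff_apply ℝ ℝ i⟩

/-! ### Vector fields and the projective Lie algebra -/

/-- A smooth vector field `X = X^i ∂_i` on `ℝⁿ`, given by its components `X^i`. -/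
abbrev VField (n : ℕ) : Type := Fin n → Smooth n

/-- The divergence `∂_i X^i` of a vector field. -/
def vdiv {n : ℕ} (X : VField n) : Smooth n := ∑ i, pd i (X i)

/-- The constant vector field `∂_j`. -/
def translationField {n : ℕ} (j : Fin n) : VField n := Pi.single j 1

/-- The linear vector field `x^i ∂_j`. -/
def linearField {n : ℕ} (i j : Fin n) : VField n := Pi.single j (coord i)

/-- The projective inversion `x^i x^j ∂_j` (sum over `j`). -/
def inversionField {n : ℕ} (i : Fin n) : VField n := fun j => coord i * coord j

/-- The Lie algebra `sl_{n+1}` of projective vector fields on `ℝⁿ`: the real span of the affine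
vector fields and of the projective inversions (this span is closed under the Lie bracket). -/
def projectiveFields (n : ℕ) : Submodule ℝ (VField n) :=
  Submodule.span ℝ
    (Set.range (translationField (n := n)) ∪
      Set.range (fun q : Fin n × Fin n => linearField q.1 q.2) ∪
      Set.range (inversionField (n := n)))

/-! ### Differential operators -/

section DiffOp

variable {n : ℕ} {M M' : Type} [AddCommGroup M] [Module ℝ M] [Module (Smooth n) M]
  [IsScalarTower ℝ (Smooth n) M]
  [AddCommGroup M'] [Module ℝ M'] [Module (Smooth n) M'] [IsScalarTower ℝ (Smooth n) M']

/-- The commutator `[A, f]` of an operator `A` with the multiplication by the function `f`. -/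
def opComm (A : M →ₗ[ℝ] M') (f : Smooth n) : M →ₗ[ℝ] M' :=
  A ∘ₗ Algebra.lsmul ℝ ℝ M f - Algebra.lsmul ℝ ℝ M' f ∘ₗ A

variable (n) in
/-- `OrderLT n k A`: the operator `A` between `C^∞(ℝⁿ)`-modules is a differential operator of
order at most `k - 1`, i.e. all its `k`-fold commutators with functions vanish. For `k = 0` this
means `A = 0`. -/
def OrderLT : ℕ → (M →ₗ[ℝ] M') → Prop
  | 0, A => A = 0
  | k + 1, A => ∀ f : Smooth n, OrderLT k (opComm A f)

variable (n) in
/-- `A` is a differential operator of order at most `k`: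
`[…[[A, f₀], f₁], …, f_k] = 0` for all functions `f₀, …, f_k`. -/
def OrderLE (k : ℕ) (A : M →ₗ[ℝ] M') : Prop := OrderLT n (k + 1) A

variable (n) in
/-- `A` is a differential operator (of some finite order). -/
def IsDiffOp (A : M →ₗ[ℝ] M') : Prop := ∃ k : ℕ, OrderLE n k A

variable (n) in
/-- `A` is a differential operator of order exactly `k`. -/
def OrderEq (k : ℕ) (A : M →ₗ[ℝ] M') : Prop := OrderLE n k A ∧ ¬ OrderLT n k A

end DiffOp

/-! ### Densities and operators between them -/

/-- The action `ℓ^λ_X = X + λ Div(X)` of a vector field `X` on the module `F^λ = C^∞(ℝⁿ)` of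
`λ`-densities. -/
def densityAction {n : ℕ} (lam : ℝ) (X : VField n) : Smooth n →ₗ[ℝ] Smooth n :=
  (∑ i, Algebra.lsmul ℝ ℝ (Smooth n) (X i) ∘ₗ pd i) +
    lam • Algebra.lsmul ℝ ℝ (Smooth n) (vdiv X)

/-- The adjoint action `𝓛^{λ,μ}_X A = ℓ^μ_X A - A ℓ^λ_X` on operators from `λ`- to
`μ`-densities. -/
def operatorAction {n : ℕ} (lam mu : ℝ) (X : VField n) (A : Smooth n →ₗ[ℝ] Smooth n) :
    Smooth n →ₗ[ℝ] Smooth n :=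
  densityAction mu X ∘ₗ A - A ∘ₗ densityAction lam X

/-! ### Symbols -/

/-- Functions on `T^*ℝⁿ` (or on `Tℝⁿ`) that are polynomial in the fibre variables:
polynomials in the `n` fibre coordinates with coefficients in `C^∞(ℝⁿ)`. -/
abbrev FibrePoly (n : ℕ) : Type := MvPolynomial (Fin n) (Smooth n)

/-- A linear map on `C^∞(ℝⁿ)` applied to each coefficient of a fibrewise polynomial function. -/
def coeffMap {n : ℕ} (T : Smooth n →ₗ[ℝ] Smooth n) : FibrePoly n →ₗ[ℝ] FibrePoly n where
  toFun P := ∑ m ∈ P.support, MvPolynomial.monomial m (T (P.coeff m))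
  map_add' P Q := by
    have key : ∀ (R : FibrePoly n) (d : Fin n →₀ ℕ),
        (∑ m ∈ R.support, MvPolynomial.monomial m (T (R.coeff m))).coeff d = T (R.coeff d) := by
      intro R d
      simp only [MvPolynomial.coeff_sum, MvPolynomial.coeff_monomial]
      rw [Finset.sum_ite_eq' R.support d]
      split_ifs with h
      · rfl
      · rw [MvPolynomial.notMem_support_iff.mp h, map_zero]
    ext1 d
    rw [MvPolynomial.coeff_add, key, key, key, MvPolynomial.coeff_add, map_add]
  map_smul' c P := by
    have key : ∀ (R : FibrePoly n) (d : Fin n →₀ ℕ),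
        (∑ m ∈ R.support, MvPolynomial.monomial m (T (R.coeff m))).coeff d = T (R.coeff d) := by
      intro R d
      simp only [MvPolynomial.coeff_sum, MvPolynomial.coeff_monomial]
      rw [Finset.sum_ite_eq' R.support d]
      split_ifs with h
      · rfl
      · rw [MvPolynomial.notMem_support_iff.mp h, map_zero]
    ext1 d
    rw [RingHom.id_apply, MvPolynomial.coeff_smul, key, key, MvPolynomial.coeff_smul, map_smul]

theorem coeff_coeffMap {n : ℕ} (T : Smooth n →ₗ[ℝ] Smooth n) (P : FibrePoly n)
    (d : Fin n →₀ ℕ) : (coeffMap T P).coeff d = T (P.coeff d) := by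
  change (∑ m ∈ P.support, MvPolynomial.monomial m (T (P.coeff m))).coeff d = T (P.coeff d)
  simp only [MvPolynomial.coeff_sum, MvPolynomial.coeff_monomial]
  rw [Finset.sum_ite_eq' P.support d]
  split_ifs with h
  · rfl
  · rw [MvPolynomial.notMem_support_iff.mp h, map_zero]

/-- The base derivative `∂_i = ∂/∂x^i` of a fibrewise polynomial function. -/
def baseD {n : ℕ} (i : Fin n) : FibrePoly n →ₗ[ℝ] FibrePoly n := coeffMap (pd i)

/-- The fibre derivative `∂_{p_i}` of a fibrewise polynomial function. -/
def fibreD {n : ℕ} (i : Fin n) : FibrePoly n →ₗ[ℝ] FibrePoly n :=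
  (MvPolynomial.pderiv i : Derivation (Smooth n) (FibrePoly n) (FibrePoly n)
    ).toLinearMap.restrictScalars ℝ

/-- The action `L^δ_X = X^i ∂_i - p_j (∂_i X^j) ∂_{p_i} + δ Div(X)` of a vector field on
symbols. -/
def symbolAction {n : ℕ} (delta : ℝ) (X : VField n) : FibrePoly n →ₗ[ℝ] FibrePoly n :=
  (∑ i, Algebra.lsmul ℝ ℝ (FibrePoly n) (X i) ∘ₗ baseD i) -
    (∑ i, ∑ j, Algebra.lsmul ℝ ℝ (FibrePoly n)
      (MvPolynomial.X j * MvPolynomial.C (pd i (X j)) : FibrePoly n) ∘ₗ fibreD i) +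
    delta • Algebra.lsmul ℝ ℝ (FibrePoly n) (vdiv X)

/-- The submodule `S_k` of symbols that are homogeneous of degree `k` in the fibre variables. -/
abbrev Symb (n k : ℕ) : Submodule (Smooth n) (FibrePoly n) :=
  MvPolynomial.homogeneousSubmodule (Fin n) (Smooth n) k

theorem baseD_mem {n k : ℕ} (i : Fin n) {P : FibrePoly n} (hP : P ∈ Symb n k) :
    baseD i P ∈ Symb n k := by
  rw [MvPolynomial.mem_homogeneousSubmodule] at hP ⊢
  intro d hd
  apply hP
  intro h
  apply hd
  rw [baseD, coeff_coeffMap, h, map_zero]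

theorem mul_fibreD_mem {n k : ℕ} (i j : Fin n) (f : Smooth n) {P : FibrePoly n}
    (hP : P ∈ Symb n k) :
    (MvPolynomial.X j * MvPolynomial.C f : FibrePoly n) * fibreD i P ∈ Symb n k := by
  rw [MvPolynomial.mem_homogeneousSubmodule] at hP ⊢
  rcases k with _ | k
  · have h0 : fibreD i P = 0 := by
      rw [MvPolynomial.totalDegree_eq_zero_iff_eq_C.mp
        (Nat.le_zero.mp hP.totalDegree_le)]
      exact MvPolynomial.pderiv_C
    rw [h0, mul_zero]
    exact MvPolynomial.isHomogeneous_zero _ _ _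
  · have h1 : (fibreD i P).IsHomogeneous k := hP.pderiv
    have h2 := ((MvPolynomial.isHomogeneous_X (Smooth n) j).mul
      (MvPolynomial.isHomogeneous_C (Fin n) f)).mul h1
    have h3 : 1 + 0 + k = k + 1 := by omega
    rwa [h3] at h2

theorem symbolAction_mem {n k : ℕ} (delta : ℝ) (X : VField n) {P : FibrePoly n}
    (hP : P ∈ Symb n k) : symbolAction delta X P ∈ Symb n k := by
  have hs : ∀ (c : ℝ) {Q : FibrePoly n}, Q ∈ Symb n k → c • Q ∈ Symb n k := by
    intro c Q hQ
    rw [← algebraMap_smul (Smooth n) c Q]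
    exact Submodule.smul_mem _ _ hQ
  simp only [symbolAction, LinearMap.add_apply, LinearMap.sub_apply, LinearMap.sum_apply,
    LinearMap.comp_apply, LinearMap.smul_apply, Algebra.lsmul_coe]
  refine Submodule.add_mem _ (Submodule.sub_mem _ ?_ ?_) ?_
  · exact Submodule.sum_mem _ fun i _ => Submodule.smul_mem _ _ (baseD_mem i hP)
  · exact Submodule.sum_mem _ fun i _ => Submodule.sum_mem _ fun j _ => mul_fibreD_mem i j _ hP
  · exact hs _ (Submodule.smul_mem _ _ hP)

/-- The action `L^δ_X` on the module `S^δ_k` of homogeneous symbols of degree `k`. -/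
def symbAction {n : ℕ} (k : ℕ) (delta : ℝ) (X : VField n) : Symb n k →ₗ[ℝ] Symb n k where
  toFun P := ⟨symbolAction delta X P.1, symbolAction_mem delta X P.2⟩
  map_add' P Q := Subtype.ext (map_add (symbolAction delta X) P.1 Q.1)
  map_smul' c P := Subtype.ext (map_smul (symbolAction delta X) c P.1)

/-- The divergence operator `D = ∂_i ∂_{p_i}` on symbols. -/
def divergenceOp (n : ℕ) : FibrePoly n →ₗ[ℝ] FibrePoly n := ∑ i, baseD i ∘ₗ fibreD i

/-- A linear map `S^δ_k → S^δ_l` is projectively invariant if it commutes with the actions of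
all projective vector fields. -/
def SymbInvariant {n k l : ℕ} (delta : ℝ) (A : Symb n k →ₗ[ℝ] Symb n l) : Prop :=
  ∀ X ∈ projectiveFields n, symbAction l delta X ∘ₗ A = A ∘ₗ symbAction k delta X

/-! ### Quantization -/

/-- The iterated partial derivative `∂_1^{m_1} ⋯ ∂_n^{m_n}`. -/
def pdMulti {n : ℕ} (m : Fin n →₀ ℕ) : Module.End ℝ (Smooth n) :=
  (List.ofFn fun i => (pd i : Module.End ℝ (Smooth n)) ^ m i).prod

/-- The normal ordering `P^{i₁…i_k} p_{i₁}⋯p_{i_k} ↦ P^{i₁…i_k} ∂_{i₁}⋯∂_{i_k}`. -/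
def normalOrdering {n : ℕ} (P : FibrePoly n) : Smooth n →ₗ[ℝ] Smooth n :=
  ∑ m ∈ P.support, Algebra.lsmul ℝ ℝ (Smooth n) (P.coeff m) ∘ₗ pdMulti m

/-- The operator `A` lies in `D_k` and its principal symbol, i.e. its class in
`D_k / D_{k-1}`, is the homogeneous symbol `P` of degree `k`. Here `D_k / D_{k-1}` is identified
with the symbols of degree `k` by sending `P` to the class of its normal ordering. -/
def HasPrincipalSymbol {n : ℕ} (k : ℕ) (A : Smooth n →ₗ[ℝ] Smooth n) (P : Symb n k) : Prop :=
  OrderLE n k A ∧ OrderLT n k (A - normalOrdering P.1)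

/-- `Q : S^δ_k → D^{λ,μ}`, with `δ = μ - λ`, is a projectively equivariant quantization on
symbols of degree `k`: it is linear, it is a right inverse of the principal symbol map, and it is
a morphism of `sl_{n+1}`-modules. -/
structure IsProjQuantization {n : ℕ} (k : ℕ) (lam mu : ℝ)
    (Q : Symb n k →ₗ[ℝ] (Smooth n →ₗ[ℝ] Smooth n)) : Prop where
  symbol : ∀ P : Symb n k, HasPrincipalSymbol k (Q P) P
  equivariant : ∀ X ∈ projectiveFields n, ∀ P : Symb n k,
    Q (symbAction k (mu - lam) X P) = operatorAction lam mu X (Q P)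

/-! ### Homogeneous bundles and invariant operators on densities -/

/-- Sections of the trivial bundle `ℝⁿ × ℝ^d`. -/
abbrev Sections (n d : ℕ) : Type := Fin d → Smooth n

/-- A linear map `ρ : gl_n → gl_d` is a representation of the Lie algebra `gl_n` on `ℝ^d`. -/
def IsGLRep {n d : ℕ}
    (rho : Matrix (Fin n) (Fin n) ℝ →ₗ[ℝ] Matrix (Fin d) (Fin d) ℝ) : Prop :=
  ∀ B C, rho (B * C - C * B) = rho B * rho C - rho C * rho B

/-- The Lie derivative of sections of the homogeneous bundle `ℝⁿ × ℝ^d` associated with a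
representation `ρ` of `gl_n` (the degree-zero part of `sl_{n+1}`) on `ℝ^d`:
`L_X s = X^i ∂_i s - (∂_i X^j) ρ(E_{ji}) s`. For the standard representation this is the bracket
of vector fields, and for `ρ = -λ tr` it is the action on `λ`-densities. -/
def sectionAction {n d : ℕ} (rho : Matrix (Fin n) (Fin n) ℝ →ₗ[ℝ] Matrix (Fin d) (Fin d) ℝ)
    (X : VField n) (s : Sections n d) : Sections n d := fun a =>
  ∑ i, X i * pd i (s a) -
    ∑ i, ∑ j, pd i (X j) * ∑ b, rho (Matrix.single j i 1) a b • s b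

/-- A linear map from `λ`-densities to sections of the bundle associated with `ρ` is projectively
invariant. -/
def SectionInvariant {n d : ℕ} (lam : ℝ)
    (rho : Matrix (Fin n) (Fin n) ℝ →ₗ[ℝ] Matrix (Fin d) (Fin d) ℝ)
    (A : Smooth n →ₗ[ℝ] Sections n d) : Prop :=
  ∀ X ∈ projectiveFields n, ∀ f : Smooth n,
    sectionAction rho X (A f) = A (densityAction lam X f)

/-- A representation of `gl_n` on `ℝ^d` is irreducible: `d ≠ 0` and there is no invariant subspace
other than `0` and `ℝ^d`. -/
def IsIrreducibleRep {n d : ℕ}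
    (rho : Matrix (Fin n) (Fin n) ℝ →ₗ[ℝ] Matrix (Fin d) (Fin d) ℝ) : Prop :=
  d ≠ 0 ∧ ∀ W : Submodule ℝ (Fin d → ℝ),
    (∀ B, ∀ w ∈ W, (rho B).mulVec w ∈ W) → W = ⊥ ∨ W = ⊤

/-- There is a projectively invariant differential operator of order `h` from `λ`-densities to
sections of a homogeneous bundle. -/
def HasInvariantOperator (n : ℕ) (lam : ℝ) (h : ℕ) : Prop :=
  ∃ (d : ℕ) (rho : Matrix (Fin n) (Fin n) ℝ →ₗ[ℝ] Matrix (Fin d) (Fin d) ℝ)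
    (A : Smooth n →ₗ[ℝ] Sections n d),
    IsGLRep rho ∧ OrderEq n h A ∧ SectionInvariant lam rho A

/-- There is a projectively invariant differential operator of order `h` from `λ`-densities to
sections of an irreducible homogeneous bundle. -/
def HasIrreducibleInvariantOperator (n : ℕ) (lam : ℝ) (h : ℕ) : Prop :=
  ∃ (d : ℕ) (rho : Matrix (Fin n) (Fin n) ℝ →ₗ[ℝ] Matrix (Fin d) (Fin d) ℝ)
    (A : Smooth n →ₗ[ℝ] Sections n d),
    IsGLRep rho ∧ IsIrreducibleRep rho ∧ OrderEq n h A ∧ SectionInvariant lam rho A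

/-- The action of a vector field on functions on `Tℝⁿ` that are polynomial in the fibre
coordinates `q^i`, tensored with `λ`-densities:
`X^i ∂_i + q^i (∂_i X^j) ∂_{q^j} + λ Div(X)`. -/
def cosymbolAction {n : ℕ} (lam : ℝ) (X : VField n) : FibrePoly n →ₗ[ℝ] FibrePoly n :=
  (∑ i, Algebra.lsmul ℝ ℝ (FibrePoly n) (X i) ∘ₗ baseD i) +
    (∑ i, ∑ j, Algebra.lsmul ℝ ℝ (FibrePoly n)
      (MvPolynomial.X i * MvPolynomial.C (pd i (X j)) : FibrePoly n) ∘ₗ fibreD j) +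
    lam • Algebra.lsmul ℝ ℝ (FibrePoly n) (vdiv X)

/-- The operator `G = q^i ∂_i` on functions on `Tℝⁿ` that are polynomial in the fibre
coordinates `q^i`. -/
def gradientOp (n : ℕ) : FibrePoly n →ₗ[ℝ] FibrePoly n :=
  ∑ i, Algebra.lsmul ℝ ℝ (FibrePoly n) (MvPolynomial.X i : FibrePoly n) ∘ₗ baseD i

/-- The operator `G^h`, from `λ`-densities (seen as functions constant along the fibres) to
functions on `Tℝⁿ` of degree `h` in the fibre coordinates tensored with `λ`-densities, is
projectively invariant. -/
def GradientPowInvariant (n : ℕ) (lam : ℝ) (h : ℕ) : Prop :=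
  ∀ X ∈ projectiveFields n, ∀ f : Smooth n,
    cosymbolAction lam X ((gradientOp n ^ h) (MvPolynomial.C f)) =
      (gradientOp n ^ h) (MvPolynomial.C (densityAction lam X f))

end ProjQuant

end

noncomputable section

namespace ProjQuant

/-! ### Averages along segments and Hadamard's lemma -/

section Averages

variable {E F : Type} [NormedAddCommGroup E] [NormedSpace ℝ E] [ProperSpace E]
  [NormedAddCommGroup F] [NormedSpace ℝ F]

/-! Affine equivariance leaves only scalars to be determined, and the inversions then impose scalar
equations on them. Normal ordering `nord` commutes with the translations and linear fields; along
the inversion of index a it fails, on symbols of degree k, by (k - 1 + λ(n+1)) ∂_{p_a}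
(`operatorAction_nord_inversionField`, `inversionDefect_eq`). Likewise D^l commutes with the affine
fields and fails along inversions by `resonance n k l δ` times ∂_{p_a} D^{l-1}
(`divergenceOp_pow_symbolAction_inversionField`).

The rigidity statement is `IsAffineEquivariant.exists_eq_smul`: a linear map from symbols of degree
k to symbols of degree k - l that commutes with the affine fields is a multiple of D^l. Its locality
comes from the Euler field E: every function vanishing to order l + 1 at a point has the form E g -
l g, with E centred there. This reduces matters to polynomial symbols, where a weight argument for
gl_n leaves a single coefficient. Hence an invariant operator is c D^l, and for 1 ≤ l ≤ k the
operator D^l is invariant exactly when the resonance vanishes. For given k and δ this happens for at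
most one l ≥ 1.

Removing principal symbols one degree at a time shows that an equivariant quantization is the normal
ordering of ∑ c_l D^l with c_0 = 1 (`IsProjQuantization.exists_coeffs`). The inversions amount to
c_{s+1} resonance(s+1) + c_s defect(s) = 0 for s < k, where defect(s) = k - s - 1 + λ(n+1). Without
resonance the solution exists and is unique. At a resonance l the coefficient c_l is free, so
uniqueness fails; a solution exists exactly when defect(s) = 0 for some s < l, which with h = k - s
reads λ = (1-h)/(n+1).

For operators on densities, G^h fails to be invariant by h(h - 1 + λ(n+1)) times p̄^a G^{h-1}, which
gives existence for that same λ; the coefficients of G^h f form a section of an irreducible bundle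
of homogeneous polynomials. Conversely, an inversion centred at x₀ vanishes there to second order,
so its action on sections is zero at x₀; comparison with its action on functions vanishing to order
h - 1 forces the same λ (`HasInvariantOperator.eq_of_one_le`). -/

theorem hasFDerivAt_weightedAverage (x₀ x : E) {w : ℝ → ℝ} (hw : Continuous w) {f : E → F}
    (hf : ContDiff ℝ 1 f) :
    HasFDerivAt (fun x => ∫ t in (0 : ℝ)..1, w t • f (x₀ + t • (x - x₀)))
      (∫ t in (0 : ℝ)..1, (w t * t) • fderiv ℝ f (x₀ + t • (x - x₀))) x := by
  have hfd : Continuous (fderiv ℝ f) := hf.continuous_fderiv one_ne_zero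
  have hfc : Continuous f := hf.continuous
  have hF : Continuous fun q : E × ℝ => (w q.2 * q.2) • fderiv ℝ f (x₀ + q.2 • (q.1 - x₀)) := by
    fun_prop
  -- The dominating constant comes from compactness of the unit ball around x times [0, 1].
  obtain ⟨C, hC⟩ := ((isCompact_closedBall x 1).prod (isCompact_Icc (a := (0 : ℝ)) (b := 1))
    ).exists_bound_of_continuousOn hF.continuousOn
  refine intervalIntegral.hasFDerivAt_integral_of_dominated_of_fderiv_le
    (F' := fun x t => (w t * t) • fderiv ℝ f (x₀ + t • (x - x₀))) (bound := fun _ => C)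
    (Metric.closedBall_mem_nhds x one_pos) ?_ ?_ ?_ ?_ ?_ ?_
  · refine Filter.Eventually.of_forall fun y => Continuous.aestronglyMeasurable ?_
    fun_prop
  · refine Continuous.intervalIntegrable ?_ _ _
    fun_prop
  · have : SecondCountableTopologyEither ℝ (E →L[ℝ] F) :=
      secondCountableTopologyEither_of_left ℝ _
    refine Continuous.aestronglyMeasurable ?_
    fun_prop
  · refine Filter.Eventually.of_forall fun t ht y hy => hC (y, t) ⟨hy, ?_⟩
    rw [Set.uIoc_of_le zero_le_one] at ht
    exact Set.Ioc_subset_Icc_self ht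
  · exact intervalIntegrable_const
  · refine Filter.Eventually.of_forall fun t _ y _ => ?_
    have h1 : HasFDerivAt (fun y : E => x₀ + t • (y - x₀)) (t • ContinuousLinearMap.id ℝ E) y :=
      (((hasFDerivAt_id y).sub_const x₀).const_smul t).const_add x₀
    have h2 := (((hf.differentiable one_ne_zero) (x₀ + t • (y - x₀))).hasFDerivAt.comp y
      h1).const_smul (w t)
    refine h2.congr_fderiv ?_
    ext v
    simp [mul_smul]

/-- Differentiation in x turns an average of weight w into one of weight w(t)·t, with values in a
space of linear maps. The class of all weights and all targets is therefore stable, and the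
induction on m must quantify over both. -/
theorem contDiff_weightedAverage (x₀ : E) (m : ℕ) : ∀ {F : Type} [NormedAddCommGroup F]
    [NormedSpace ℝ F] {w : ℝ → ℝ}, Continuous w → ∀ {f : E → F}, ContDiff ℝ ∞ f →
    ContDiff ℝ m (fun x => ∫ t in (0 : ℝ)..1, w t • f (x₀ + t • (x - x₀))) := by
  induction m with
  | zero =>
    intro F _ _ w hw f hf
    exact contDiff_zero.2 (continuous_iff_continuousAt.2 fun x =>
      (hasFDerivAt_weightedAverage x₀ x hw (hf.of_le (by simp))).continuousAt)
  | succ m ih =>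
    intro F _ _ w hw f hf
    have hd := fun x => hasFDerivAt_weightedAverage x₀ x hw (hf.of_le (m := 1) (by simp))
    rw [Nat.cast_add, Nat.cast_one, contDiff_succ_iff_fderiv]
    refine ⟨fun x => (hd x).differentiableAt, by simp, ?_⟩
    rw [funext fun x => (hd x).fderiv]
    exact ih (hw.mul continuous_id) (hf.fderiv_right (by simp))

end Averages

variable {n : ℕ}

/-- The average `x ↦ ∫₀¹ f (x₀ + t (x - x₀)) dt` of a function along segments issued from `x₀`. -/
def avg (x₀ : Fin n → ℝ) (f : Smooth n) : Smooth n :=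
  ⟨fun x => ∫ t in (0 : ℝ)..1, f.1 (x₀ + t • (x - x₀)), by
    have h := contDiff_infty.2 fun m =>
      contDiff_weightedAverage x₀ m (continuous_const (y := (1 : ℝ))) f.contDiff
    simp only [one_smul] at h
    exact h⟩

/-- Evaluation of smooth functions at a point. -/
def evalAt (x₀ : Fin n → ℝ) : Smooth n →ₐ[ℝ] ℝ where
  toFun f := f.1 x₀
  map_one' := rfl
  map_mul' _ _ := rfl
  map_zero' := rfl
  map_add' _ _ := rfl
  commutes' _ := rfl

theorem Smooth.ext_evalAt {f g : Smooth n} (h : ∀ x, evalAt x f = evalAt x g) : f = g :=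
  Smooth.ext h

/-- The coordinate function `x^i` centred at `x₀`. -/
def ccoord (x₀ : Fin n → ℝ) (i : Fin n) : Smooth n := coord i - algebraMap ℝ _ (x₀ i)

/-- The Euler operator centred at `x₀`. -/
def euler (x₀ : Fin n → ℝ) (f : Smooth n) : Smooth n := ∑ i, ccoord x₀ i * pd i f

theorem evalAt_ccoord (x₀ x : Fin n → ℝ) (i : Fin n) : evalAt x (ccoord x₀ i) = x i - x₀ i := rfl

theorem fderiv_eq_sum (f : Smooth n) (x v : Fin n → ℝ) :
    fderiv ℝ f.1 x v = ∑ i, v i * evalAt x (pd i f) := by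
  conv_lhs => rw [pi_eq_sum_univ' v]
  simp only [map_sum, map_smul, smul_eq_mul]
  rfl

theorem evalAt_euler (x₀ x : Fin n → ℝ) (f : Smooth n) :
    evalAt x (euler x₀ f) = fderiv ℝ f.1 x (x - x₀) := by
  simp [euler, fderiv_eq_sum, evalAt_ccoord]

/-! ### Calculus of partial derivatives on `Smooth n`. -/

theorem pd_mul (i : Fin n) (f g : Smooth n) : pd i (f * g) = f * pd i g + g * pd i f := by
  refine Smooth.ext fun x => ?_
  change fderiv ℝ (f.1 * g.1) x _ = _
  rw [fderiv_mul (f.differentiableAt x) (g.differentiableAt x)]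
  rfl

theorem pd_algebraMap (i : Fin n) (c : ℝ) : pd i (algebraMap ℝ (Smooth n) c) = 0 := by
  refine Smooth.ext fun x => ?_
  change fderiv ℝ (fun _ => c) x _ = _
  rw [fderiv_const_apply]
  rfl

theorem pd_one (i : Fin n) : pd i (1 : Smooth n) = 0 := by
  simpa using pd_algebraMap i 1

theorem pd_coord (i j : Fin n) : pd i (coord j) = if i = j then (1 : Smooth n) else 0 := by
  refine Smooth.ext fun x => ?_
  change fderiv ℝ (fun x : Fin n → ℝ => x j) x _ = _
  rw [(hasFDerivAt_apply j x).fderiv]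
  change (Pi.single i 1 : Fin n → ℝ) j = _
  rw [Pi.single_apply]
  by_cases h : i = j
  · simp only [h, if_true]; rfl
  · rw [if_neg h, if_neg (Ne.symm h)]; rfl

theorem pd_ccoord (x₀ : Fin n → ℝ) (i j : Fin n) :
    pd i (ccoord x₀ j) = if i = j then (1 : Smooth n) else 0 := by
  rw [ccoord, map_sub, pd_coord, pd_algebraMap, sub_zero]

theorem two_le_infty : (1 : ℕ∞ω) + 1 ≤ ∞ := by
  rw [one_add_one_eq_two]
  exact WithTop.coe_le_coe.2 (le_top : (2 : ℕ∞) ≤ ⊤)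

theorem pd_comm (i j : Fin n) (f : Smooth n) : pd i (pd j f) = pd j (pd i f) := by
  refine Smooth.ext fun x => ?_
  have h2 : DifferentiableAt ℝ (fderiv ℝ f.1) x :=
    ((f.contDiff.fderiv_right (m := 1) two_le_infty).differentiable one_ne_zero) x
  have key : ∀ v w : Fin n → ℝ, fderiv ℝ (fun y => fderiv ℝ f.1 y v) x w =
      fderiv ℝ (fderiv ℝ f.1) x w v := by
    intro v w
    rw [fderiv_clm_apply h2 (differentiableAt_const v)]
    simp
  change fderiv ℝ (fun y => fderiv ℝ f.1 y (Pi.single j 1)) x (Pi.single i 1) =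
    fderiv ℝ (fun y => fderiv ℝ f.1 y (Pi.single i 1)) x (Pi.single j 1)
  rw [key, key]
  exact (f.contDiff.contDiffAt.isSymmSndFDerivAt
    (by rw [minSmoothness_of_isRCLikeNormedField, ← one_add_one_eq_two]; exact two_le_infty)) _ _

theorem hasDerivAt_segment (x₀ x : Fin n → ℝ) (f : Smooth n) (t : ℝ) :
    HasDerivAt (fun t : ℝ => f.1 (x₀ + t • (x - x₀)))
      (fderiv ℝ f.1 (x₀ + t • (x - x₀)) (x - x₀)) t := by
  have h1 : HasDerivAt (fun t : ℝ => x₀ + t • (x - x₀)) (x - x₀) t := by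
    simpa using ((hasDerivAt_id t).smul_const (x - x₀)).const_add x₀
  exact (f.differentiableAt _).hasFDerivAt.comp_hasDerivAt t h1

theorem continuous_fderiv_segment (x₀ x v : Fin n → ℝ) (f : Smooth n) :
    Continuous fun t : ℝ => fderiv ℝ f.1 (x₀ + t • (x - x₀)) v := by
  have := f.contDiff.continuous_fderiv (by simp)
  fun_prop

/-- Integration by parts on [0, 1]: the Euler derivative of the average is the integral of t times
the t-derivative of f along the segment. -/
theorem euler_avg (x₀ : Fin n → ℝ) (f : Smooth n) : euler x₀ (avg x₀ f) + avg x₀ f = f := by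
  refine Smooth.ext_evalAt fun x => ?_
  rw [map_add, evalAt_euler]
  have h1 := hasFDerivAt_weightedAverage x₀ x (continuous_const (y := (1 : ℝ)))
    (f.contDiff.of_le (m := 1) (by simp))
  simp only [one_smul, one_mul] at h1
  have hc : Continuous fun t : ℝ => t • fderiv ℝ f.1 (x₀ + t • (x - x₀)) := by
    have := f.contDiff.continuous_fderiv (by simp)
    fun_prop
  have h2 : fderiv ℝ (avg x₀ f).1 x (x - x₀) =
      ∫ t in (0 : ℝ)..1, t * fderiv ℝ f.1 (x₀ + t • (x - x₀)) (x - x₀) := by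
    change fderiv ℝ (fun x => ∫ t in (0 : ℝ)..1, f.1 (x₀ + t • (x - x₀))) x (x - x₀) = _
    rw [h1.fderiv, ContinuousLinearMap.intervalIntegral_apply (hc.intervalIntegrable _ _)]
    rfl
  have h3 := intervalIntegral.integral_mul_deriv_eq_deriv_mul (a := 0) (b := 1)
    (u := fun t : ℝ => t) (u' := fun _ => 1) (fun t _ => hasDerivAt_id t)
    (fun t _ => hasDerivAt_segment x₀ x f t) (continuous_const.intervalIntegrable _ _)
    ((continuous_fderiv_segment x₀ x _ f).intervalIntegrable _ _)
  rw [h2, h3]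
  change _ + ∫ t in (0 : ℝ)..1, f.1 (x₀ + t • (x - x₀)) = f.1 x
  simp

/-- Hadamard's lemma. -/
theorem hadamard (x₀ : Fin n → ℝ) (f : Smooth n) :
    f = algebraMap ℝ _ (evalAt x₀ f) + ∑ i, ccoord x₀ i * avg x₀ (pd i f) := by
  refine Smooth.ext_evalAt fun x => ?_
  rw [map_add, map_sum]
  have h1 := intervalIntegral.integral_eq_sub_of_hasDerivAt (a := 0) (b := 1)
    (fun t _ => hasDerivAt_segment x₀ x f t)
    ((continuous_fderiv_segment x₀ x _ f).intervalIntegrable _ _)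
  have h2 : ∫ t in (0 : ℝ)..1, fderiv ℝ f.1 (x₀ + t • (x - x₀)) (x - x₀) =
      ∑ i, evalAt x (ccoord x₀ i * avg x₀ (pd i f)) := by
    simp_rw [fderiv_eq_sum f _ (x - x₀)]
    rw [intervalIntegral.integral_finsetSum]
    · refine Finset.sum_congr rfl fun i _ => ?_
      rw [intervalIntegral.integral_const_mul, map_mul]
      rfl
    · intro i _
      exact ((continuous_fderiv_segment x₀ x _ f).const_smul ((x - x₀) i)).intervalIntegrable _ _
  rw [← h2, h1]
  change f.1 x = f.1 x₀ + _
  simp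

/-- The ideal of functions vanishing at `x₀`. -/
def vanishing (x₀ : Fin n → ℝ) : Ideal (Smooth n) := RingHom.ker (evalAt x₀)

theorem ccoord_mem_vanishing (x₀ : Fin n → ℝ) (i : Fin n) : ccoord x₀ i ∈ vanishing x₀ := by
  simp [vanishing, RingHom.mem_ker, evalAt_ccoord]

/-- Hadamard's lemma applied to one factor that vanishes at x₀. It makes induction on the order of
vanishing possible. -/
theorem exists_sum_of_mem_vanishing_pow_succ {x₀ : Fin n → ℝ} {r : ℕ} {f : Smooth n}
    (hf : f ∈ vanishing x₀ ^ (r + 1)) :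
    ∃ g : Fin n → Smooth n, (∀ i, g i ∈ vanishing x₀ ^ r) ∧ f = ∑ i, ccoord x₀ i * g i := by
  rw [pow_succ'] at hf
  induction hf using Submodule.mul_induction_on' with
  | mem_mul_mem a ha b hb =>
    refine ⟨fun i => avg x₀ (pd i a) * b, fun i => Ideal.mul_mem_left _ _ hb, ?_⟩
    have ha0 : evalAt x₀ a = 0 := ha
    conv_lhs => rw [hadamard x₀ a, ha0, map_zero, zero_add]
    rw [Finset.sum_mul]
    exact Finset.sum_congr rfl fun i _ => mul_assoc _ _ _
  | add a _ b _ ha hb =>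
    obtain ⟨g, hg, rfl⟩ := ha
    obtain ⟨g', hg', rfl⟩ := hb
    refine ⟨g + g', fun i => Ideal.add_mem _ (hg i) (hg' i), ?_⟩
    simp [mul_add, Finset.sum_add_distrib]

theorem euler_ccoord_mul (x₀ : Fin n → ℝ) (i : Fin n) (g : Smooth n) :
    euler x₀ (ccoord x₀ i * g) = ccoord x₀ i * euler x₀ g + ccoord x₀ i * g := by
  simp only [euler, pd_mul, pd_ccoord, mul_add, Finset.sum_add_distrib, Finset.mul_sum]
  congr 1
  · exact Finset.sum_congr rfl fun j _ => by ring
  · simp [mul_comm]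

theorem euler_sum (x₀ : Fin n → ℝ) {ι : Type} (s : Finset ι) (g : ι → Smooth n) :
    euler x₀ (∑ i ∈ s, g i) = ∑ i ∈ s, euler x₀ (g i) := by
  simp only [euler, map_sum, Finset.mul_sum]
  exact Finset.sum_comm

/-- Division of the functions vanishing to order `r` at `x₀` by a shifted Euler operator. -/
theorem exists_euler_eq (x₀ : Fin n → ℝ) (r : ℕ) : ∀ f ∈ vanishing x₀ ^ r,
    ∃ g, euler x₀ g + (1 - (r : ℝ)) • g = f := by
  induction r with
  | zero => exact fun f _ => ⟨avg x₀ f, by simpa using euler_avg x₀ f⟩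
  | succ r ih =>
    intro f hf
    obtain ⟨g, hg, rfl⟩ := exists_sum_of_mem_vanishing_pow_succ hf
    choose u hu using fun i => ih (g i) (hg i)
    -- Since E(yu) = y(E + 1)u for a centred coordinate y, multiplication by y turns a solution for
    -- r into one for r + 1.
    refine ⟨∑ i, ccoord x₀ i * u i, ?_⟩
    rw [euler_sum, Finset.smul_sum, ← Finset.sum_add_distrib]
    refine Finset.sum_congr rfl fun i _ => ?_
    rw [euler_ccoord_mul, ← hu i, mul_add, mul_smul_comm, add_assoc]
    congr 1
    rw [Nat.cast_succ, ← sub_sub, sub_smul _ (1 : ℝ) (ccoord x₀ i * u i), one_smul]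
    abel

/-- The polynomial functions on `ℝⁿ`. -/
def polyFun (n : ℕ) : MvPolynomial (Fin n) ℝ →ₐ[ℝ] Smooth n := MvPolynomial.aeval coord

theorem polyFun_X (i : Fin n) : polyFun n (MvPolynomial.X i) = coord i := by simp [polyFun]

theorem polyFun_C (c : ℝ) : polyFun n (MvPolynomial.C c) = algebraMap ℝ _ c := by simp [polyFun]

theorem pd_polyFun (i : Fin n) (p : MvPolynomial (Fin n) ℝ) :
    pd i (polyFun n p) = polyFun n (MvPolynomial.pderiv i p) := by
  induction p using MvPolynomial.induction_on with
  | C a => rw [polyFun_C, pd_algebraMap, MvPolynomial.pderiv_C, map_zero]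
  | add p q hp hq => rw [map_add, map_add, map_add, hp, hq, map_add]
  | mul_X p j hp =>
    rw [map_mul, pd_mul, hp, polyFun_X, pd_coord, MvPolynomial.pderiv_mul, map_add, map_mul,
      map_mul, polyFun_X, MvPolynomial.pderiv_X, Pi.single_apply]
    split_ifs with h1 h2 h2
    · simp [mul_comm, add_comm]
    · exact absurd h1.symm h2
    · exact absurd h2.symm h1
    · simp [mul_comm]

theorem ccoord_eq_polyFun (x₀ : Fin n → ℝ) (i : Fin n) :
    ccoord x₀ i = polyFun n (MvPolynomial.X i - MvPolynomial.C (x₀ i)) := by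
  rw [map_sub, polyFun_X, polyFun_C, ccoord]

/-- Every smooth function is, to any finite order at a point, a polynomial function. -/
theorem exists_polyFun_sub_mem (x₀ : Fin n → ℝ) (r : ℕ) : ∀ f : Smooth n,
    ∃ p, f - polyFun n p ∈ vanishing x₀ ^ r := by
  induction r with
  | zero => exact fun f => ⟨0, by simp⟩
  | succ r ih =>
    intro f
    choose p hp using fun i => ih (avg x₀ (pd i f))
    -- Taylor expansion: the Hadamard quotients are approximated to order r, and the centred
    -- coordinate in front supplies the missing order.
    refine ⟨MvPolynomial.C (evalAt x₀ f) +
      ∑ i, (MvPolynomial.X i - MvPolynomial.C (x₀ i)) * p i, ?_⟩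
    nth_rw 1 [hadamard x₀ f]
    rw [map_add, map_sum, polyFun_C, add_sub_add_left_eq_sub, ← Finset.sum_sub_distrib]
    refine Ideal.sum_mem _ fun i _ => ?_
    rw [map_mul, ← ccoord_eq_polyFun, ← mul_sub, pow_succ']
    exact Ideal.mul_mem_mul (ccoord_mem_vanishing x₀ i) (hp i)

/-! ### Orders of differential operators -/

section Order

variable {M M' M'' : Type} [AddCommGroup M] [Module ℝ M] [Module (Smooth n) M]
  [IsScalarTower ℝ (Smooth n) M]
  [AddCommGroup M'] [Module ℝ M'] [Module (Smooth n) M'] [IsScalarTower ℝ (Smooth n) M']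
  [AddCommGroup M''] [Module ℝ M''] [Module (Smooth n) M''] [IsScalarTower ℝ (Smooth n) M'']

theorem opComm_apply (A : M →ₗ[ℝ] M') (f : Smooth n) (m : M) :
    opComm A f m = A (f • m) - f • A m := rfl

theorem opComm_add (A B : M →ₗ[ℝ] M') (f : Smooth n) :
    opComm (A + B) f = opComm A f + opComm B f := by
  ext m
  simp only [opComm_apply, LinearMap.add_apply, smul_add]
  abel

theorem opComm_zero (f : Smooth n) : opComm (0 : M →ₗ[ℝ] M') f = 0 := by
  ext m
  simp [opComm_apply]

theorem opComm_smul (c : ℝ) (A : M →ₗ[ℝ] M') (f : Smooth n) :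
    opComm (c • A) f = c • opComm A f := by
  ext m
  simp only [opComm_apply, LinearMap.smul_apply, smul_sub]
  rw [smul_comm f c]

theorem opComm_sub (A B : M →ₗ[ℝ] M') (f : Smooth n) :
    opComm (A - B) f = opComm A f - opComm B f := by
  ext m
  simp only [opComm_apply, LinearMap.sub_apply, smul_sub]
  abel

theorem opComm_comp (A : M' →ₗ[ℝ] M'') (B : M →ₗ[ℝ] M') (f : Smooth n) :
    opComm (A ∘ₗ B) f = A ∘ₗ opComm B f + opComm A f ∘ₗ B := by
  ext m
  simp only [opComm_apply, LinearMap.comp_apply, LinearMap.add_apply, map_sub]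
  abel

theorem opComm_comm (A : M →ₗ[ℝ] M') (f g : Smooth n) :
    opComm (opComm A f) g = opComm (opComm A g) f := by
  ext m
  simp only [opComm_apply, smul_sub, smul_smul, mul_comm f g]
  abel

theorem orderLT_zero_map (k : ℕ) : OrderLT n k (0 : M →ₗ[ℝ] M') := by
  induction k with
  | zero => rfl
  | succ k ih => exact fun f => by rw [opComm_zero]; exact ih

theorem OrderLT.add {k : ℕ} {A B : M →ₗ[ℝ] M'} (hA : OrderLT n k A) (hB : OrderLT n k B) :
    OrderLT n k (A + B) := by
  induction k generalizing A B with
  | zero => rw [show A = 0 from hA, show B = 0 from hB, add_zero]; rfl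
  | succ k ih => exact fun f => by rw [opComm_add]; exact ih (hA f) (hB f)

theorem OrderLT.smul {k : ℕ} {A : M →ₗ[ℝ] M'} (c : ℝ) (hA : OrderLT n k A) :
    OrderLT n k (c • A) := by
  induction k generalizing A with
  | zero => rw [show A = 0 from hA, smul_zero]; rfl
  | succ k ih => exact fun f => by rw [opComm_smul]; exact ih (hA f)

theorem OrderLT.sub {k : ℕ} {A B : M →ₗ[ℝ] M'} (hA : OrderLT n k A) (hB : OrderLT n k B) :
    OrderLT n k (A - B) := by
  have h := hA.add (hB.smul (-1))
  rwa [neg_one_smul, ← sub_eq_add_neg] at h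

theorem orderLT_sum {ι : Type} (s : Finset ι) {k : ℕ} {A : ι → M →ₗ[ℝ] M'}
    (hA : ∀ i ∈ s, OrderLT n k (A i)) : OrderLT n k (∑ i ∈ s, A i) := by
  classical
  induction s using Finset.induction_on with
  | empty => exact orderLT_zero_map k
  | insert a s ha ih =>
    rw [Finset.sum_insert ha]
    exact (hA a (Finset.mem_insert_self a s)).add
      (ih fun i hi => hA i (Finset.mem_insert_of_mem hi))

theorem OrderLT.succ {k : ℕ} {A : M →ₗ[ℝ] M'} (hA : OrderLT n k A) : OrderLT n (k + 1) A := by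
  induction k generalizing A with
  | zero => rw [show A = 0 from hA]; exact orderLT_zero_map 1
  | succ k ih => exact fun f => ih (hA f)

theorem OrderLT.mono {k l : ℕ} (h : k ≤ l) {A : M →ₗ[ℝ] M'} (hA : OrderLT n k A) :
    OrderLT n l A := by
  induction h with
  | refl => exact hA
  | step _ ih => exact ih.succ

/-- The Leibniz rule [AB, f] = A[B, f] + [A, f]B lowers the total order by one in each summand; a
factor of order zero has zero commutator. -/
theorem OrderLT.comp {a b : ℕ} {A : M' →ₗ[ℝ] M''} {B : M →ₗ[ℝ] M'}
    (hA : OrderLT n (a + 1) A) (hB : OrderLT n (b + 1) B) : OrderLT n (a + b + 1) (A ∘ₗ B) := by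
  induction h : a + b generalizing a b A B with
  | zero =>
    obtain ⟨rfl, rfl⟩ : a = 0 ∧ b = 0 := by omega
    intro f
    rw [opComm_comp, show opComm A f = 0 from hA f, show opComm B f = 0 from hB f]
    simp only [LinearMap.comp_zero, LinearMap.zero_comp, add_zero]
    rfl
  | succ s ih =>
    intro f
    rw [opComm_comp]
    refine OrderLT.add ?_ ?_
    · rcases b with _ | b
      · rw [show opComm B f = 0 from hB f, LinearMap.comp_zero]
        exact orderLT_zero_map _
      · exact ih hA (hB f) (by omega)
    · rcases a with _ | a
      · rw [show opComm A f = 0 from hA f, LinearMap.zero_comp]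
        exact orderLT_zero_map _
      · exact ih (hA f) hB (by omega)

theorem orderLE_zero_of_linear (A : M →ₗ[Smooth n] M') :
    OrderLE n 0 (A.restrictScalars ℝ) := by
  intro f
  ext m
  simp [opComm_apply]

/-- A C^∞-linear map passes through commutators. The order of a map into a submodule can thus be
computed in the ambient module. -/
theorem orderLT_of_comp_injective (φ : M' →ₗ[Smooth n] M'') (hφ : Function.Injective φ) {k : ℕ}
    {A : M →ₗ[ℝ] M'} (h : OrderLT n k (φ.restrictScalars ℝ ∘ₗ A)) : OrderLT n k A := by
  induction k generalizing A with
  | zero =>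
    ext m
    apply hφ
    simpa using LinearMap.congr_fun (show φ.restrictScalars ℝ ∘ₗ A = 0 from h) m
  | succ k ih =>
    intro f
    apply ih
    have := h f
    rwa [opComm_comp, show opComm (φ.restrictScalars ℝ) f = 0 from orderLE_zero_of_linear φ f,
      LinearMap.zero_comp, add_zero] at this

theorem orderLT_pi_iff {ι : Type} {k : ℕ} {A : M →ₗ[ℝ] (ι → M')} :
    OrderLT n k A ↔ ∀ a, OrderLT n k ((LinearMap.proj a : (ι → M') →ₗ[ℝ] M') ∘ₗ A) := by
  induction k generalizing A with
  | zero =>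
    refine ⟨fun h a => ?_, fun h => ?_⟩
    · rw [show A = 0 from h]; exact LinearMap.comp_zero _
    · ext m a
      exact LinearMap.congr_fun
        (show (LinearMap.proj a : (ι → M') →ₗ[ℝ] M') ∘ₗ A = 0 from h a) m
  | succ k ih =>
    have key : ∀ (f : Smooth n) (a : ι), opComm ((LinearMap.proj a : (ι → M') →ₗ[ℝ] M') ∘ₗ A) f =
        (LinearMap.proj a : (ι → M') →ₗ[ℝ] M') ∘ₗ opComm A f := by
      intro f a
      ext m
      simp [opComm_apply]
    refine ⟨fun h a f => ?_, fun h f => ?_⟩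
    · rw [key]; exact ih.1 (h f) a
    · exact ih.2 fun a => by rw [← key]; exact h a f

end Order

/-- Constants commute with A, so f may be replaced by f - f(x) before evaluating at x; then the term
f · A g drops out. -/
theorem opComm_evalAt (A : Smooth n →ₗ[ℝ] Smooth n) (f g : Smooth n) (x : Fin n → ℝ) :
    evalAt x (opComm A f g) = evalAt x (A ((f - algebraMap ℝ _ (evalAt x f)) * g)) := by
  have h : A (algebraMap ℝ _ (evalAt x f) * g) = evalAt x f • A g := by
    rw [← map_smul, Algebra.smul_def]
  rw [opComm_apply, sub_mul, map_sub A, map_sub, map_sub, h, smul_eq_mul, smul_eq_mul,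
    map_mul (evalAt x), map_smul, smul_eq_mul]

/-- An operator has order less than `k` if and only if it sends the functions that vanish to order
`k` at a point to functions that vanish at this point. -/
theorem orderLT_iff_vanishing {k : ℕ} {A : Smooth n →ₗ[ℝ] Smooth n} :
    OrderLT n k A ↔ ∀ x, ∀ g ∈ vanishing x ^ k, evalAt x (A g) = 0 := by
  induction k generalizing A with
  | zero =>
    refine ⟨fun h x g _ => ?_, fun h => ?_⟩
    · rw [show A = 0 from h, LinearMap.zero_apply, map_zero]
    · ext g
      exact Smooth.ext_evalAt fun x => by simpa using h x g (by simp)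
  | succ k ih =>
    refine ⟨fun h x g hg => ?_, fun h f => ih.2 fun x g hg => ?_⟩
    · obtain ⟨u, hu, rfl⟩ := exists_sum_of_mem_vanishing_pow_succ hg
      rw [map_sum, map_sum]
      refine Finset.sum_eq_zero fun i _ => ?_
      have h1 := ih.1 (h (ccoord x i)) x (u i) (hu i)
      rwa [opComm_evalAt, evalAt_ccoord, sub_self, map_zero, sub_zero] at h1
    · rw [opComm_evalAt]
      refine h x _ ?_
      rw [pow_succ']
      refine Ideal.mul_mem_mul ?_ hg
      simp [vanishing, RingHom.mem_ker]

/-- The order can be tested on commutators with the coordinate functions. -/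
theorem orderLT_succ_of_coord {k : ℕ} {A : Smooth n →ₗ[ℝ] Smooth n}
    (h : ∀ i : Fin n, OrderLT n k (opComm A (coord i))) : OrderLT n (k + 1) A := by
  refine orderLT_iff_vanishing.2 fun x g hg => ?_
  obtain ⟨u, hu, rfl⟩ := exists_sum_of_mem_vanishing_pow_succ hg
  rw [map_sum, map_sum]
  refine Finset.sum_eq_zero fun i _ => ?_
  have h1 := orderLT_iff_vanishing.1 (h i) x (u i) (hu i)
  rw [opComm_evalAt] at h1
  exact h1

/-! ### Lie derivatives of operators on densities. -/

theorem densityAction_apply (lam : ℝ) (X : VField n) (f : Smooth n) :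
    densityAction lam X f = ∑ i, X i * pd i f + lam • (vdiv X * f) := by
  simp [densityAction]

theorem opComm_densityAction (lam : ℝ) (X : VField n) (f : Smooth n) :
    opComm (densityAction lam X) f = Algebra.lsmul ℝ ℝ (Smooth n) (∑ i, X i * pd i f) := by
  ext g
  simp only [opComm_apply, densityAction_apply, smul_eq_mul, pd_mul, Algebra.lsmul_coe, mul_add,
    Finset.sum_add_distrib, Finset.sum_mul, Finset.mul_sum, mul_smul_comm]
  have h1 : ∀ i, X i * (f * pd i g) = f * (X i * pd i g) := fun i => by ring
  have h2 : ∀ i, X i * (g * pd i f) = X i * pd i f * g := fun i => by ring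
  simp only [h1, h2, mul_left_comm (vdiv X) f g]
  abel

/-- Writing L_X for the action on operators, [L_X B, f] = L_X [B, f] - [B, X f]. Hence the action
does not raise the order, although ℓ_X itself has order one. -/
theorem OrderLT.operatorAction {k : ℕ} (lam mu : ℝ) (X : VField n) {B : Smooth n →ₗ[ℝ] Smooth n}
    (hB : OrderLT n k B) : OrderLT n k (operatorAction lam mu X B) := by
  induction k generalizing B with
  | zero =>
    rw [show B = 0 from hB]
    change _ = _
    simp [ProjQuant.operatorAction]
  | succ k ih =>
    intro f
    have key : opComm (ProjQuant.operatorAction lam mu X B) f =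
        ProjQuant.operatorAction lam mu X (opComm B f) - opComm B (∑ i, X i * pd i f) := by
      rw [ProjQuant.operatorAction, opComm_sub, opComm_comp, opComm_comp, opComm_densityAction,
        opComm_densityAction, ProjQuant.operatorAction]
      ext g
      simp only [LinearMap.sub_apply, LinearMap.add_apply, LinearMap.comp_apply, opComm_apply,
        Algebra.lsmul_coe]
      abel
    rw [key]
    exact (ih (hB f)).sub (hB _)

/-! ### Derivatives of symbols -/

section Derivatives

open MvPolynomial

theorem baseD_monomial (i : Fin n) (m : Fin n →₀ ℕ) (f : Smooth n) :
    baseD i (monomial m f) = monomial m (pd i f) := by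
  ext1 d
  rw [baseD, coeff_coeffMap, coeff_monomial, coeff_monomial]
  split_ifs <;> simp

theorem baseD_C (i : Fin n) (f : Smooth n) : baseD i (C f) = C (pd i f) :=
  baseD_monomial i 0 f

theorem baseD_mul (i : Fin n) (P Q : FibrePoly n) :
    baseD i (P * Q) = P * baseD i Q + Q * baseD i P := by
  induction P using MvPolynomial.induction_on' with
  | add P P' h h' => rw [add_mul, map_add, h, h', map_add]; ring
  | monomial m f =>
    induction Q using MvPolynomial.induction_on' with
    | add Q Q' h h' => rw [mul_add, map_add, h, h', map_add]; ring
    | monomial m' f' =>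
      simp only [monomial_mul, baseD_monomial, pd_mul, map_add, add_comm m' m]

theorem baseD_X (i j : Fin n) : baseD i (X j : FibrePoly n) = 0 := by
  rw [X, baseD_monomial, pd_one, map_zero]

theorem baseD_smul (i : Fin n) (f : Smooth n) (P : FibrePoly n) :
    baseD i (f • P) = f • baseD i P + pd i f • P := by
  rw [smul_eq_C_mul, baseD_mul, baseD_C, smul_eq_C_mul, smul_eq_C_mul]
  ring

theorem baseD_comm (i j : Fin n) (P : FibrePoly n) : baseD i (baseD j P) = baseD j (baseD i P) := by
  ext1 d
  simp only [baseD, coeff_coeffMap, pd_comm i j]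

theorem fibreD_apply (i : Fin n) (P : FibrePoly n) : fibreD i P = pderiv i P := rfl

theorem fibreD_mul (i : Fin n) (P Q : FibrePoly n) :
    fibreD i (P * Q) = P * fibreD i Q + Q * fibreD i P := by
  simp only [fibreD_apply, pderiv_mul]
  ring

theorem fibreD_C (i : Fin n) (f : Smooth n) : fibreD i (C f) = 0 := pderiv_C

theorem fibreD_X (i j : Fin n) : fibreD i (X j : FibrePoly n) = if i = j then 1 else 0 := by
  rw [fibreD_apply, pderiv_X, Pi.single_apply]
  simp only [eq_comm]

theorem fibreD_smul (i : Fin n) (f : Smooth n) (P : FibrePoly n) :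
    fibreD i (f • P) = f • fibreD i P := by
  simp only [fibreD_apply, Derivation.map_smul]

theorem baseD_fibreD_comm (i j : Fin n) (P : FibrePoly n) :
    baseD i (fibreD j P) = fibreD j (baseD i P) := by
  ext1 d
  rw [baseD, coeff_coeffMap, fibreD_apply, fibreD_apply, coeff_pderiv, coeff_pderiv,
    coeff_coeffMap]
  have h : ((d j : Smooth n) + 1) = algebraMap ℝ _ (d j + 1) := by simp
  rw [h, mul_comm, ← Algebra.smul_def, map_smul, Algebra.smul_def, mul_comm]

theorem fibreD_comm (i j : Fin n) (P : FibrePoly n) :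
    fibreD i (fibreD j P) = fibreD j (fibreD i P) := by
  ext1 d
  simp only [fibreD_apply, coeff_pderiv, Finsupp.add_apply, add_right_comm _ (Finsupp.single i 1)]
  by_cases h : i = j
  · subst h; rfl
  · simp only [Finsupp.single_apply, if_neg h, if_neg (Ne.symm h)]
    ring_nf

theorem fibreD_mem {k : ℕ} (i : Fin n) {P : FibrePoly n} (hP : P ∈ Symb n k) :
    fibreD i P ∈ Symb n (k - 1) := by
  rw [mem_homogeneousSubmodule] at hP ⊢
  exact hP.pderiv

theorem fibreD_eq_zero (i : Fin n) {P : FibrePoly n} (hP : P ∈ Symb n 0) : fibreD i P = 0 := by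
  rw [mem_homogeneousSubmodule] at hP
  rw [totalDegree_eq_zero_iff_eq_C.mp (Nat.le_zero.mp hP.totalDegree_le)]
  exact pderiv_C

theorem sum_X_mul_fibreD {k : ℕ} {P : FibrePoly n} (hP : P ∈ Symb n k) :
    ∑ i, X i * fibreD i P = (k : ℝ) • P := by
  rw [mem_homogeneousSubmodule] at hP
  rw [Nat.cast_smul_eq_nsmul]
  exact hP.sum_X_mul_pderiv

theorem smul_mem_symb {k : ℕ} (c : ℝ) {P : FibrePoly n} (hP : P ∈ Symb n k) :
    c • P ∈ Symb n k := by
  rw [← algebraMap_smul (Smooth n) c P]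
  exact Submodule.smul_mem _ _ hP

theorem eq_C_of_mem_symb_zero {P : FibrePoly n} (hP : P ∈ Symb n 0) : ∃ f, P = C f :=
  ⟨_, totalDegree_eq_zero_iff_eq_C.mp (Nat.le_zero.mp
    ((mem_homogeneousSubmodule _ _).1 hP).totalDegree_le)⟩

end Derivatives

/-! ### Normal ordering -/

/-- `pdMulti` is a product over a list in a fixed order; the extra factor is moved to the right end
because partial derivatives commute. Absence of repetitions ensures that it occurs exactly once. -/
theorem pdMulti_add_single (m : Fin n →₀ ℕ) (i : Fin n) :
    pdMulti (m + Finsupp.single i 1) = pdMulti m * pd i := by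
  have hc : ∀ i j : Fin n, Commute (pd i : Module.End ℝ (Smooth n)) (pd j) := fun i j => by
    ext f
    exact congrArg (fun g : Smooth n => g) (pd_comm i j f)
  have key : ∀ l : List (Fin n), l.Nodup →
      (l.map fun j => (pd j : Module.End ℝ (Smooth n)) ^
        (m + Finsupp.single i 1 : Fin n →₀ ℕ) j).prod =
        (l.map fun j => (pd j : Module.End ℝ (Smooth n)) ^ m j).prod *
          if i ∈ l then pd i else 1 := by
    intro l
    induction l with
    | nil => intro _; simp
    | cons a l ih =>
      intro hl
      rw [List.nodup_cons] at hl
      rw [List.map_cons, List.map_cons, List.prod_cons, List.prod_cons, ih hl.2]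
      by_cases h : i = a
      · subst h
        have hcl : Commute (pd i : Module.End ℝ (Smooth n))
            (l.map fun j => (pd j : Module.End ℝ (Smooth n)) ^ m j).prod :=
          Commute.list_prod_right _ _ fun x hx => by
            obtain ⟨j, _, rfl⟩ := List.mem_map.1 hx
            exact (hc i j).pow_right _
        rw [if_neg hl.1, if_pos List.mem_cons_self, mul_one, Finsupp.add_apply,
          Finsupp.single_eq_same, pow_succ, mul_assoc, mul_assoc, hcl.eq]
      · have h1 : (i ∈ a :: l) ↔ i ∈ l := by simp [h]
        simp only [h1, Finsupp.add_apply, Finsupp.single_apply, if_neg h, add_zero, mul_assoc]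
  rw [pdMulti, pdMulti, List.ofFn_eq_map, List.ofFn_eq_map, key _ (List.nodup_finRange n),
    if_pos (List.mem_finRange i)]

theorem pdMulti_zero : pdMulti (0 : Fin n →₀ ℕ) = LinearMap.id := by
  have h : ∀ l : List (Fin n),
      (l.map fun j => (pd j : Module.End ℝ (Smooth n)) ^ (0 : Fin n →₀ ℕ) j).prod = 1 := by
    intro l
    induction l with
    | nil => rfl
    | cons a l ih => rw [List.map_cons, List.prod_cons, ih]; simp
  rw [pdMulti, List.ofFn_eq_map, h]
  rfl

theorem normalOrdering_eq_sum (P : FibrePoly n) {s : Finset (Fin n →₀ ℕ)} (hs : P.support ⊆ s) :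
    normalOrdering P = ∑ m ∈ s, Algebra.lsmul ℝ ℝ (Smooth n) (P.coeff m) ∘ₗ pdMulti m := by
  refine Finset.sum_subset hs fun m _ hm => ?_
  rw [MvPolynomial.notMem_support_iff.1 hm, map_zero, LinearMap.zero_comp]

/-- Normal ordering as a linear map. -/
def nord (n : ℕ) : FibrePoly n →ₗ[ℝ] Module.End ℝ (Smooth n) where
  toFun := normalOrdering
  map_add' P Q := by
    classical
    rw [normalOrdering_eq_sum P (Finset.subset_union_left (s₂ := Q.support)),
      normalOrdering_eq_sum Q (Finset.subset_union_right (s₁ := P.support)),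
      normalOrdering_eq_sum (P + Q) MvPolynomial.support_add, ← Finset.sum_add_distrib]
    refine Finset.sum_congr rfl fun m _ => ?_
    rw [MvPolynomial.coeff_add, map_add, LinearMap.add_comp]
  map_smul' c P := by
    rw [normalOrdering_eq_sum (c • P) MvPolynomial.support_smul, RingHom.id_apply, normalOrdering,
      Finset.smul_sum]
    refine Finset.sum_congr rfl fun m _ => ?_
    rw [MvPolynomial.coeff_smul, map_smul]
    rfl

theorem nord_apply (P : FibrePoly n) : nord n P = normalOrdering P := rfl

theorem nord_monomial (m : Fin n →₀ ℕ) (f : Smooth n) :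
    nord n (MvPolynomial.monomial m f) = Algebra.lsmul ℝ ℝ (Smooth n) f ∘ₗ pdMulti m := by
  classical
  rw [nord_apply, normalOrdering_eq_sum _ MvPolynomial.support_monomial_subset,
    Finset.sum_singleton, MvPolynomial.coeff_monomial, if_pos rfl]

theorem nord_C (f : Smooth n) : nord n (MvPolynomial.C f) = Algebra.lsmul ℝ ℝ (Smooth n) f := by
  rw [← MvPolynomial.monomial_zero', nord_monomial, pdMulti_zero, LinearMap.comp_id]

theorem nord_mul_X (P : FibrePoly n) (i : Fin n) :
    nord n (P * MvPolynomial.X i) = nord n P ∘ₗ pd i := by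
  induction P using MvPolynomial.induction_on' with
  | add P Q h h' => rw [add_mul, map_add, h, h', map_add, LinearMap.add_comp]
  | monomial m f =>
    rw [MvPolynomial.X, MvPolynomial.monomial_mul, mul_one, nord_monomial, nord_monomial,
      pdMulti_add_single]
    rfl

theorem nord_smul (f : Smooth n) (P : FibrePoly n) :
    nord n (f • P) = Algebra.lsmul ℝ ℝ (Smooth n) f ∘ₗ nord n P := by
  induction P using MvPolynomial.induction_on' with
  | add P Q h h' => rw [smul_add, map_add, h, h', map_add, LinearMap.comp_add]
  | monomial m g =>
    rw [MvPolynomial.smul_monomial, nord_monomial, nord_monomial, smul_eq_mul, map_mul]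
    rfl

/-- Commutators with coordinates correspond to fibre derivatives of the symbol. Orders and principal
symbols are then handled by induction on the fibre degree. -/
theorem opComm_nord (P : FibrePoly n) (i : Fin n) :
    opComm (nord n P) (coord i) = nord n (fibreD i P) := by
  induction P using MvPolynomial.induction_on with
  | C f =>
    rw [nord_C, fibreD_C, map_zero]
    ext g
    simp only [opComm_apply, Algebra.lsmul_coe, smul_eq_mul, LinearMap.zero_apply]
    ring
  | add P Q h h' => rw [map_add, opComm_add, h, h', map_add, map_add]
  | mul_X P j h =>
    rw [nord_mul_X, opComm_comp, h, fibreD_mul, fibreD_X, map_add, mul_comm _ (fibreD i P),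
      nord_mul_X]
    congr 1
    have h1 : opComm (pd j) (coord i) = if i = j then LinearMap.id else (0 : Smooth n →ₗ[ℝ] _) := by
      ext g
      rw [opComm_apply, smul_eq_mul, pd_mul, pd_coord, smul_eq_mul]
      by_cases hij : i = j
      · rw [if_pos hij, if_pos hij.symm, LinearMap.id_apply]; ring
      · rw [if_neg hij, if_neg (Ne.symm hij), LinearMap.zero_apply]; ring
    rw [h1]
    split_ifs
    · rw [mul_one, LinearMap.comp_id]
    · rw [mul_zero, map_zero, LinearMap.comp_zero]

theorem orderLE_nord {k : ℕ} {P : FibrePoly n} (hP : P ∈ Symb n k) : OrderLE n k (nord n P) := by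
  induction k generalizing P with
  | zero =>
    refine orderLT_succ_of_coord fun i => ?_
    rw [opComm_nord, fibreD_eq_zero i hP, map_zero]
    rfl
  | succ k ih =>
    refine orderLT_succ_of_coord fun i => ?_
    rw [opComm_nord]
    exact ih (fibreD_mem i hP)

/-- By induction all fibre derivatives of P vanish, and Euler's identity recovers P from them in
positive degree. This gives uniqueness of the principal symbol. -/
theorem eq_zero_of_orderLT_nord {k : ℕ} {P : FibrePoly n} (hP : P ∈ Symb n k)
    (h : OrderLT n k (nord n P)) : P = 0 := by
  induction k generalizing P with
  | zero =>
    obtain ⟨f, rfl⟩ := eq_C_of_mem_symb_zero hP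
    have h1 := LinearMap.congr_fun (show nord n (MvPolynomial.C f) = 0 from h) 1
    rw [nord_C] at h1
    have h2 : f = 0 := by simpa using h1
    rw [h2, map_zero]
  | succ k ih =>
    have h1 : ∀ i, fibreD i P = 0 := fun i => ih (fibreD_mem i hP) (by
      rw [← opComm_nord]; exact h (coord i))
    have h2 := sum_X_mul_fibreD hP
    simp only [h1, mul_zero, Finset.sum_const_zero] at h2
    exact (smul_eq_zero.1 h2.symm).resolve_left (by positivity)

/-- Every differential operator has a principal symbol. -/
theorem exists_symbol {k : ℕ} {B : Smooth n →ₗ[ℝ] Smooth n} (hB : OrderLT n (k + 1) B) :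
    ∃ P ∈ Symb n k, OrderLT n k (B - nord n P) := by
  induction k generalizing B with
  | zero =>
    refine ⟨MvPolynomial.C (B 1), MvPolynomial.isHomogeneous_C _ _, ?_⟩
    change _ = _
    ext f
    have h1 := LinearMap.congr_fun (show opComm B f = 0 from hB f) 1
    rw [opComm_apply, smul_eq_mul, mul_one, LinearMap.zero_apply, sub_eq_zero, smul_eq_mul] at h1
    rw [LinearMap.sub_apply, nord_C, Algebra.lsmul_coe, h1, LinearMap.zero_apply, sub_eq_zero]
    exact mul_comm _ _
  | succ k ih =>
    choose S hS hS' using fun i : Fin n => ih (hB (coord i))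
    -- Integrability condition for the candidate gradient (S_i), obtained from the symmetry of the
    -- double commutators [[B, x_i], x_j].
    have hcomm : ∀ i j, fibreD j (S i) = fibreD i (S j) := by
      intro i j
      rcases k with _ | k
      · rw [fibreD_eq_zero j (hS i), fibreD_eq_zero i (hS j)]
      · rw [← sub_eq_zero]
        refine eq_zero_of_orderLT_nord
          (Submodule.sub_mem _ (fibreD_mem j (hS i)) (fibreD_mem i (hS j))) ?_
        have h1 := hS' i (coord j)
        have h2 := hS' j (coord i)
        rw [opComm_sub, opComm_nord] at h1 h2
        have h3 := h2.sub h1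
        rw [opComm_comm B (coord j) (coord i), sub_sub_sub_cancel_left, ← map_sub] at h3
        exact h3
    have hk : ((k : ℝ) + 1) ≠ 0 := by positivity
    -- The only possible primitive, by Euler's identity in degree k + 1; `hcomm` shows that its
    -- fibre derivatives are the S_j.
    refine ⟨((k : ℝ) + 1)⁻¹ • ∑ i, MvPolynomial.X i * S i, smul_mem_symb _
      (Submodule.sum_mem _ fun i _ => ?_), ?_⟩
    · have := (MvPolynomial.isHomogeneous_X (Smooth n) i).mul
        ((MvPolynomial.mem_homogeneousSubmodule _ _).1 (hS i))
      rwa [add_comm] at this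
    · refine orderLT_succ_of_coord fun j => ?_
      rw [opComm_sub, opComm_nord]
      have h4 : fibreD j (((k : ℝ) + 1)⁻¹ • ∑ i, MvPolynomial.X i * S i) = S j := by
        rw [map_smul, map_sum]
        simp only [fibreD_mul, fibreD_X, hcomm _ j, Finset.sum_add_distrib, sum_X_mul_fibreD (hS j)]
        simp only [mul_ite, mul_one, mul_zero, Finset.sum_ite_eq, Finset.mem_univ, if_true]
        rw [show ∀ Q : FibrePoly n, (k : ℝ) • Q + Q = ((k : ℝ) + 1) • Q from fun Q => by
          rw [add_smul, one_smul], smul_smul, inv_mul_cancel₀ hk, one_smul]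
      rw [h4]
      exact hS' j

/-! ### Equivariance of normal ordering -/

theorem symbolAction_apply (δ : ℝ) (X : VField n) (P : FibrePoly n) :
    symbolAction δ X P = ∑ i, X i • baseD i P -
      ∑ i, ∑ j, (MvPolynomial.X j * MvPolynomial.C (pd i (X j)) : FibrePoly n) * fibreD i P +
      δ • (vdiv X • P) := by
  simp [symbolAction, LinearMap.sum_apply, mul_assoc]

theorem symbolAction_C (δ : ℝ) (X : VField n) (f : Smooth n) :
    symbolAction δ X (MvPolynomial.C f) = MvPolynomial.C (densityAction δ X f) := by
  simp only [symbolAction_apply, fibreD_C, mul_zero, Finset.sum_const_zero, sub_zero,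
    densityAction_apply, map_add, map_sum, baseD_C, MvPolynomial.smul_eq_C_mul, map_mul]
  congr 1
  rw [Algebra.smul_def, Algebra.smul_def, map_mul, map_mul]
  rfl

theorem symbolAction_mul_X (δ : ℝ) (X : VField n) (P : FibrePoly n) (i : Fin n) :
    symbolAction δ X (P * MvPolynomial.X i) = symbolAction δ X P * MvPolynomial.X i -
      P * ∑ j, MvPolynomial.X j * MvPolynomial.C (pd i (X j)) := by
  have h1 : ∀ i', X i' • baseD i' (P * MvPolynomial.X i) =
      X i' • baseD i' P * MvPolynomial.X i := by
    intro i'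
    rw [baseD_mul, baseD_X, mul_zero, zero_add, smul_mul_assoc, mul_comm]
  have h2 : ∀ i' j, (MvPolynomial.X j * MvPolynomial.C (pd i' (X j)) : FibrePoly n) *
      fibreD i' (P * MvPolynomial.X i) =
      MvPolynomial.X j * MvPolynomial.C (pd i' (X j)) * fibreD i' P * MvPolynomial.X i +
        if i' = i then P * (MvPolynomial.X j * MvPolynomial.C (pd i' (X j))) else 0 := by
    intro i' j
    rw [fibreD_mul, fibreD_X]
    split_ifs <;> ring
  simp only [symbolAction_apply, h1, h2, Finset.sum_add_distrib, Finset.sum_mul, add_mul, sub_mul,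
    smul_mul_assoc, Finset.mul_sum]
  rw [Finset.sum_comm (f := fun i' j => if i' = i then
    P * (MvPolynomial.X j * MvPolynomial.C (pd i' (X j))) else 0)]
  simp only [Finset.sum_ite_eq', Finset.mem_univ, if_true]
  abel

/-- The correction is the bracket of ∂_i with the density action. It supports inductions on the
symbol one factor p_i at a time. -/
theorem operatorAction_comp_pd (lam mu : ℝ) (X : VField n) (B : Smooth n →ₗ[ℝ] Smooth n)
    (i : Fin n) : operatorAction lam mu X (B ∘ₗ pd i) = operatorAction lam mu X B ∘ₗ pd i -
      B ∘ₗ (∑ j, Algebra.lsmul ℝ ℝ (Smooth n) (pd i (X j)) ∘ₗ pd j +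
        lam • Algebra.lsmul ℝ ℝ (Smooth n) (pd i (vdiv X))) := by
  have h : pd i ∘ₗ densityAction lam X = densityAction lam X ∘ₗ pd i +
      (∑ j, Algebra.lsmul ℝ ℝ (Smooth n) (pd i (X j)) ∘ₗ pd j +
        lam • Algebra.lsmul ℝ ℝ (Smooth n) (pd i (vdiv X))) := by
    ext f
    simp only [LinearMap.comp_apply, densityAction_apply, map_add, map_sum, pd_mul, map_smul,
      LinearMap.add_apply, LinearMap.sum_apply, Algebra.lsmul_coe, LinearMap.smul_apply,
      smul_eq_mul, Finset.sum_add_distrib, smul_add, pd_comm i, mul_comm (pd _ f)]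
    rw [mul_comm f]
    abel
  rw [operatorAction, operatorAction, LinearMap.comp_assoc, h, LinearMap.comp_add,
    LinearMap.sub_comp]
  simp only [LinearMap.comp_assoc]
  abel

theorem operatorAction_nord_C (lam mu : ℝ) (X : VField n) (f : Smooth n) :
    operatorAction lam mu X (nord n (MvPolynomial.C f)) =
      nord n (symbolAction (mu - lam) X (MvPolynomial.C f)) := by
  rw [symbolAction_C, nord_C, nord_C]
  ext g
  simp only [operatorAction, LinearMap.sub_apply, LinearMap.comp_apply, densityAction_apply,
    Algebra.lsmul_coe, smul_eq_mul, pd_mul, mul_add, Finset.sum_add_distrib, add_mul,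
    Finset.sum_mul, Finset.mul_sum, Algebra.smul_def, map_sub]
  have h1 : ∀ i, X i * (g * pd i f) = X i * pd i f * g := fun i => by ring
  have h2 : ∀ i, f * (X i * pd i g) = X i * (f * pd i g) := fun i => by ring
  simp only [h1, h2]
  ring

theorem nord_mul_sum_X (P : FibrePoly n) (c : Fin n → ℝ) :
    nord n (P * ∑ j, MvPolynomial.X j * MvPolynomial.C (algebraMap ℝ (Smooth n) (c j))) =
      ∑ j, nord n P ∘ₗ (Algebra.lsmul ℝ ℝ (Smooth n) (algebraMap ℝ (Smooth n) (c j)) ∘ₗ pd j) := by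
  rw [Finset.mul_sum, map_sum]
  refine Finset.sum_congr rfl fun j _ => ?_
  have h : P * (MvPolynomial.X j * MvPolynomial.C (algebraMap ℝ (Smooth n) (c j))) =
      c j • (P * MvPolynomial.X j) := by
    rw [Algebra.smul_def, MvPolynomial.algebraMap_apply]
    ring
  rw [h, map_smul, nord_mul_X]
  ext f
  simp

/-- Normal ordering is equivariant with respect to the affine vector fields. -/
theorem operatorAction_nord_of_affine (lam mu : ℝ) {X : VField n} {c : Fin n → Fin n → ℝ}
    (hX : ∀ i j, pd i (X j) = algebraMap ℝ _ (c i j)) (P : FibrePoly n) :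
    operatorAction lam mu X (nord n P) = nord n (symbolAction (mu - lam) X P) := by
  have hadd : ∀ A B : Smooth n →ₗ[ℝ] Smooth n,
      operatorAction lam mu X (A + B) = operatorAction lam mu X A + operatorAction lam mu X B := by
    intro A B
    rw [operatorAction, LinearMap.comp_add, LinearMap.add_comp, operatorAction, operatorAction]
    abel
  have hdiv : ∀ i, pd i (vdiv X) = 0 := fun i => by
    simp [vdiv, hX, pd_algebraMap]
  induction P using MvPolynomial.induction_on with
  | C f => exact operatorAction_nord_C lam mu X f
  | add P Q h h' => rw [map_add, hadd, h, h', map_add, map_add]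
  | mul_X P i h =>
    rw [nord_mul_X, operatorAction_comp_pd, h, symbolAction_mul_X, map_sub, nord_mul_X, hdiv,
      map_zero, smul_zero, add_zero]
    simp only [hX, nord_mul_sum_X]
    congr 1
    ext f
    simp

theorem pd_inversionField (a i j : Fin n) : pd i (inversionField a j) =
    (if i = j then coord a else 0) + if i = a then coord j else 0 := by
  rw [inversionField, pd_mul, pd_coord, pd_coord]
  split_ifs <;> simp

theorem vdiv_inversionField (a : Fin n) :
    vdiv (inversionField a) = ((n : ℝ) + 1) • coord a := by
  simp only [vdiv, pd_inversionField, Finset.sum_add_distrib, if_true, Finset.sum_const,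
    Finset.card_univ, Fintype.card_fin, Finset.sum_ite_eq', Finset.mem_univ]
  rw [add_smul, one_smul, Nat.cast_smul_eq_nsmul]

/-- Moving a coordinate to the left of the derivatives costs one fibre derivative. This reordering,
together with the λ-term, produces the defect along inversions. -/
theorem nord_comp_coord (P : FibrePoly n) (a : Fin n) :
    nord n P ∘ₗ Algebra.lsmul ℝ ℝ (Smooth n) (coord a) =
      nord n (P * MvPolynomial.C (coord a) + fibreD a P) := by
  rw [map_add, ← opComm_nord, mul_comm, ← MvPolynomial.smul_eq_C_mul, nord_smul, opComm]
  abel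

/-- The defect of equivariance of normal ordering with respect to inversions. -/
def inversionDefect (lam : ℝ) (a : Fin n) (P : FibrePoly n) : FibrePoly n :=
  ∑ j, MvPolynomial.X j * fibreD j (fibreD a P) + (lam * ((n : ℝ) + 1)) • fibreD a P

theorem inversionDefect_mul_X (lam : ℝ) (a i : Fin n) (P : FibrePoly n) :
    inversionDefect lam a (P * MvPolynomial.X i) = inversionDefect lam a P * MvPolynomial.X i +
      (MvPolynomial.X i * fibreD a P + (if i = a then ∑ j, MvPolynomial.X j * fibreD j P else 0) +
        (lam * ((n : ℝ) + 1)) • (if i = a then P else 0)) := by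
  have h1 : fibreD a (P * MvPolynomial.X i) =
      fibreD a P * MvPolynomial.X i + if i = a then P else 0 := by
    rw [fibreD_mul, fibreD_X, add_comm, mul_comm]
    by_cases h : i = a
    · rw [if_pos h, if_pos h.symm, mul_one]
    · rw [if_neg h, if_neg (Ne.symm h), mul_zero]
  have h2 : ∀ j, (MvPolynomial.X j : FibrePoly n) * fibreD j (fibreD a P * MvPolynomial.X i) =
      MvPolynomial.X j * fibreD j (fibreD a P) * MvPolynomial.X i +
        if j = i then MvPolynomial.X j * fibreD a P else 0 := by
    intro j
    rw [fibreD_mul, fibreD_X]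
    split_ifs <;> ring
  simp only [inversionDefect, h1, map_add, mul_add, h2, Finset.sum_add_distrib, Finset.sum_mul,
    add_mul, smul_add, Finset.sum_ite_eq', Finset.mem_univ, if_true, smul_mul_assoc]
  have h3 : ∑ j, (MvPolynomial.X j : FibrePoly n) * fibreD j (if i = a then P else 0) =
      if i = a then ∑ j, MvPolynomial.X j * fibreD j P else 0 := by
    split_ifs <;> simp
  rw [h3]
  abel

theorem operatorAction_nord_inversionField (lam mu : ℝ) (a : Fin n) (P : FibrePoly n) :
    operatorAction lam mu (inversionField a) (nord n P) =
      nord n (symbolAction (mu - lam) (inversionField a) P - inversionDefect lam a P) := by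
  have hadd : ∀ A B : Smooth n →ₗ[ℝ] Smooth n,
      operatorAction lam mu (inversionField a) (A + B) =
        operatorAction lam mu (inversionField a) A +
          operatorAction lam mu (inversionField a) B := by
    intro A B
    rw [operatorAction, LinearMap.comp_add, LinearMap.add_comp, operatorAction, operatorAction]
    abel
  have hdadd : ∀ P Q : FibrePoly n,
      inversionDefect lam a (P + Q) = inversionDefect lam a P + inversionDefect lam a Q := by
    intro P Q
    simp only [inversionDefect, map_add, mul_add, Finset.sum_add_distrib, smul_add]
    abel
  induction P using MvPolynomial.induction_on with
  | C f =>
    rw [operatorAction_nord_C]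
    simp [inversionDefect, fibreD_C]
  | add P Q h h' => rw [map_add, hadd, h, h', map_add, hdadd, ← map_add]; congr 1; abel
  | mul_X P i h =>
    have hpd : ∀ j, nord n P ∘ₗ (Algebra.lsmul ℝ ℝ (Smooth n) (pd i (inversionField a j)) ∘ₗ pd j) =
        nord n (P * (MvPolynomial.X j * MvPolynomial.C (pd i (inversionField a j))) +
          ((if i = j then MvPolynomial.X j * fibreD a P else 0) +
            if i = a then MvPolynomial.X j * fibreD j P else 0)) := by
      intro j
      rw [← LinearMap.comp_assoc, pd_inversionField, map_add, LinearMap.comp_add]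
      have h1 : nord n P ∘ₗ Algebra.lsmul ℝ ℝ (Smooth n) (if i = j then coord a else 0) =
          nord n (P * MvPolynomial.C (if i = j then coord a else 0) +
            if i = j then fibreD a P else 0) := by
        split_ifs
        · exact nord_comp_coord P a
        · simp
      have h2 : nord n P ∘ₗ Algebra.lsmul ℝ ℝ (Smooth n) (if i = a then coord j else 0) =
          nord n (P * MvPolynomial.C (if i = a then coord j else 0) +
            if i = a then fibreD j P else 0) := by
        split_ifs
        · exact nord_comp_coord P j
        · simp
      rw [h1, h2, ← map_add, ← nord_mul_X]
      congr 1
      rw [map_add MvPolynomial.C]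
      split_ifs <;> ring
    have hvd : pd i (vdiv (inversionField a)) =
        algebraMap ℝ _ (if i = a then (n : ℝ) + 1 else 0) := by
      rw [vdiv_inversionField, map_smul, pd_coord]
      split_ifs <;> simp [Algebra.smul_def]
    have hdiv : nord n P ∘ₗ (lam • Algebra.lsmul ℝ ℝ (Smooth n) (pd i (vdiv (inversionField a)))) =
        nord n ((lam * ((n : ℝ) + 1)) • if i = a then P else 0) := by
      rw [hvd]
      ext f
      simp only [LinearMap.comp_apply, LinearMap.smul_apply, Algebra.lsmul_coe, map_smul,
        algebraMap_smul]
      split_ifs <;> simp [mul_smul]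
    rw [nord_mul_X, operatorAction_comp_pd, h, symbolAction_mul_X, inversionDefect_mul_X,
      LinearMap.comp_add, hdiv, ← nord_mul_X]
    have hs : nord n P ∘ₗ (∑ j, Algebra.lsmul ℝ ℝ (Smooth n) (pd i (inversionField a j)) ∘ₗ pd j) =
        ∑ j, nord n P ∘ₗ (Algebra.lsmul ℝ ℝ (Smooth n) (pd i (inversionField a j)) ∘ₗ pd j) := by
      ext f
      simp
    simp only [hs, hpd, ← map_sum, ← map_add, ← map_sub]
    congr 1
    simp only [Finset.sum_add_distrib, Finset.mul_sum, Finset.sum_ite_eq, Finset.mem_univ, if_true]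
    have h5 : (∑ j, if i = a then (MvPolynomial.X j : FibrePoly n) * fibreD j P else 0) =
        if i = a then ∑ j, MvPolynomial.X j * fibreD j P else 0 := by
      split_ifs <;> simp
    rw [h5]
    ring

/-- Euler's identity on ∂_{p_a} P, which has degree k - 1. For k = 0 both sides vanish, whatever the
scalar. -/
theorem inversionDefect_eq {k : ℕ} (lam : ℝ) (a : Fin n) {P : FibrePoly n} (hP : P ∈ Symb n k) :
    inversionDefect lam a P = ((k : ℝ) - 1 + lam * ((n : ℝ) + 1)) • fibreD a P := by
  rcases k with _ | k
  · simp [inversionDefect, fibreD_eq_zero a hP]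
  · rw [inversionDefect, sum_X_mul_fibreD (fibreD_mem a hP), ← add_smul]
    simp

/-! ### Commutation of the divergence with the action on symbols -/

theorem symbolAction_translationField (δ : ℝ) (b : Fin n) (P : FibrePoly n) :
    symbolAction δ (translationField b) P = baseD b P := by
  have h : ∀ i j, pd i (translationField b j : Smooth n) = 0 := by
    intro i j
    rw [translationField, Pi.single_apply]
    split_ifs <;> simp [pd_one]
  have h' : vdiv (translationField b) = 0 := by simp [vdiv, h]
  simp only [symbolAction_apply, h, h', map_zero, mul_zero, zero_mul, Finset.sum_const_zero,
    sub_zero, zero_smul, smul_zero, add_zero]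
  rw [Finset.sum_eq_single b]
  · simp [translationField]
  · intro i _ hi
    simp [translationField, hi]
  · simp

theorem pd_linearField (a b i j : Fin n) : pd i (linearField a b j) =
    if i = a ∧ j = b then (1 : Smooth n) else 0 := by
  rw [linearField, Pi.single_apply]
  by_cases hj : j = b
  · simp [hj, pd_coord]
  · simp [hj]

theorem symbolAction_linearField (δ : ℝ) (a b : Fin n) (P : FibrePoly n) :
    symbolAction δ (linearField a b) P = coord a • baseD b P - MvPolynomial.X b * fibreD a P +
      (if a = b then δ else 0) • P := by
  have h1 : vdiv (linearField a b) = if a = b then (1 : Smooth n) else 0 := by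
    simp only [vdiv, pd_linearField]
    by_cases h : a = b
    · subst h; simp
    · rw [if_neg h]
      exact Finset.sum_eq_zero fun i _ => if_neg fun h' => h (h'.1.symm.trans h'.2)
  have h2 : ∑ i, (linearField a b i : Smooth n) • baseD i P = coord a • baseD b P := by
    rw [Finset.sum_eq_single b]
    · simp [linearField]
    · intro i _ hi
      simp [linearField, hi]
    · simp
  have h3 : ∑ i, ∑ j, (MvPolynomial.X j * MvPolynomial.C (pd i (linearField a b j)) :
      FibrePoly n) * fibreD i P = MvPolynomial.X b * fibreD a P := by
    rw [Finset.sum_eq_single a, Finset.sum_eq_single b]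
    · simp [pd_linearField]
    · intro j _ hj
      simp [pd_linearField, hj]
    · simp
    · intro i _ hi
      simp [pd_linearField, hi]
    · simp
  rw [symbolAction_apply, h1, h2, h3]
  by_cases h : a = b <;> simp [h]

theorem symbolAction_inversionField (δ : ℝ) (a : Fin n) (P : FibrePoly n) :
    symbolAction δ (inversionField a) P = coord a • (∑ i, coord i • baseD i P -
      ∑ i, MvPolynomial.X i * fibreD i P + (δ * ((n : ℝ) + 1)) • P) -
        (∑ j, coord j • (MvPolynomial.X j * fibreD a P)) := by
  have h1 : ∀ i j, (MvPolynomial.X j * MvPolynomial.C (pd i (inversionField a j)) : FibrePoly n) *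
      fibreD i P = (if i = j then coord a • (MvPolynomial.X i * fibreD i P) else 0) +
        if i = a then coord j • (MvPolynomial.X j * fibreD i P) else 0 := by
    intro i j
    rw [pd_inversionField]
    by_cases h : i = j
    · subst h
      by_cases h' : i = a
      · simp only [h', if_true, MvPolynomial.smul_eq_C_mul, map_add]; ring
      · simp only [h', if_true, if_false, MvPolynomial.smul_eq_C_mul, add_zero]; ring
    · by_cases h' : i = a
      · subst h'
        simp only [h, if_true, if_false, MvPolynomial.smul_eq_C_mul, zero_add]; ring
      · simp [h, h']
  rw [symbolAction_apply, vdiv_inversionField]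
  simp only [h1, Finset.sum_add_distrib, Finset.sum_ite_eq, Finset.mem_univ, if_true]
  rw [Finset.sum_comm (f := fun i j => if i = a then
    coord j • (MvPolynomial.X j * fibreD i P : FibrePoly n) else 0)]
  simp only [Finset.sum_ite_eq', Finset.mem_univ, if_true, smul_add, smul_sub, Finset.smul_sum,
    inversionField, mul_smul (coord _)]
  rw [smul_assoc ((n : ℝ) + 1), smul_smul δ, smul_comm (δ * ((n : ℝ) + 1))]
  abel

theorem divergenceOp_apply (P : FibrePoly n) : divergenceOp n P = ∑ i, baseD i (fibreD i P) := by
  simp [divergenceOp, LinearMap.sum_apply]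

theorem divergenceOp_coord_smul (a : Fin n) (P : FibrePoly n) :
    divergenceOp n (coord a • P) = coord a • divergenceOp n P + fibreD a P := by
  simp only [divergenceOp_apply, fibreD_smul, baseD_smul, pd_coord, Finset.sum_add_distrib,
    Finset.smul_sum]
  simp [ite_smul]

theorem divergenceOp_X_mul (a : Fin n) (P : FibrePoly n) :
    divergenceOp n (MvPolynomial.X a * P) = MvPolynomial.X a * divergenceOp n P + baseD a P := by
  simp only [divergenceOp_apply, fibreD_mul, map_add, baseD_mul, baseD_X, fibreD_X, mul_zero,
    add_zero, Finset.sum_add_distrib, Finset.mul_sum]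
  congr 1
  have h : ∀ i, P * baseD i (if i = a then (1 : FibrePoly n) else 0) = 0 := by
    intro i
    have : baseD i (1 : FibrePoly n) = 0 := by
      rw [← map_one MvPolynomial.C, baseD_C, pd_one, map_zero]
    split_ifs <;> simp [this]
  simp [h]

theorem divergenceOp_baseD (a : Fin n) (P : FibrePoly n) :
    divergenceOp n (baseD a P) = baseD a (divergenceOp n P) := by
  simp only [divergenceOp_apply, map_sum, ← baseD_fibreD_comm a, baseD_comm a]

theorem divergenceOp_fibreD (a : Fin n) (P : FibrePoly n) :
    divergenceOp n (fibreD a P) = fibreD a (divergenceOp n P) := by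
  simp only [divergenceOp_apply, map_sum, fibreD_comm _ a, ← baseD_fibreD_comm _ a]

theorem divergenceOp_mem {k : ℕ} {P : FibrePoly n} (hP : P ∈ Symb n k) :
    divergenceOp n P ∈ Symb n (k - 1) := by
  rw [divergenceOp_apply]
  exact Submodule.sum_mem _ fun i _ => baseD_mem i (fibreD_mem i hP)

theorem divergenceOp_pow_mem {k : ℕ} (l : ℕ) {P : FibrePoly n} (hP : P ∈ Symb n k) :
    (divergenceOp n ^ l) P ∈ Symb n (k - l) := by
  induction l with
  | zero => exact hP
  | succ l ih =>
    rw [pow_succ', Module.End.mul_apply, ← Nat.sub_sub]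
    exact divergenceOp_mem ih

theorem divergenceOp_symbolAction_translationField (δ : ℝ) (b : Fin n) (P : FibrePoly n) :
    divergenceOp n (symbolAction δ (translationField b) P) =
      symbolAction δ (translationField b) (divergenceOp n P) := by
  rw [symbolAction_translationField, symbolAction_translationField, divergenceOp_baseD]

theorem divergenceOp_symbolAction_linearField (δ : ℝ) (a b : Fin n) (P : FibrePoly n) :
    divergenceOp n (symbolAction δ (linearField a b) P) =
      symbolAction δ (linearField a b) (divergenceOp n P) := by
  rw [symbolAction_linearField, symbolAction_linearField, map_add, map_sub,
    map_smul (divergenceOp n) (if a = b then δ else 0) P, divergenceOp_coord_smul, divergenceOp_X_mul, divergenceOp_baseD, divergenceOp_fibreD,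
    baseD_fibreD_comm]
  abel

/-- Every summand of the inversion action is commuted past D separately. The terms left over with
x-derivatives cancel, and Euler's identity turns the rest into a scalar times ∂_{p_a} P. -/
theorem divergenceOp_symbolAction_inversionField {k : ℕ} (δ : ℝ) (a : Fin n) {P : FibrePoly n}
    (hP : P ∈ Symb n k) :
    divergenceOp n (symbolAction δ (inversionField a) P) =
      symbolAction δ (inversionField a) (divergenceOp n P) +
        ((δ - 1) * ((n : ℝ) + 1) - 2 * ((k : ℝ) - 1)) • fibreD a P := by
  have hE : ∀ Q : FibrePoly n, divergenceOp n (∑ i, coord i • baseD i Q) =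
      ∑ i, coord i • baseD i (divergenceOp n Q) + divergenceOp n Q := by
    intro Q
    rw [map_sum]
    simp only [divergenceOp_coord_smul, divergenceOp_baseD, Finset.sum_add_distrib]
    rw [divergenceOp_apply Q]
    simp only [baseD_fibreD_comm]
  have hEp : ∀ Q : FibrePoly n, divergenceOp n (∑ i, MvPolynomial.X i * fibreD i Q) =
      ∑ i, MvPolynomial.X i * fibreD i (divergenceOp n Q) + divergenceOp n Q := by
    intro Q
    rw [map_sum]
    simp only [divergenceOp_X_mul, divergenceOp_fibreD, Finset.sum_add_distrib]
    rw [divergenceOp_apply Q]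
  have hxp : ∀ Q : FibrePoly n, divergenceOp n (∑ j, coord j • (MvPolynomial.X j * Q)) =
      ∑ j, coord j • (MvPolynomial.X j * divergenceOp n Q) + ∑ j, coord j • baseD j Q +
        ∑ j, MvPolynomial.X j * fibreD j Q + (n : ℝ) • Q := by
    intro Q
    rw [map_sum]
    simp only [divergenceOp_coord_smul, divergenceOp_X_mul, fibreD_mul, fibreD_X, if_true, mul_one,
      smul_add, Finset.sum_add_distrib, Finset.sum_const, Finset.card_univ, Fintype.card_fin]
    rw [Nat.cast_smul_eq_nsmul]
    abel
  have hEa : fibreD a (∑ i, coord i • baseD i P) = ∑ i, coord i • baseD i (fibreD a P) := by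
    simp only [map_sum, fibreD_smul, baseD_fibreD_comm]
  have hk : ∑ i, MvPolynomial.X i * fibreD i (fibreD a P) = ((k : ℝ) - 1) • fibreD a P := by
    rcases k with _ | k
    · simp [fibreD_eq_zero a hP]
    · rw [sum_X_mul_fibreD (fibreD_mem a hP)]
      simp
  rw [symbolAction_inversionField, symbolAction_inversionField, map_sub, divergenceOp_coord_smul,
    map_add (divergenceOp n), map_sub (divergenceOp n), hE, hEp, hxp, map_add (fibreD a),
    map_sub (fibreD a), hEa, sum_X_mul_fibreD hP, hk, map_smul, map_smul, map_smul,
    divergenceOp_fibreD, add_sub_add_right_eq_sub, two_mul]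
  module

/-- The coefficient of the defect of projective invariance of `D^l` on symbols of degree `k`. -/
def resonance (n k l : ℕ) (δ : ℝ) : ℝ :=
  (l : ℝ) * (((n : ℝ) + 1) * (δ - 1) - 2 * (k : ℝ) + (l : ℝ) + 1)

/-- D commutes with ∂_{p_a}, so the defects of the single steps add up. The step performed in fibre
degree r contributes (n+1)(δ-1) - 2(r-1), and the arithmetic sum over r = k, …, k - l is the
resonance of l + 1. -/
theorem divergenceOp_pow_symbolAction_inversionField {k : ℕ} (δ : ℝ) (a : Fin n) {P : FibrePoly n}
    (hP : P ∈ Symb n k) (l : ℕ) (hl : l ≤ k) :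
    (divergenceOp n ^ (l + 1)) (symbolAction δ (inversionField a) P) =
      symbolAction δ (inversionField a) ((divergenceOp n ^ (l + 1)) P) +
        resonance n k (l + 1) δ • fibreD a ((divergenceOp n ^ l) P) := by
  induction l with
  | zero =>
    simp only [zero_add, pow_one, pow_zero, Module.End.one_apply]
    rw [divergenceOp_symbolAction_inversionField δ a hP]
    congr 2
    simp only [resonance]
    push_cast
    ring
  | succ l ih =>
    rw [pow_succ', Module.End.mul_apply, ih (by omega), map_add, map_smul,
      divergenceOp_symbolAction_inversionField δ a (divergenceOp_pow_mem (l + 1) hP),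
      divergenceOp_fibreD, ← Module.End.mul_apply (divergenceOp n), ← pow_succ',
      ← Module.End.mul_apply (divergenceOp n), ← pow_succ', add_assoc, ← add_smul]
    congr 2
    rw [Nat.cast_sub (by omega)]
    simp only [resonance]
    push_cast
    ring

/-! ### Affinely equivariant maps between symbols -/

section Monomials

open MvPolynomial

/-- The homogeneous polynomials of degree `h` are spanned by `X_o^h` under the operators
`X_j ∂_o`. -/
theorem homogeneousSubmodule_le_of_lowering {h : ℕ} (o : Fin n)
    (T : Submodule ℝ (MvPolynomial (Fin n) ℝ)) (h0 : X o ^ h ∈ T)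
    (hT : ∀ Q ∈ T, Q ∈ homogeneousSubmodule (Fin n) ℝ h → ∀ j, j ≠ o → X j * pderiv o Q ∈ T) :
    homogeneousSubmodule (Fin n) ℝ h ≤ T := by
  -- Here s counts the factors of the monomial other than X_o. One such factor X_j is traded for
  -- X_o, and X_j ∂_o trades it back up to a positive scalar.
  have key : ∀ s : ℕ, ∀ m : Fin n →₀ ℕ, m.degree = h → m o + s = h → monomial m (1 : ℝ) ∈ T := by
    intro s
    induction s with
    | zero =>
      intro m hm hs
      have h1 : m = Finsupp.single o h := by
        have h2 := Finset.add_sum_erase Finset.univ m (Finset.mem_univ o)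
        rw [← Finsupp.degree_eq_sum, hm] at h2
        ext i
        rw [Finsupp.single_apply]
        split_ifs with hi
        · rw [← hi]; omega
        · exact (Finset.sum_eq_zero_iff.1 (by omega : ∑ i ∈ Finset.univ.erase o, m i = 0)) i
            (Finset.mem_erase.2 ⟨Ne.symm hi, Finset.mem_univ i⟩)
      rw [h1, ← X_pow_eq_monomial]
      exact h0
    | succ s ih =>
      intro m hm hs
      obtain ⟨j, hj, hmj⟩ : ∃ j, j ≠ o ∧ m j ≠ 0 := by
        by_contra! hcon
        have h2 := Finset.add_sum_erase Finset.univ m (Finset.mem_univ o)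
        rw [← Finsupp.degree_eq_sum, hm, Finset.sum_eq_zero
          fun i hi => hcon i (Finset.ne_of_mem_erase hi)] at h2
        omega
      have hle : Finsupp.single j 1 ≤ m := by
        rw [Finsupp.single_le_iff]; omega
      obtain ⟨m₁, rfl⟩ : ∃ m₁, m = m₁ + Finsupp.single j 1 := ⟨_, (tsub_add_cancel_of_le hle).symm⟩
      have hoj : (Finsupp.single j 1 : Fin n →₀ ℕ) o = 0 := Finsupp.single_eq_of_ne (Ne.symm hj)
      rw [Finsupp.add_apply, hoj, add_zero] at hs
      have hdeg : (m₁ + Finsupp.single o 1).degree = h := by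
        rw [map_add, Finsupp.degree_single] at hm ⊢
        exact hm
      have h3 := ih (m₁ + Finsupp.single o 1) hdeg (by
        rw [Finsupp.add_apply, Finsupp.single_eq_same]; omega)
      have h4 := hT _ h3 ((mem_homogeneousSubmodule _ _).2 (isHomogeneous_monomial _ hdeg)) j hj
      have h5 : X j * pderiv o (monomial (m₁ + Finsupp.single o 1) (1 : ℝ)) =
          ((m₁ o : ℝ) + 1) • monomial (m₁ + Finsupp.single j 1) (1 : ℝ) := by
        rw [pderiv_monomial, add_tsub_cancel_right, X, monomial_mul, smul_monomial,
          add_comm (Finsupp.single j 1)]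
        simp
      rw [h5] at h4
      exact (T.smul_mem_iff (by positivity)).1 h4
  intro P hP
  rw [P.as_sum]
  refine T.sum_mem fun m hm => ?_
  have hdeg : m.degree = h := by
    have := ((mem_homogeneousSubmodule _ _).1 hP) (mem_support_iff.1 hm)
    rwa [Finsupp.degree_eq_weight_one]
  rw [show monomial m (coeff m P) = coeff m P • monomial m (1 : ℝ) by
    rw [smul_monomial, smul_eq_mul, mul_one]]
  refine T.smul_mem _ (key (h - m o) m hdeg ?_)
  have := Finset.single_le_sum (f := m) (fun _ _ => Nat.zero_le _) (Finset.mem_univ o)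
  rw [← Finsupp.degree_eq_sum] at this
  omega

/-- The product of a polynomial function on the base and a polynomial in the fibre variables. -/
def polySymb (p Q : MvPolynomial (Fin n) ℝ) : FibrePoly n :=
  polyFun n p • MvPolynomial.map (algebraMap ℝ (Smooth n)) Q

theorem polySymb_add_left (p p' Q : MvPolynomial (Fin n) ℝ) :
    polySymb (p + p') Q = polySymb p Q + polySymb p' Q := by
  rw [polySymb, map_add, add_smul]; rfl

theorem polySymb_add_right (p Q Q' : MvPolynomial (Fin n) ℝ) :
    polySymb p (Q + Q') = polySymb p Q + polySymb p Q' := by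
  rw [polySymb, map_add, smul_add]; rfl

theorem polySymb_smul_left (c : ℝ) (p Q : MvPolynomial (Fin n) ℝ) :
    polySymb (c • p) Q = c • polySymb p Q := by
  rw [polySymb, map_smul, smul_assoc]; rfl

theorem map_algebraMap_smul (c : ℝ) (Q : MvPolynomial (Fin n) ℝ) :
    MvPolynomial.map (algebraMap ℝ (Smooth n)) (c • Q) =
      c • MvPolynomial.map (algebraMap ℝ (Smooth n)) Q := by
  rw [smul_eq_C_mul, map_mul, map_C, Algebra.smul_def, MvPolynomial.algebraMap_apply]

theorem polySymb_smul_right (c : ℝ) (p Q : MvPolynomial (Fin n) ℝ) :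
    polySymb p (c • Q) = c • polySymb p Q := by
  rw [polySymb, map_algebraMap_smul, smul_comm]; rfl

/-- `polySymb` as a linear map in the fibre polynomial. -/
def polySymbRight (p : MvPolynomial (Fin n) ℝ) : MvPolynomial (Fin n) ℝ →ₗ[ℝ] FibrePoly n where
  toFun := polySymb p
  map_add' := polySymb_add_right p
  map_smul' c := polySymb_smul_right c p

/-- `polySymb` as a linear map in the base polynomial. -/
def polySymbLeft (Q : MvPolynomial (Fin n) ℝ) : MvPolynomial (Fin n) ℝ →ₗ[ℝ] FibrePoly n where
  toFun p := polySymb p Q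
  map_add' p p' := polySymb_add_left p p' Q
  map_smul' c p := polySymb_smul_left c p Q

theorem baseD_map_algebraMap (i : Fin n) (Q : MvPolynomial (Fin n) ℝ) :
    baseD i (MvPolynomial.map (algebraMap ℝ (Smooth n)) Q) = 0 := by
  ext1 d
  rw [baseD, coeff_coeffMap, coeff_map, pd_algebraMap, coeff_zero]

theorem baseD_polySymb (i : Fin n) (p Q : MvPolynomial (Fin n) ℝ) :
    baseD i (polySymb p Q) = polySymb (pderiv i p) Q := by
  rw [polySymb, baseD_smul, baseD_map_algebraMap, smul_zero, zero_add, pd_polyFun]; rfl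

theorem fibreD_polySymb (i : Fin n) (p Q : MvPolynomial (Fin n) ℝ) :
    fibreD i (polySymb p Q) = polySymb p (pderiv i Q) := by
  rw [polySymb, fibreD_smul, fibreD_apply, pderiv_map]; rfl

theorem coord_smul_polySymb (i : Fin n) (p Q : MvPolynomial (Fin n) ℝ) :
    coord i • polySymb p Q = polySymb (X i * p) Q := by
  rw [polySymb, polySymb, map_mul, polyFun_X, mul_smul]

theorem X_mul_polySymb (i : Fin n) (p Q : MvPolynomial (Fin n) ℝ) :
    X i * polySymb p Q = polySymb p (X i * Q) := by
  rw [polySymb, polySymb, map_mul, map_X, mul_smul_comm]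

theorem polySymb_mem {k : ℕ} (p : MvPolynomial (Fin n) ℝ) {Q : MvPolynomial (Fin n) ℝ}
    (hQ : Q ∈ homogeneousSubmodule (Fin n) ℝ k) : polySymb p Q ∈ Symb n k :=
  Submodule.smul_mem _ _ (((mem_homogeneousSubmodule _ _).1 hQ).map _)

theorem polySymb_monomial (p : MvPolynomial (Fin n) ℝ) (m : Fin n →₀ ℕ) :
    polySymb p (monomial m 1) = monomial m (polyFun n p) := by
  rw [polySymb, map_monomial, map_one, smul_monomial, smul_eq_mul, mul_one]

theorem X_pow_mem_homogeneousSubmodule (o : Fin n) (k : ℕ) :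
    (X o ^ k : MvPolynomial (Fin n) ℝ) ∈ homogeneousSubmodule (Fin n) ℝ k := by
  have := (isHomogeneous_X ℝ o).pow k
  rwa [one_mul] at this

theorem divergenceOp_polySymb_X_pow (o : Fin n) (a b : ℕ) :
    divergenceOp n (polySymb (X o ^ (a + 1)) (X o ^ (b + 1))) =
      (((a : ℝ) + 1) * ((b : ℝ) + 1)) • polySymb (X o ^ a) (X o ^ b) := by
  have hp : ∀ c : ℕ, pderiv o (X o ^ (c + 1) : MvPolynomial (Fin n) ℝ) =
      ((c : ℝ) + 1) • X o ^ c := by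
    intro c
    rw [pderiv_pow, pderiv_X_self, add_tsub_cancel_right, mul_one, smul_eq_C_mul]
    simp
  rw [divergenceOp_apply, Finset.sum_eq_single o]
  · rw [fibreD_polySymb, baseD_polySymb, hp, hp, polySymb_smul_left, polySymb_smul_right, smul_smul]
  · intro i _ hi
    have h0 : pderiv i (X o ^ (b + 1) : MvPolynomial (Fin n) ℝ) = 0 := by
      rw [pderiv_pow, pderiv_X_of_ne (Ne.symm hi), mul_zero]
    rw [fibreD_polySymb, h0, ← zero_smul ℝ (1 : MvPolynomial (Fin n) ℝ), polySymb_smul_right,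
      zero_smul, map_zero]
  · simp

theorem divergenceOp_pow_polySymb_X_pow (o : Fin n) (s : ℕ) : ∀ a b : ℕ, ∃ c : ℝ, 0 < c ∧
    (divergenceOp n ^ s) (polySymb (X o ^ (a + s)) (X o ^ (b + s))) =
      c • polySymb (X o ^ a) (X o ^ b) := by
  induction s with
  | zero => exact fun a b => ⟨1, one_pos, by simp⟩
  | succ s ih =>
    intro a b
    obtain ⟨c, hc, h⟩ := ih a b
    refine ⟨((a + s : ℕ) + 1) * ((b + s : ℕ) + 1) * c, by positivity, ?_⟩
    rw [pow_succ, Module.End.mul_apply, ← add_assoc, ← add_assoc, divergenceOp_polySymb_X_pow,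
      map_smul, h, smul_smul]

end Monomials

/-- A linear map from symbols of degree `k` to symbols of degree `j` (extended to all symbols) that
commutes with the translations and the linear vector fields. -/
structure IsAffineEquivariant (k j : ℕ) (B : FibrePoly n →ₗ[ℝ] FibrePoly n) : Prop where
  mem : ∀ P ∈ Symb n k, B P ∈ Symb n j
  translation : ∀ P ∈ Symb n k, ∀ b, B (baseD b P) = baseD b (B P)
  linear : ∀ P ∈ Symb n k, ∀ a b, B (coord a • baseD b P - MvPolynomial.X b * fibreD a P) =
    coord a • baseD b (B P) - MvPolynomial.X b * fibreD a (B P)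

namespace IsAffineEquivariant

variable {k j : ℕ} {B B' : FibrePoly n →ₗ[ℝ] FibrePoly n}

theorem sub_smul (h : IsAffineEquivariant k j B) (h' : IsAffineEquivariant k j B') (c : ℝ) :
    IsAffineEquivariant k j (B - c • B') where
  mem P hP := Submodule.sub_mem _ (h.mem P hP) (smul_mem_symb c (h'.mem P hP))
  translation P hP b := by
    simp only [LinearMap.sub_apply, LinearMap.smul_apply, h.translation P hP b,
      h'.translation P hP b, map_sub, map_smul]
  linear P hP a b := by
    simp only [LinearMap.sub_apply, LinearMap.smul_apply, h.linear P hP a b, h'.linear P hP a b]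
    simp only [map_sub (baseD b), map_sub (fibreD a), map_smul (baseD b), map_smul (fibreD a),
      smul_sub, mul_sub, mul_smul_comm, smul_comm (coord a) c]
    abel

/-- The sum of the fields x^i ∂_i acts as the Euler field minus the fibre degree. The drop k - j in
fibre degree therefore appears as a shift, and translations allow any centre. -/
theorem euler (h : IsAffineEquivariant k j B) (x₀ : Fin n → ℝ) {P : FibrePoly n}
    (hP : P ∈ Symb n k) : B (∑ i, ccoord x₀ i • baseD i P) =
      ∑ i, ccoord x₀ i • baseD i (B P) + ((k : ℝ) - j) • B P := by
  have h1 : B (∑ i, (coord i • baseD i P - MvPolynomial.X i * fibreD i P)) =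
      ∑ i, (coord i • baseD i (B P) - MvPolynomial.X i * fibreD i (B P)) := by
    rw [map_sum]
    exact Finset.sum_congr rfl fun i _ => h.linear P hP i i
  rw [Finset.sum_sub_distrib, Finset.sum_sub_distrib, sum_X_mul_fibreD hP,
    sum_X_mul_fibreD (h.mem P hP), map_sub, map_smul] at h1
  have h2 : ∀ R : FibrePoly n, ∑ i, ccoord x₀ i • baseD i R =
      ∑ i, coord i • baseD i R - ∑ i, x₀ i • baseD i R := by
    intro R
    rw [← Finset.sum_sub_distrib]
    refine Finset.sum_congr rfl fun i _ => ?_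
    rw [ccoord, _root_.sub_smul, algebraMap_smul]
  have h3 : B (∑ i, x₀ i • baseD i P) = ∑ i, x₀ i • baseD i (B P) := by
    simp only [map_sum, map_smul, h.translation P hP]
  rw [h2, h2, map_sub, h3, ← sub_eq_zero]
  rw [← sub_eq_zero] at h1
  rw [← h1]
  module

/-- Locality: the value at a point depends only on a jet of finite order. -/
theorem eval_coeff_eq_zero (h : IsAffineEquivariant k j B) {l : ℕ} (hk : k = j + l)
    (x₀ : Fin n → ℝ) {m : Fin n →₀ ℕ} (hm : m.degree = k) {f : Smooth n}
    (hf : f ∈ vanishing x₀ ^ (l + 1)) (d : Fin n →₀ ℕ) :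
    evalAt x₀ ((B (MvPolynomial.monomial m f)).coeff d) = 0 := by
  obtain ⟨g, rfl⟩ := exists_euler_eq x₀ (l + 1) f hf
  have hg : MvPolynomial.monomial m g ∈ Symb n k :=
    (MvPolynomial.mem_homogeneousSubmodule _ _).2 (MvPolynomial.isHomogeneous_monomial _ hm)
  have h1 : MvPolynomial.monomial m (ProjQuant.euler x₀ g) =
      ∑ i, ccoord x₀ i • baseD i (MvPolynomial.monomial m g) := by
    simp only [ProjQuant.euler, map_sum, baseD_monomial, MvPolynomial.smul_monomial, smul_eq_mul]
  have h2 : MvPolynomial.monomial m ((1 - ((l + 1 : ℕ) : ℝ)) • g) =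
      (-(l : ℝ)) • MvPolynomial.monomial m g := by
    rw [MvPolynomial.smul_monomial]
    push_cast
    congr 2
    ring
  -- With f = E g - l g, the shift by l in `euler` cancels -l g. Only E applied to B(g) is left, and
  -- E vanishes at its centre.
  rw [map_add, h1, h2, map_add, map_smul, h.euler x₀ hg, hk]
  have h3 : ((((j + l : ℕ) : ℝ)) - j) = l := by push_cast; ring
  rw [h3, neg_smul, add_neg_cancel_right, MvPolynomial.coeff_sum, map_sum]
  refine Finset.sum_eq_zero fun i _ => ?_
  rw [MvPolynomial.coeff_smul, smul_eq_mul, map_mul, evalAt_ccoord, sub_self, zero_mul]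

/-- At each point the coefficients can be replaced by polynomials agreeing with them to order l, by
locality. -/
theorem eq_zero_of_polySymb (h : IsAffineEquivariant k j B) {l : ℕ} (hk : k = j + l)
    (h0 : ∀ r, ∀ p ∈ MvPolynomial.homogeneousSubmodule (Fin n) ℝ r,
      ∀ Q ∈ MvPolynomial.homogeneousSubmodule (Fin n) ℝ k, B (polySymb p Q) = 0)
    {P : FibrePoly n} (hP : P ∈ Symb n k) : B P = 0 := by
  have h0' : ∀ p, ∀ Q ∈ MvPolynomial.homogeneousSubmodule (Fin n) ℝ k, B (polySymb p Q) = 0 := by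
    intro p Q hQ
    induction p using MvPolynomial.induction_on' with
    | add p p' hp hp' => rw [polySymb_add_left, map_add, hp, hp', add_zero]
    | monomial m c => exact h0 _ _ (MvPolynomial.isHomogeneous_monomial _ rfl) Q hQ
  rw [P.as_sum, map_sum]
  refine Finset.sum_eq_zero fun m hm => ?_
  have hdeg : m.degree = k := by
    have := ((MvPolynomial.mem_homogeneousSubmodule _ _).1 hP) (MvPolynomial.mem_support_iff.1 hm)
    rwa [Finsupp.degree_eq_weight_one]
  ext1 d
  refine Smooth.ext_evalAt fun x => ?_
  obtain ⟨p, hp⟩ := exists_polyFun_sub_mem x (l + 1) (P.coeff m)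
  have h1 := h.eval_coeff_eq_zero hk x hdeg hp d
  rw [map_sub, ← polySymb_monomial, map_sub,
    h0' p _ (MvPolynomial.isHomogeneous_monomial _ hdeg), sub_zero] at h1
  rw [h1, MvPolynomial.coeff_zero, map_zero]

end IsAffineEquivariant

theorem eq_algebraMap_of_pd_eq_zero {f : Smooth n} (h : ∀ i, pd i f = 0) :
    f = algebraMap ℝ _ (evalAt 0 f) := by
  have h0 : avg 0 (0 : Smooth n) = 0 := by
    refine Smooth.ext fun x => ?_
    change ∫ t in (0 : ℝ)..1, (0 : ℝ) = 0
    simp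
  have h1 := hadamard 0 f
  simpa [h, h0] using h1

theorem X_mul_eq_zero {a : Fin n} {P : FibrePoly n} (h : MvPolynomial.X a * P = 0) : P = 0 := by
  ext1 d
  have h1 := congrArg (MvPolynomial.coeff (Finsupp.single a 1 + d)) h
  rwa [MvPolynomial.coeff_X_mul] at h1

namespace IsAffineEquivariant

variable {k j : ℕ} {B : FibrePoly n →ₗ[ℝ] FibrePoly n}

/-- Induction on the degree r of the base polynomial: translations make B of the symbol constant in
x. If r ≠ l the Euler field kills it; if r = l, B is determined by its value on x_o^l p_o^k, an
extremal weight vector whose image can only be a multiple of p_o^j. -/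
theorem eq_zero_of_coeff (h : IsAffineEquivariant k j B) {l : ℕ} (hk : k = j + l) (o : Fin n)
    (h0 : evalAt 0 ((B (polySymb (MvPolynomial.X o ^ l) (MvPolynomial.X o ^ k))).coeff
      (Finsupp.single o j)) = 0) {P : FibrePoly n} (hP : P ∈ Symb n k) : B P = 0 := by
  refine h.eq_zero_of_polySymb hk (fun r => ?_) hP
  have step : ∀ r : ℕ, (∀ p ∈ MvPolynomial.homogeneousSubmodule (Fin n) ℝ r,
      ∀ Q ∈ MvPolynomial.homogeneousSubmodule (Fin n) ℝ k, ∀ b, baseD b (B (polySymb p Q)) = 0) →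
      ∀ p ∈ MvPolynomial.homogeneousSubmodule (Fin n) ℝ r,
      ∀ Q ∈ MvPolynomial.homogeneousSubmodule (Fin n) ℝ k, B (polySymb p Q) = 0 := by
    intro r hr
    by_cases hrl : r = l
    · subst hrl
      have hlin : ∀ p ∈ MvPolynomial.homogeneousSubmodule (Fin n) ℝ r,
          ∀ Q ∈ MvPolynomial.homogeneousSubmodule (Fin n) ℝ k, ∀ a b,
          B (polySymb (MvPolynomial.X a * MvPolynomial.pderiv b p) Q) -
            B (polySymb p (MvPolynomial.X b * MvPolynomial.pderiv a Q)) =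
            -(MvPolynomial.X b * fibreD a (B (polySymb p Q))) := by
        intro p hp Q hQ a b
        have h1 := h.linear _ (polySymb_mem p hQ) a b
        rwa [baseD_polySymb, fibreD_polySymb, coord_smul_polySymb, X_mul_polySymb, hr p hp Q hQ,
          smul_zero, zero_sub, map_sub] at h1
      have hX : ∀ (a : Fin n) (c : ℕ), a ≠ o →
          MvPolynomial.pderiv a (MvPolynomial.X o ^ c : MvPolynomial (Fin n) ℝ) = 0 := by
        intro a c ha
        rw [MvPolynomial.pderiv_pow, MvPolynomial.pderiv_X_of_ne (Ne.symm ha), mul_zero]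
      have hr0 := X_pow_mem_homogeneousSubmodule o r
      have hk0 := X_pow_mem_homogeneousSubmodule o k
      have hz : ∀ p : MvPolynomial (Fin n) ℝ, B (polySymb p 0) = 0 :=
        fun p => by rw [polySymb, map_zero, smul_zero, map_zero]
      have hz' : ∀ Q : MvPolynomial (Fin n) ℝ, B (polySymb 0 Q) = 0 :=
        fun p => by rw [polySymb, map_zero, zero_smul, map_zero]
      have hstart : B (polySymb (MvPolynomial.X o ^ r) (MvPolynomial.X o ^ k)) = 0 := by
        -- The linear field x^a ∂_a annihilates x_o^r p_o^k for a ≠ o, so the image contains no p_a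
        -- and is a multiple of p_o^j.
        have hf : ∀ a, a ≠ o →
            fibreD a (B (polySymb (MvPolynomial.X o ^ r) (MvPolynomial.X o ^ k))) = 0 := by
          intro a ha
          have h1 := hlin _ hr0 _ hk0 a a
          rw [hX a r ha, hX a k ha, mul_zero, hz, hz', sub_zero, zero_eq_neg] at h1
          exact X_mul_eq_zero h1
        have hmem := h.mem _ (polySymb_mem (MvPolynomial.X o ^ r) hk0)
        ext1 d
        rw [MvPolynomial.coeff_zero]
        by_contra hd
        have hdeg : d.degree = j := by
          have := ((MvPolynomial.mem_homogeneousSubmodule _ _).1 hmem) hd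
          rwa [Finsupp.degree_eq_weight_one]
        have hda : ∀ a, a ≠ o → d a = 0 := by
          intro a ha
          by_contra hda
          apply hd
          have hle : Finsupp.single a 1 ≤ d := by
            rw [Finsupp.single_le_iff]; omega
          have h1 := congrArg (MvPolynomial.coeff (d - Finsupp.single a 1)) (hf a ha)
          rw [fibreD_apply, MvPolynomial.coeff_pderiv, tsub_add_cancel_of_le hle,
            MvPolynomial.coeff_zero] at h1
          have h2 : (((d - Finsupp.single a 1 : Fin n →₀ ℕ) a : Smooth n) + 1) =
              algebraMap ℝ _ (((d - Finsupp.single a 1 : Fin n →₀ ℕ) a : ℝ) + 1) := by simp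
          rw [h2, mul_comm, ← Algebra.smul_def] at h1
          exact (smul_eq_zero.1 h1).resolve_left (by positivity)
        have hdo : d = Finsupp.single o j := by
          have h1 : d = Finsupp.single o (d o) := by
            ext i
            rw [Finsupp.single_apply]
            split_ifs with hi
            · rw [hi]
            · exact hda i (Ne.symm hi)
          rw [h1, Finsupp.degree_single] at hdeg
          rw [h1, hdeg]
        rw [hdo] at hd
        apply hd
        rw [eq_algebraMap_of_pd_eq_zero (f := MvPolynomial.coeff _ _) fun i => ?_, h0, map_zero]
        have h1 := congrArg (MvPolynomial.coeff (Finsupp.single o j)) (hr _ hr0 _ hk0 i)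
        rwa [baseD, coeff_coeffMap] at h1
      -- The fields x^o ∂_b with b ≠ o kill x_o^r, so they move only the fibre polynomial and reach
      -- every Q from p_o^k.
      have h1 : ∀ Q ∈ MvPolynomial.homogeneousSubmodule (Fin n) ℝ k,
          B (polySymb (MvPolynomial.X o ^ r) Q) = 0 := by
        refine homogeneousSubmodule_le_of_lowering o
          (LinearMap.ker (B ∘ₗ polySymbRight (MvPolynomial.X o ^ r))) hstart ?_
        intro Q hQ hQk b hb
        have hQ' : B (polySymb (MvPolynomial.X o ^ r) Q) = 0 := hQ
        have h2 := hlin _ hr0 Q hQk o b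
        rw [hX b r hb, mul_zero, hz', zero_sub, hQ', map_zero, mul_zero, neg_zero, neg_eq_zero] at h2
        exact h2
      intro p hp Q hQ
      -- The base polynomial is now lowered by x_a ∂_o. The same field also changes Q, hence the
      -- intersection over all Q at once.
      have h2 : MvPolynomial.homogeneousSubmodule (Fin n) ℝ r ≤
          ⨅ Q ∈ MvPolynomial.homogeneousSubmodule (Fin n) ℝ k,
            LinearMap.ker (B ∘ₗ polySymbLeft Q) := by
        refine homogeneousSubmodule_le_of_lowering o _ ?_ ?_
        · simp only [Submodule.mem_iInf]
          exact h1
        · intro p hp hpr a ha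
          simp only [Submodule.mem_iInf] at hp ⊢
          intro Q hQ
          have h3 := hlin p hpr Q hQ a o
          have h4 : B (polySymb p Q) = 0 := hp Q hQ
          have h5 : B (polySymb p (MvPolynomial.X o * MvPolynomial.pderiv a Q)) = 0 := by
            refine hp _ ?_
            rw [MvPolynomial.mem_homogeneousSubmodule] at hQ ⊢
            rcases k with _ | k
            · rw [MvPolynomial.totalDegree_eq_zero_iff_eq_C.mp (Nat.le_zero.mp hQ.totalDegree_le),
                MvPolynomial.pderiv_C, mul_zero]
              exact MvPolynomial.isHomogeneous_zero _ _ _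
            · have := (MvPolynomial.isHomogeneous_X ℝ o).mul (hQ.pderiv (i := a))
              rwa [Nat.add_sub_cancel, add_comm] at this
          rw [h4, h5, map_zero, mul_zero, neg_zero, sub_zero] at h3
          exact h3
      have h3 := h2 hp
      simp only [Submodule.mem_iInf] at h3
      exact h3 Q hQ
    · intro p hp Q hQ
      -- On a base polynomial of degree r with image constant in x, the Euler relation reads (r - l)
      -- B = 0.
      have h1 := h.euler 0 (polySymb_mem p hQ)
      have h2 : ∀ i : Fin n, ccoord 0 i = coord i := fun i => by simp [ccoord]
      simp only [h2, baseD_polySymb, coord_smul_polySymb, hr p hp Q hQ, smul_zero,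
        Finset.sum_const_zero, zero_add] at h1
      have h3 : ∑ i, polySymb (MvPolynomial.X i * MvPolynomial.pderiv i p) Q =
          (r : ℝ) • polySymb p Q := by
        rw [← polySymb_smul_left, Nat.cast_smul_eq_nsmul,
          ← ((MvPolynomial.mem_homogeneousSubmodule _ _).1 hp).sum_X_mul_pderiv]
        exact (map_sum (polySymbLeft Q) _ _).symm
      rw [h3, map_smul, hk, ← sub_eq_zero, ← _root_.sub_smul] at h1
      refine (smul_eq_zero.1 h1).resolve_left ?_
      push_cast
      rw [add_sub_cancel_left, sub_eq_zero]
      exact_mod_cast hrl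
  induction r with
  | zero =>
    refine step 0 fun p hp Q hQ b => ?_
    rw [← h.translation _ (polySymb_mem p hQ), baseD_polySymb,
      MvPolynomial.totalDegree_eq_zero_iff_eq_C.mp
        (Nat.le_zero.mp ((MvPolynomial.mem_homogeneousSubmodule _ _).1 hp).totalDegree_le),
      MvPolynomial.pderiv_C, polySymb, map_zero, zero_smul, map_zero]
  | succ r ih =>
    refine step (r + 1) fun p hp Q hQ b => ?_
    rw [← h.translation _ (polySymb_mem p hQ), baseD_polySymb]
    exact ih _ ((MvPolynomial.mem_homogeneousSubmodule _ _).1 hp).pderiv Q hQ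

end IsAffineEquivariant

theorem isAffineEquivariant_divergenceOp_pow (k l : ℕ) :
    IsAffineEquivariant k (k - l) (divergenceOp n ^ l) where
  mem _ hP := divergenceOp_pow_mem l hP
  translation P _ b := by
    induction l with
    | zero => rfl
    | succ l ih =>
      rw [pow_succ', Module.End.mul_apply, ih, divergenceOp_baseD]; rfl
  linear P _ a b := by
    induction l with
    | zero => rfl
    | succ l ih =>
      rw [pow_succ', Module.End.mul_apply, ih, Module.End.mul_apply]
      have h := divergenceOp_symbolAction_linearField 0 a b ((divergenceOp n ^ l) P)
      simpa [symbolAction_linearField] using h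

/-- Every affinely equivariant map between symbols is a multiple of a power of the divergence. -/
theorem IsAffineEquivariant.exists_eq_smul {k l : ℕ} (hl : l ≤ k) (o : Fin n)
    {B : FibrePoly n →ₗ[ℝ] FibrePoly n} (h : IsAffineEquivariant k (k - l) B) :
    ∃ c : ℝ, ∀ P ∈ Symb n k, B P = c • (divergenceOp n ^ l) P := by
  obtain ⟨c', hc', hD⟩ := divergenceOp_pow_polySymb_X_pow o l 0 (k - l)
  rw [zero_add, Nat.sub_add_cancel hl, pow_zero] at hD
  have h1 : evalAt 0 (((divergenceOp n ^ l) (polySymb (MvPolynomial.X o ^ l)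
      (MvPolynomial.X o ^ k))).coeff (Finsupp.single o (k - l))) = c' := by
    rw [hD, MvPolynomial.X_pow_eq_monomial, polySymb_monomial, map_one, MvPolynomial.coeff_smul,
      MvPolynomial.coeff_monomial, if_pos rfl, map_smul, map_one, smul_eq_mul, mul_one]
  -- The scalar is the ratio of the coefficients of p_o^{k-l} in the images of x_o^l p_o^k under B
  -- and D^l. The denominator c' is positive, and B - c D^l has zero coefficient there.
  refine ⟨evalAt 0 ((B (polySymb (MvPolynomial.X o ^ l) (MvPolynomial.X o ^ k))).coeff
    (Finsupp.single o (k - l))) / c', fun P hP => ?_⟩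
  rw [← sub_eq_zero]
  refine (h.sub_smul (isAffineEquivariant_divergenceOp_pow k l) _).eq_zero_of_coeff
    (Nat.sub_add_cancel hl).symm o ?_ hP
  rw [LinearMap.sub_apply, LinearMap.smul_apply, MvPolynomial.coeff_sub, MvPolynomial.coeff_smul,
    map_sub, map_smul, h1, smul_eq_mul, div_mul_cancel₀ _ hc'.ne', sub_self]

/-! ### Invariance of the powers of the divergence -/

theorem projectiveFields_induction {p : VField n → Prop} (htr : ∀ b, p (translationField b))
    (hlin : ∀ a b, p (linearField a b)) (hinv : ∀ a, p (inversionField a)) (hzero : p 0)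
    (hadd : ∀ X Y, p X → p Y → p (X + Y)) (hsmul : ∀ (c : ℝ) X, p X → p (c • X)) :
    ∀ X ∈ projectiveFields n, p X := by
  intro X hX
  induction hX using Submodule.span_induction with
  | mem X hX =>
    rcases hX with (⟨b, rfl⟩ | ⟨q, rfl⟩) | ⟨a, rfl⟩
    · exact htr b
    · exact hlin q.1 q.2
    · exact hinv a
  | zero => exact hzero
  | add X Y _ _ h h' => exact hadd X Y h h'
  | smul c X _ h => exact hsmul c X h

theorem translationField_mem (b : Fin n) : translationField b ∈ projectiveFields n :=
  Submodule.subset_span (Or.inl (Or.inl ⟨b, rfl⟩))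

theorem linearField_mem (a b : Fin n) : linearField a b ∈ projectiveFields n :=
  Submodule.subset_span (Or.inl (Or.inr ⟨(a, b), rfl⟩))

theorem inversionField_mem (a : Fin n) : inversionField a ∈ projectiveFields n :=
  Submodule.subset_span (Or.inr ⟨a, rfl⟩)

/-! ### Linearity of the actions in the vector field. -/

theorem vdiv_add (X Y : VField n) : vdiv (X + Y) = vdiv X + vdiv Y := by
  simp [vdiv, Finset.sum_add_distrib]

theorem vdiv_smul (c : ℝ) (X : VField n) : vdiv (c • X) = c • vdiv X := by
  simp [vdiv, Finset.smul_sum]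

theorem symbolAction_add_field (δ : ℝ) (X Y : VField n) :
    symbolAction δ (X + Y) = symbolAction δ X + symbolAction δ Y := by
  refine LinearMap.ext fun P => ?_
  simp only [LinearMap.add_apply, symbolAction_apply, vdiv_add, Pi.add_apply, map_add, add_smul,
    smul_add, mul_add, add_mul, Finset.sum_add_distrib]
  abel

theorem symbolAction_smul_field (δ c : ℝ) (X : VField n) :
    symbolAction δ (c • X) = c • symbolAction δ X := by
  refine LinearMap.ext fun P => ?_
  simp only [LinearMap.smul_apply, symbolAction_apply, vdiv_smul, Pi.smul_apply, map_smul,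
    smul_add, smul_sub, Finset.smul_sum, smul_assoc]
  have h : ∀ f : Smooth n, (MvPolynomial.C (c • f) : FibrePoly n) = c • MvPolynomial.C f := by
    intro f
    rw [Algebra.smul_def, map_mul, Algebra.smul_def, MvPolynomial.algebraMap_apply]
  simp only [h, mul_smul_comm, smul_mul_assoc, smul_comm δ c]

theorem symbolAction_zero_field (δ : ℝ) : symbolAction δ (0 : VField n) = 0 := by
  rw [← zero_smul ℝ (0 : VField n), symbolAction_smul_field, zero_smul]

theorem densityAction_add_field (lam : ℝ) (X Y : VField n) :
    densityAction lam (X + Y) = densityAction lam X + densityAction lam Y := by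
  ext1 f
  simp only [LinearMap.add_apply, densityAction_apply, vdiv_add, Pi.add_apply, add_mul, smul_add,
    Finset.sum_add_distrib]
  abel

theorem densityAction_smul_field (lam c : ℝ) (X : VField n) :
    densityAction lam (c • X) = c • densityAction lam X := by
  ext1 f
  simp only [LinearMap.smul_apply, densityAction_apply, vdiv_smul, Pi.smul_apply, smul_add,
    Finset.smul_sum, smul_mul_assoc, smul_comm lam c]

theorem densityAction_zero_field (lam : ℝ) : densityAction lam (0 : VField n) = 0 := by
  rw [← zero_smul ℝ (0 : VField n), densityAction_smul_field, zero_smul]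

/-- The projection of symbols to their component of degree `k`. -/
def symbProj (n k : ℕ) : FibrePoly n →ₗ[ℝ] Symb n k :=
  ((MvPolynomial.homogeneousComponent k).codRestrict (Symb n k)
    fun P => MvPolynomial.homogeneousComponent_isHomogeneous k P).restrictScalars ℝ

theorem symbProj_of_mem {k : ℕ} {P : FibrePoly n} (hP : P ∈ Symb n k) :
    symbProj n k P = ⟨P, hP⟩ := by
  apply Subtype.ext
  change MvPolynomial.homogeneousComponent k P = P
  rw [MvPolynomial.homogeneousComponent_of_mem hP, if_pos rfl]

theorem SymbInvariant.apply {k j : ℕ} {δ : ℝ} {A : Symb n k →ₗ[ℝ] Symb n j}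
    (hA : SymbInvariant δ A) {X : VField n} (hX : X ∈ projectiveFields n) {P : FibrePoly n}
    (hP : P ∈ Symb n k) :
    (A ⟨symbolAction δ X P, symbolAction_mem δ X hP⟩ : FibrePoly n) =
      symbolAction δ X (A ⟨P, hP⟩ : FibrePoly n) :=
  (congrArg Subtype.val (LinearMap.congr_fun (hA X hX) ⟨P, hP⟩)).symm

theorem isAffineEquivariant_of_symbolAction {k j : ℕ} (δ : ℝ) {B : FibrePoly n →ₗ[ℝ] FibrePoly n}
    (hmem : ∀ P ∈ Symb n k, B P ∈ Symb n j)
    (htr : ∀ P ∈ Symb n k, ∀ b, B (symbolAction δ (translationField b) P) =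
      symbolAction δ (translationField b) (B P))
    (hlin : ∀ P ∈ Symb n k, ∀ a b, B (symbolAction δ (linearField a b) P) =
      symbolAction δ (linearField a b) (B P)) : IsAffineEquivariant k j B where
  mem := hmem
  translation P hP b := by simpa [symbolAction_translationField] using htr P hP b
  linear P hP a b := by
    have h := hlin P hP a b
    rwa [symbolAction_linearField, symbolAction_linearField, map_add, map_smul,
      add_left_inj] at h

/-- Invariant maps between symbols are multiples of powers of the divergence. -/
theorem SymbInvariant.exists_eq_smul {k l : ℕ} (hl : l ≤ k) (o : Fin n) {δ : ℝ}
    {A : Symb n k →ₗ[ℝ] Symb n (k - l)} (hA : SymbInvariant δ A) :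
    ∃ c : ℝ, ∀ P : Symb n k, (A P : FibrePoly n) = c • (divergenceOp n ^ l) P := by
  have hB : IsAffineEquivariant k (k - l)
      ((Symb n (k - l)).subtype.restrictScalars ℝ ∘ₗ A ∘ₗ symbProj n k) := by
    refine isAffineEquivariant_of_symbolAction δ (fun P _ => Subtype.property _)
      (fun P hP b => ?_) (fun P hP a b => ?_)
    · simp only [LinearMap.comp_apply, symbProj_of_mem hP,
        symbProj_of_mem (symbolAction_mem δ (translationField b) hP)]
      exact hA.apply (translationField_mem b) hP
    · simp only [LinearMap.comp_apply, symbProj_of_mem hP,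
        symbProj_of_mem (symbolAction_mem δ (linearField a b) hP)]
      exact hA.apply (linearField_mem a b) hP
  obtain ⟨c, hc⟩ := hB.exists_eq_smul hl o
  refine ⟨c, fun P => ?_⟩
  have h := hc P.1 P.2
  rw [LinearMap.comp_apply, LinearMap.comp_apply, symbProj_of_mem P.2] at h
  exact h

/-- The power `D^l` of the divergence on symbols of degree `k`. -/
def divergencePow (n k l : ℕ) : Symb n k →ₗ[ℝ] Symb n (k - l) :=
  LinearMap.codRestrict ((Symb n (k - l)).restrictScalars ℝ)
    ((divergenceOp n ^ l) ∘ₗ (Symb n k).subtype.restrictScalars ℝ)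
    fun P => divergenceOp_pow_mem l P.2

theorem orderLE_divergenceOp_pow (l : ℕ) : OrderLE n l (divergenceOp n ^ l) := by
  have hD : OrderLE n 1 (divergenceOp n) := by
    refine orderLT_sum _ fun i _ => ?_
    refine OrderLT.comp (a := 1) (b := 0) ?_ ?_
    · intro f
      have h : opComm (baseD i) f =
          (Algebra.lsmul (Smooth n) (Smooth n) (FibrePoly n) (pd i f)).restrictScalars ℝ := by
        refine LinearMap.ext fun P => ?_
        rw [opComm_apply, baseD_smul, add_sub_cancel_left]
        rfl
      rw [h]
      exact orderLE_zero_of_linear _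
    · exact orderLE_zero_of_linear _
  induction l with
  | zero => exact orderLE_zero_of_linear (LinearMap.id : FibrePoly n →ₗ[Smooth n] FibrePoly n)
  | succ l ih =>
    rw [pow_succ]
    exact OrderLT.comp ih hD

theorem isDiffOp_divergencePow (k l : ℕ) : IsDiffOp n (divergencePow n k l) := by
  refine ⟨l, orderLT_of_comp_injective (Symb n (k - l)).subtype Subtype.val_injective ?_⟩
  change OrderLT n (l + 0 + 1)
    ((divergenceOp n ^ l) ∘ₗ (Symb n k).subtype.restrictScalars ℝ)
  exact OrderLT.comp (b := 0) (orderLE_divergenceOp_pow l)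
    (orderLE_zero_of_linear (Symb n k).subtype)

theorem symbInvariant_divergencePow {k l : ℕ} (hl : l + 1 ≤ k) {δ : ℝ}
    (h : resonance n k (l + 1) δ = 0) : SymbInvariant δ (divergencePow n k (l + 1)) := by
  have hcomm : ∀ X ∈ projectiveFields n, ∀ P ∈ Symb n k,
      symbolAction δ X ((divergenceOp n ^ (l + 1)) P) =
        (divergenceOp n ^ (l + 1)) (symbolAction δ X P) := by
    refine projectiveFields_induction ?_ ?_ ?_ ?_ ?_ ?_
    · intro b P hP
      have h1 := (isAffineEquivariant_divergenceOp_pow k (l + 1)).translation P hP b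
      rw [symbolAction_translationField, symbolAction_translationField, h1]
    · intro a b P hP
      have h1 := (isAffineEquivariant_divergenceOp_pow k (l + 1)).linear P hP a b
      rw [symbolAction_linearField, symbolAction_linearField, map_add, map_smul, h1]
    · intro a P hP
      rw [divergenceOp_pow_symbolAction_inversionField δ a hP l (by omega), h, zero_smul, add_zero]
    · intro P _
      simp [symbolAction_zero_field]
    · intro X Y hX hY P hP
      simp only [symbolAction_add_field, LinearMap.add_apply, hX P hP, hY P hP, map_add]
    · intro c X hX P hP
      simp only [symbolAction_smul_field, LinearMap.smul_apply, hX P hP, map_smul]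
  intro X hX
  refine LinearMap.ext fun P => Subtype.ext ?_
  exact hcomm X hX P.1 P.2

/-- A symbol of degree `k` on which `∂_{p_o} D^s` is non-zero and which `D^{s+1}` annihilates. -/
def testSymbol (k : ℕ) (o : Fin n) (s : ℕ) : FibrePoly n :=
  polySymb (MvPolynomial.X o ^ s) (MvPolynomial.X o ^ k)

theorem testSymbol_mem (k : ℕ) (o : Fin n) (s : ℕ) : testSymbol k o s ∈ Symb n k :=
  polySymb_mem _ (X_pow_mem_homogeneousSubmodule o k)

theorem divergenceOp_pow_testSymbol_eq {k s : ℕ} (o : Fin n) (hs : s ≤ k) :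
    ∃ c : ℝ, 0 < c ∧ (divergenceOp n ^ s) (testSymbol k o s) =
      c • polySymb 1 (MvPolynomial.X o ^ (k - s)) := by
  obtain ⟨c, hc, h⟩ := divergenceOp_pow_polySymb_X_pow o s 0 (k - s)
  rw [zero_add, Nat.sub_add_cancel hs, pow_zero] at h
  exact ⟨c, hc, h⟩

theorem polySymb_one_X_pow_ne_zero (o : Fin n) (k : ℕ) :
    polySymb 1 (MvPolynomial.X o ^ k : MvPolynomial (Fin n) ℝ) ≠ 0 := by
  intro h
  rw [MvPolynomial.X_pow_eq_monomial, polySymb_monomial, map_one,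
    MvPolynomial.monomial_eq_zero] at h
  have h1 := congrArg (evalAt 0) h
  rw [map_one, map_zero] at h1
  exact one_ne_zero h1

theorem divergenceOp_pow_testSymbol_ne_zero {k s : ℕ} (o : Fin n) (hs : s ≤ k) :
    (divergenceOp n ^ s) (testSymbol k o s) ≠ 0 := by
  obtain ⟨c, hc, h⟩ := divergenceOp_pow_testSymbol_eq o hs
  rw [h]
  exact smul_ne_zero hc.ne' (polySymb_one_X_pow_ne_zero o _)

theorem fibreD_divergenceOp_pow_testSymbol_ne_zero {k s : ℕ} (o : Fin n) (hs : s < k) :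
    fibreD o ((divergenceOp n ^ s) (testSymbol k o s)) ≠ 0 := by
  obtain ⟨c, hc, h⟩ := divergenceOp_pow_testSymbol_eq o hs.le
  obtain ⟨r, hr⟩ : ∃ r, k - s = r + 1 := ⟨k - s - 1, by omega⟩
  have hp : MvPolynomial.pderiv o (MvPolynomial.X o ^ (r + 1) : MvPolynomial (Fin n) ℝ) =
      ((r : ℝ) + 1) • MvPolynomial.X o ^ r := by
    rw [MvPolynomial.pderiv_pow, MvPolynomial.pderiv_X_self, add_tsub_cancel_right, mul_one,
      MvPolynomial.smul_eq_C_mul]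
    simp
  rw [h, hr, map_smul, fibreD_polySymb, hp, polySymb_smul_right]
  exact smul_ne_zero hc.ne' (smul_ne_zero (by positivity) (polySymb_one_X_pow_ne_zero o _))

theorem divergenceOp_pow_testSymbol_eq_zero {k s t : ℕ} (o : Fin n) (hs : s ≤ k) (ht : s < t) :
    (divergenceOp n ^ t) (testSymbol k o s) = 0 := by
  obtain ⟨c, -, h⟩ := divergenceOp_pow_testSymbol_eq o hs
  obtain ⟨r, rfl⟩ : ∃ r, t = r + 1 + s := ⟨t - s - 1, by omega⟩
  have h1 : divergenceOp n (polySymb 1 (MvPolynomial.X o ^ (k - s))) = 0 := by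
    rw [divergenceOp_apply]
    refine Finset.sum_eq_zero fun i _ => ?_
    rw [fibreD_polySymb, baseD_polySymb, MvPolynomial.pderiv_one, polySymb, map_zero, zero_smul]
  rw [pow_add, Module.End.mul_apply, h, map_smul, pow_succ, Module.End.mul_apply, h1, map_zero,
    smul_zero]

/-- By rigidity A is a non-zero multiple of D^{l+1}. Its commutation with the inversion is tested on
x_o^l p_o^k, where ∂_{p_o} D^l does not vanish. -/
theorem resonance_eq_zero_of_invariant {k l : ℕ} (hl : l + 1 ≤ k) (o : Fin n) {δ : ℝ}
    {A : Symb n k →ₗ[ℝ] Symb n (k - (l + 1))} (hA : SymbInvariant δ A) (hA0 : A ≠ 0) :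
    ∃ c : ℝ, c ≠ 0 ∧ (∀ P : Symb n k, (A P : FibrePoly n) = c • (divergenceOp n ^ (l + 1)) P) ∧
      resonance n k (l + 1) δ = 0 := by
  obtain ⟨c, hc⟩ := hA.exists_eq_smul hl o
  have hc0 : c ≠ 0 := by
    rintro rfl
    exact hA0 (LinearMap.ext fun P => Subtype.ext (by simpa using hc P))
  refine ⟨c, hc0, hc, ?_⟩
  have hP := testSymbol_mem k o l
  have h1 := hA.apply (inversionField_mem o) hP
  rw [hc, hc, map_smul] at h1
  have h2 := smul_right_injective (FibrePoly n) hc0 h1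
  dsimp only at h2
  rw [divergenceOp_pow_symbolAction_inversionField δ o hP l (by omega), add_eq_left] at h2
  exact (smul_eq_zero.1 h2).resolve_right (fibreD_divergenceOp_pow_testSymbol_ne_zero o (by omega))

/-- For l ≥ 1 the second factor of the resonance is affine in l with slope 1, so it has at most one
root. -/
theorem resonance_unique {k l l' : ℕ} {δ : ℝ} (hl : 1 ≤ l) (hl' : 1 ≤ l')
    (h : resonance n k l δ = 0) (h' : resonance n k l' δ = 0) : l = l' := by
  have h1 := (mul_eq_zero.1 h).resolve_left (by positivity)
  have h1' := (mul_eq_zero.1 h').resolve_left (by positivity)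
  have h2 : (l : ℝ) = l' := by linarith
  exact_mod_cast h2

/-! ### Projectively equivariant quantizations -/

theorem operatorAction_sub (lam mu : ℝ) (X : VField n) (A B : Smooth n →ₗ[ℝ] Smooth n) :
    operatorAction lam mu X (A - B) = operatorAction lam mu X A - operatorAction lam mu X B := by
  rw [operatorAction, LinearMap.comp_sub, LinearMap.sub_comp, operatorAction, operatorAction]
  abel

theorem operatorAction_add_field (lam mu : ℝ) (X Y : VField n) (A : Smooth n →ₗ[ℝ] Smooth n) :
    operatorAction lam mu (X + Y) A = operatorAction lam mu X A + operatorAction lam mu Y A := by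
  simp only [operatorAction, densityAction_add_field, LinearMap.add_comp, LinearMap.comp_add]
  abel

theorem operatorAction_smul_field (lam mu c : ℝ) (X : VField n) (A : Smooth n →ₗ[ℝ] Smooth n) :
    operatorAction lam mu (c • X) A = c • operatorAction lam mu X A := by
  simp only [operatorAction, densityAction_smul_field, LinearMap.smul_comp, LinearMap.comp_smul,
    smul_sub]

theorem operatorAction_nord_translationField (lam mu : ℝ) (b : Fin n) (P : FibrePoly n) :
    operatorAction lam mu (translationField b) (nord n P) =
      nord n (symbolAction (mu - lam) (translationField b) P) := by
  refine operatorAction_nord_of_affine (c := fun _ _ => 0) lam mu (fun i j => ?_) P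
  rw [translationField, Pi.single_apply, map_zero]
  split_ifs <;> simp [pd_one]

theorem operatorAction_nord_linearField (lam mu : ℝ) (a b : Fin n) (P : FibrePoly n) :
    operatorAction lam mu (linearField a b) (nord n P) =
      nord n (symbolAction (mu - lam) (linearField a b) P) := by
  refine operatorAction_nord_of_affine (c := fun i j => if i = a ∧ j = b then 1 else 0) lam mu
    (fun i j => ?_) P
  rw [pd_linearField]
  split_ifs <;> simp

/-- The principal symbols of an affinely equivariant family of differential operators. -/
theorem exists_symbol_map {k j : ℕ} (lam mu : ℝ)
    (B : FibrePoly n →ₗ[ℝ] Module.End ℝ (Smooth n))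
    (hB : ∀ P ∈ Symb n k, OrderLT n (j + 1) (B P))
    (htr : ∀ P ∈ Symb n k, ∀ b, B (symbolAction (mu - lam) (translationField b) P) =
      operatorAction lam mu (translationField b) (B P))
    (hlin : ∀ P ∈ Symb n k, ∀ a b, B (symbolAction (mu - lam) (linearField a b) P) =
      operatorAction lam mu (linearField a b) (B P)) :
    ∃ S : FibrePoly n →ₗ[ℝ] FibrePoly n, IsAffineEquivariant k j S ∧
      ∀ P ∈ Symb n k, OrderLT n j (B P - nord n (S P)) := by
  choose S hS hS' using fun P : Symb n k => exists_symbol (hB P.1 P.2)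
  -- Uniqueness of principal symbols turns the pointwise choice S into a linear and affinely
  -- equivariant map.
  have huniq : ∀ (P : Symb n k) (R : FibrePoly n), R ∈ Symb n j →
      OrderLT n j (B P - nord n R) → S P = R := by
    intro P R hR h
    rw [← sub_eq_zero]
    refine eq_zero_of_orderLT_nord (Submodule.sub_mem _ (hS P) hR) ?_
    have h1 := h.sub (hS' P)
    rwa [sub_sub_sub_cancel_left, ← map_sub] at h1
  let S' : Symb n k →ₗ[ℝ] FibrePoly n :=
    { toFun := S
      map_add' := fun P P' => huniq _ _ (Submodule.add_mem _ (hS P) (hS P')) (by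
        have h1 := (hS' P).add (hS' P')
        rwa [sub_add_sub_comm, ← map_add, ← map_add] at h1)
      map_smul' := fun c P => huniq _ _ (smul_mem_symb c (hS P)) (by
        have h1 := (hS' P).smul c
        rwa [smul_sub, ← map_smul, ← map_smul] at h1) }
  have hS'' : ∀ P (hP : P ∈ Symb n k), (S' ∘ₗ symbProj n k) P = S ⟨P, hP⟩ := by
    intro P hP
    rw [LinearMap.comp_apply, symbProj_of_mem hP]; rfl
  refine ⟨S' ∘ₗ symbProj n k, isAffineEquivariant_of_symbolAction (mu - lam) ?_ ?_ ?_, ?_⟩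
  · intro P hP
    rw [hS'' P hP]
    exact hS _
  · intro P hP b
    rw [hS'' P hP, hS'' _ (symbolAction_mem _ _ hP)]
    refine huniq _ _ (symbolAction_mem _ _ (hS _)) ?_
    have h1 := (hS' ⟨P, hP⟩).operatorAction lam mu (translationField b)
    rwa [operatorAction_sub, operatorAction_nord_translationField, ← htr P hP b] at h1
  · intro P hP a b
    rw [hS'' P hP, hS'' _ (symbolAction_mem _ _ hP)]
    refine huniq _ _ (symbolAction_mem _ _ (hS _)) ?_
    have h1 := (hS' ⟨P, hP⟩).operatorAction lam mu (linearField a b)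
    rwa [operatorAction_sub, operatorAction_nord_linearField, ← hlin P hP a b] at h1
  · intro P hP
    rw [hS'' P hP]
    exact hS' ⟨P, hP⟩

/-- The combination `∑_{l < s} c_l D^l` of powers of the divergence. -/
def divSum (n s : ℕ) (c : ℕ → ℝ) : FibrePoly n →ₗ[ℝ] FibrePoly n :=
  ∑ l ∈ Finset.range s, c l • divergenceOp n ^ l

theorem divSum_apply (s : ℕ) (c : ℕ → ℝ) (P : FibrePoly n) :
    divSum n s c P = ∑ l ∈ Finset.range s, c l • (divergenceOp n ^ l) P := by
  simp [divSum, LinearMap.sum_apply]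

theorem divSum_symbolAction_translationField (δ : ℝ) (s : ℕ) (c : ℕ → ℝ) (b : Fin n)
    (P : FibrePoly n) : divSum n s c (symbolAction δ (translationField b) P) =
      symbolAction δ (translationField b) (divSum n s c P) := by
  have h : ∀ l, (divergenceOp n ^ l) (symbolAction δ (translationField b) P) =
      symbolAction δ (translationField b) ((divergenceOp n ^ l) P) := by
    intro l
    induction l with
    | zero => rfl
    | succ l ih =>
      rw [pow_succ', Module.End.mul_apply, ih, divergenceOp_symbolAction_translationField]; rfl
  simp only [divSum_apply, map_sum, map_smul, h]

theorem divSum_symbolAction_linearField (δ : ℝ) (s : ℕ) (c : ℕ → ℝ) (a b : Fin n)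
    (P : FibrePoly n) : divSum n s c (symbolAction δ (linearField a b) P) =
      symbolAction δ (linearField a b) (divSum n s c P) := by
  have h : ∀ l, (divergenceOp n ^ l) (symbolAction δ (linearField a b) P) =
      symbolAction δ (linearField a b) ((divergenceOp n ^ l) P) := by
    intro l
    induction l with
    | zero => rfl
    | succ l ih =>
      rw [pow_succ', Module.End.mul_apply, ih, divergenceOp_symbolAction_linearField]; rfl
  simp only [divSum_apply, map_sum, map_smul, h]

/-- The coefficient of the defect of equivariance of normal ordering on symbols of degree
`k - s`. -/
def defect (n k s : ℕ) (lam : ℝ) : ℝ := (k : ℝ) - s - 1 + lam * ((n : ℝ) + 1)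

/-- Both failures along inversions have the shape ∂_{p_a} D^s. Collecting them by s turns
equivariance into a two-term recursion for the coefficients. -/
theorem operatorAction_nord_divSum_inversionField {k : ℕ} (lam mu : ℝ) (c : ℕ → ℝ) (a : Fin n)
    {P : FibrePoly n} (hP : P ∈ Symb n k) :
    nord n (divSum n (k + 1) c (symbolAction (mu - lam) (inversionField a) P)) =
      operatorAction lam mu (inversionField a) (nord n (divSum n (k + 1) c P)) +
        nord n (∑ s ∈ Finset.range k, (c (s + 1) * resonance n k (s + 1) (mu - lam) +
          c s * defect n k s lam) • fibreD a ((divergenceOp n ^ s) P)) := by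
  have h1 : ∀ l ∈ Finset.range (k + 1), inversionDefect lam a ((divergenceOp n ^ l) P) =
      defect n k l lam • fibreD a ((divergenceOp n ^ l) P) := by
    intro l hl
    rw [inversionDefect_eq lam a (divergenceOp_pow_mem l hP), Nat.cast_sub
      (Nat.lt_succ_iff.1 (Finset.mem_range.1 hl))]
    rfl
  have h2 : inversionDefect lam a (divSum n (k + 1) c P) =
      ∑ s ∈ Finset.range k, (c s * defect n k s lam) • fibreD a ((divergenceOp n ^ s) P) := by
    have h3 : inversionDefect lam a (divSum n (k + 1) c P) =
        ∑ l ∈ Finset.range (k + 1), c l • inversionDefect lam a ((divergenceOp n ^ l) P) := by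
      simp only [divSum_apply, inversionDefect, map_sum, map_smul, Finset.mul_sum, mul_smul_comm,
        Finset.smul_sum, smul_add, Finset.sum_add_distrib, smul_comm (lam * ((n : ℝ) + 1))]
      rw [Finset.sum_comm]
    -- The term l = k disappears because D^k P has fibre degree 0.
    rw [h3, Finset.sum_congr rfl fun l hl => by rw [h1 l hl, smul_smul], Finset.sum_range_succ,
      fibreD_eq_zero a (by simpa using divergenceOp_pow_mem k hP), smul_zero, add_zero]
  have h4 : divSum n (k + 1) c (symbolAction (mu - lam) (inversionField a) P) =
      symbolAction (mu - lam) (inversionField a) (divSum n (k + 1) c P) +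
        ∑ s ∈ Finset.range k, (c (s + 1) * resonance n k (s + 1) (mu - lam)) •
          fibreD a ((divergenceOp n ^ s) P) := by
    rw [divSum_apply, divSum_apply, Finset.sum_range_succ', Finset.sum_range_succ', map_add,
      map_sum]
    have h5 : ∀ l ∈ Finset.range k, c (l + 1) •
        (divergenceOp n ^ (l + 1)) (symbolAction (mu - lam) (inversionField a) P) =
        symbolAction (mu - lam) (inversionField a) (c (l + 1) • (divergenceOp n ^ (l + 1)) P) +
          (c (l + 1) * resonance n k (l + 1) (mu - lam)) •
            fibreD a ((divergenceOp n ^ l) P) := by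
      intro l hl
      rw [divergenceOp_pow_symbolAction_inversionField _ a hP l (Finset.mem_range.1 hl).le,
        smul_add, map_smul, smul_smul]
    rw [Finset.sum_congr rfl h5, Finset.sum_add_distrib, map_smul]
    simp only [pow_zero, Module.End.one_apply]
    abel
  rw [operatorAction_nord_inversionField, h2, h4, ← map_add]
  congr 1
  simp only [add_smul, Finset.sum_add_distrib]
  abel

/-- The quantization with coefficients `c`. -/
def divQuant (n k : ℕ) (c : ℕ → ℝ) : Symb n k →ₗ[ℝ] (Smooth n →ₗ[ℝ] Smooth n) :=
  nord n ∘ₗ divSum n (k + 1) c ∘ₗ (Symb n k).subtype.restrictScalars ℝ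

theorem divQuant_apply {k : ℕ} (c : ℕ → ℝ) (P : Symb n k) :
    divQuant n k c P = nord n (divSum n (k + 1) c P) := rfl

/-- The recursion satisfied by the coefficients of an equivariant quantization. -/
def IsCoeffs (n k : ℕ) (lam mu : ℝ) (c : ℕ → ℝ) : Prop :=
  ∀ s < k, c (s + 1) * resonance n k (s + 1) (mu - lam) + c s * defect n k s lam = 0

theorem isProjQuantization_divQuant {k : ℕ} {lam mu : ℝ} {c : ℕ → ℝ} (h0 : c 0 = 1)
    (hc : IsCoeffs n k lam mu c) : IsProjQuantization k lam mu (divQuant n k c) where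
  symbol P := by
    have hdecomp : divQuant n k c P - normalOrdering P.1 =
        ∑ s ∈ Finset.range k, c (s + 1) • nord n ((divergenceOp n ^ (s + 1)) P) := by
      rw [divQuant_apply, divSum_apply, Finset.sum_range_succ', h0, map_add, map_sum, one_smul,
        ← nord_apply]
      simp only [map_smul, pow_zero, Module.End.one_apply, add_sub_cancel_right]
    have hlow : OrderLT n k (divQuant n k c P - normalOrdering P.1) := by
      rw [hdecomp]
      refine orderLT_sum _ fun s hs => OrderLT.smul _ ?_
      have hs' := Finset.mem_range.1 hs
      exact (orderLE_nord (divergenceOp_pow_mem (s + 1) P.2)).mono (by omega)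
    refine ⟨?_, hlow⟩
    have h1 := hlow.succ.add (orderLE_nord P.2)
    rwa [nord_apply, sub_add_cancel] at h1
  equivariant := by
    refine projectiveFields_induction ?_ ?_ ?_ ?_ ?_ ?_
    · intro b P
      rw [divQuant_apply, divQuant_apply, operatorAction_nord_translationField,
        ← divSum_symbolAction_translationField]
      rfl
    · intro a b P
      rw [divQuant_apply, divQuant_apply, operatorAction_nord_linearField,
        ← divSum_symbolAction_linearField]
      rfl
    · intro a P
      have h := operatorAction_nord_divSum_inversionField lam mu c a P.2
      rw [Finset.sum_eq_zero fun s hs => by rw [hc s (Finset.mem_range.1 hs), zero_smul],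
        map_zero, add_zero] at h
      exact h
    · intro P
      have h1 : symbAction k (mu - lam) 0 P = 0 :=
        Subtype.ext (by change symbolAction _ 0 P.1 = 0; rw [symbolAction_zero_field]; rfl)
      rw [h1, map_zero, operatorAction, densityAction_zero_field, densityAction_zero_field]
      simp
    · intro X Y hX hY P
      have h1 : symbAction k (mu - lam) (X + Y) P =
          symbAction k (mu - lam) X P + symbAction k (mu - lam) Y P :=
        Subtype.ext (by change symbolAction _ _ P.1 = _; rw [symbolAction_add_field]; rfl)
      rw [h1, map_add, hX, hY, operatorAction_add_field]
    · intro c' X hX P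
      have h1 : symbAction k (mu - lam) (c' • X) P = c' • symbAction k (mu - lam) X P :=
        Subtype.ext (by change symbolAction _ _ P.1 = _; rw [symbolAction_smul_field]; rfl)
      rw [h1, map_smul, hX, operatorAction_smul_field]

/-- Every equivariant quantization is a combination of normally ordered powers of the
divergence. -/
theorem IsProjQuantization.exists_coeffs {k : ℕ} {lam mu : ℝ} (o : Fin n)
    {Q : Symb n k →ₗ[ℝ] (Smooth n →ₗ[ℝ] Smooth n)} (hQ : IsProjQuantization k lam mu Q) :
    ∃ c : ℕ → ℝ, c 0 = 1 ∧ IsCoeffs n k lam mu c ∧ Q = divQuant n k c := by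
  have key : ∀ s ≤ k, ∃ c : ℕ → ℝ, c 0 = 1 ∧
      ∀ P (hP : P ∈ Symb n k), OrderLT n (k - s) (Q ⟨P, hP⟩ - nord n (divSum n (s + 1) c P)) := by
    intro s
    induction s with
    | zero =>
      -- Only the value at 0 matters; the values at 1, …, k are overwritten in later steps.
      refine fun _ => ⟨fun _ => 1, rfl, fun P hP => ?_⟩
      rw [divSum_apply, Finset.sum_range_one, one_smul, pow_zero, Module.End.one_apply]
      exact (hQ.symbol ⟨P, hP⟩).2
    | succ s ih =>
      intro hs
      obtain ⟨c, hc0, hc⟩ := ih (by omega)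
      let B : FibrePoly n →ₗ[ℝ] Module.End ℝ (Smooth n) :=
        Q ∘ₗ symbProj n k - nord n ∘ₗ divSum n (s + 1) c
      have hB : ∀ P (hP : P ∈ Symb n k), B P = Q ⟨P, hP⟩ - nord n (divSum n (s + 1) c P) := by
        intro P hP
        change Q (symbProj n k P) - _ = _
        rw [symbProj_of_mem hP]
        rfl
      obtain ⟨S, hS, hS'⟩ := exists_symbol_map (k := k) (j := k - (s + 1)) lam mu B
        (fun P hP => by
          rw [hB P hP]
          have h1 := hc P hP
          rwa [show k - s = k - (s + 1) + 1 by omega] at h1)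
        (fun P hP b => by
          rw [hB P hP, hB _ (symbolAction_mem _ _ hP), operatorAction_sub,
            operatorAction_nord_translationField, divSum_symbolAction_translationField]
          congr 1
          exact hQ.equivariant _ (translationField_mem b) ⟨P, hP⟩)
        (fun P hP a b => by
          rw [hB P hP, hB _ (symbolAction_mem _ _ hP), operatorAction_sub,
            operatorAction_nord_linearField, divSum_symbolAction_linearField]
          congr 1
          exact hQ.equivariant _ (linearField_mem a b) ⟨P, hP⟩)
      -- The remainder is affinely equivariant, hence so is its symbol of degree k - s - 1. Rigidity
      -- makes this a multiple of D^{s+1}, whose factor is the next coefficient.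
      obtain ⟨d, hd⟩ := hS.exists_eq_smul hs o
      refine ⟨Function.update c (s + 1) d, by simp [hc0], fun P hP => ?_⟩
      have h1 := hS' P hP
      rw [hB P hP, hd P hP, sub_sub, ← map_add] at h1
      have h2 : divSum n (s + 1 + 1) (Function.update c (s + 1) d) P =
          divSum n (s + 1) c P + d • (divergenceOp n ^ (s + 1)) P := by
        rw [divSum_apply, divSum_apply, Finset.sum_range_succ, Function.update_self]
        congr 1
        refine Finset.sum_congr rfl fun l hl => ?_
        rw [Function.update_of_ne (Finset.mem_range.1 hl).ne]
      rwa [h2]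
  obtain ⟨c, hc0, hc⟩ := key k le_rfl
  have hQc : Q = divQuant n k c := by
    ext1 P
    have h1 := hc P.1 P.2
    rw [Nat.sub_self] at h1
    exact sub_eq_zero.1 h1
  refine ⟨c, hc0, fun s => ?_, hQc⟩
  induction s using Nat.strong_induction_on with
  | _ s ih =>
    intro hs
    -- The test symbol x_o^s p_o^k isolates the equation of index s: earlier equations hold by
    -- induction, and D^t kills the symbol for t > s.
    have hP := testSymbol_mem k o s
    have h1 := operatorAction_nord_divSum_inversionField lam mu c o hP
    have h2 := hQ.equivariant _ (inversionField_mem o) ⟨_, hP⟩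
    rw [hQc, divQuant_apply, divQuant_apply] at h2
    rw [← h2, Finset.sum_eq_single s] at h1
    · have h3 := left_eq_add.1 h1
      have h4 := eq_zero_of_orderLT_nord (k := k - s - 1)
        (smul_mem_symb _ (fibreD_mem o (divergenceOp_pow_mem s hP)))
        (by rw [h3]; exact orderLT_zero_map _)
      exact (smul_eq_zero.1 h4).resolve_right (fibreD_divergenceOp_pow_testSymbol_ne_zero o hs)
    · intro t ht hts
      rcases lt_or_gt_of_ne hts with h | h
      · rw [ih t h (Finset.mem_range.1 ht), zero_smul]
      · rw [divergenceOp_pow_testSymbol_eq_zero o hs.le h, map_zero, smul_zero]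
    · intro h
      exact absurd (Finset.mem_range.2 hs) h

/-! ### The recursion for the coefficients, with and without resonance. -/

theorem divQuant_congr {k : ℕ} {c c' : ℕ → ℝ} (h : ∀ s ≤ k, c s = c' s) :
    divQuant n k c = divQuant n k c' := by
  ext1 P
  rw [divQuant_apply, divQuant_apply, divSum_apply, divSum_apply]
  congr 1
  exact Finset.sum_congr rfl fun l hl => by rw [h l (Nat.lt_succ_iff.1 (Finset.mem_range.1 hl))]

/-- The same triangularity: on x_o^s p_o^k the difference reduces to the term D^s, which is
non-zero, and normal ordering is injective on homogeneous symbols. -/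
theorem divQuant_injective {k : ℕ} (o : Fin n) {c c' : ℕ → ℝ}
    (h : divQuant n k c = divQuant n k c') : ∀ s ≤ k, c s = c' s := by
  intro s
  induction s using Nat.strong_induction_on with
  | _ s ih =>
    intro hs
    have hP := testSymbol_mem k o s
    have h1 := LinearMap.congr_fun h ⟨_, hP⟩
    rw [divQuant_apply, divQuant_apply, ← sub_eq_zero, ← map_sub, divSum_apply, divSum_apply,
      ← Finset.sum_sub_distrib, Finset.sum_eq_single s] at h1
    · rw [← sub_smul] at h1
      have h4 := eq_zero_of_orderLT_nord (k := k - s) (smul_mem_symb _ (divergenceOp_pow_mem s hP))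
        (by rw [h1]; exact orderLT_zero_map _)
      exact sub_eq_zero.1
        ((smul_eq_zero.1 h4).resolve_right (divergenceOp_pow_testSymbol_ne_zero o hs))
    · intro t ht hts
      rcases lt_or_gt_of_ne hts with h | h
      · rw [ih t h (by omega), sub_self]
      · dsimp only
        rw [divergenceOp_pow_testSymbol_eq_zero o hs h, smul_zero, smul_zero, sub_self]
    · intro h
      exact absurd (Finset.mem_range.2 (by omega)) h

/-- The solution of the recursion as far as there is no resonance. -/
def solCoeffs (n k : ℕ) (lam mu : ℝ) : ℕ → ℝ
  | 0 => 1
  | s + 1 => -(solCoeffs n k lam mu s * defect n k s lam) / resonance n k (s + 1) (mu - lam)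

/-- The solution of the recursion that starts at the resonance `l`. -/
def tailCoeffs (n k l : ℕ) (lam mu : ℝ) : ℕ → ℝ
  | 0 => 0
  | s + 1 => if s + 1 = l then 1 else
      -(tailCoeffs n k l lam mu s * defect n k s lam) / resonance n k (s + 1) (mu - lam)

theorem tailCoeffs_eq_zero {k l : ℕ} {lam mu : ℝ} {s : ℕ} (hs : s < l) :
    tailCoeffs n k l lam mu s = 0 := by
  induction s with
  | zero => rfl
  | succ s ih => rw [tailCoeffs, if_neg hs.ne, ih (by omega), zero_mul, neg_zero, zero_div]

theorem isCoeffs_tailCoeffs {k l : ℕ} {lam mu : ℝ} (hl : 1 ≤ l)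
    (h : resonance n k l (mu - lam) = 0) :
    IsCoeffs n k lam mu (tailCoeffs n k l lam mu) := by
  intro s _
  by_cases hsl : s + 1 = l
  · rw [hsl, h, mul_zero, zero_add, tailCoeffs_eq_zero (by omega), zero_mul]
  · have hr : resonance n k (s + 1) (mu - lam) ≠ 0 := fun h' =>
      hsl (resonance_unique (by omega) hl h' h)
    rw [tailCoeffs, if_neg hsl, div_mul_cancel₀ _ hr, neg_add_cancel]

/-- The recursion is linear, so `tailCoeffs`, a solution of the homogeneous problem, can be added to
any solution. The two quantizations differ in the coefficient of D^l. -/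
theorem not_existsUnique_of_resonance {k l : ℕ} {lam mu : ℝ} (o : Fin n) (hl : 1 ≤ l) (hlk : l ≤ k)
    (h : resonance n k l (mu - lam) = 0) :
    ¬ ∃! Q : Symb n k →ₗ[ℝ] (Smooth n →ₗ[ℝ] Smooth n), IsProjQuantization k lam mu Q := by
  rintro ⟨Q, hQ, huniq⟩
  obtain ⟨c, hc0, hc, rfl⟩ := IsProjQuantization.exists_coeffs o hQ
  have ht := isCoeffs_tailCoeffs hl h
  have h1 := huniq (divQuant n k (c + tailCoeffs n k l lam mu)) (isProjQuantization_divQuant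
    (by rw [Pi.add_apply, hc0, tailCoeffs, add_zero]) (fun s hs => by
      have h2 := hc s hs
      have h3 := ht s hs
      simp only [Pi.add_apply]
      linear_combination h2 + h3))
  have h2 := divQuant_injective o h1 l hlk
  obtain ⟨l, rfl⟩ : ∃ l', l = l' + 1 := ⟨l - 1, by omega⟩
  rw [Pi.add_apply, tailCoeffs, if_pos rfl] at h2
  linarith

theorem existsUnique_of_no_resonance {k : ℕ} {lam mu : ℝ} (o : Fin n)
    (h : ∀ s < k, resonance n k (s + 1) (mu - lam) ≠ 0) :
    ∃! Q : Symb n k →ₗ[ℝ] (Smooth n →ₗ[ℝ] Smooth n), IsProjQuantization k lam mu Q := by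
  refine ⟨divQuant n k (solCoeffs n k lam mu), isProjQuantization_divQuant rfl fun s hs => ?_,
    fun Q hQ => ?_⟩
  · rw [solCoeffs, div_mul_cancel₀ _ (h s hs), neg_add_cancel]
  · obtain ⟨c, hc0, hc, rfl⟩ := IsProjQuantization.exists_coeffs o hQ
    refine divQuant_congr fun s => ?_
    induction s with
    | zero => exact fun _ => hc0
    | succ s ih =>
      intro hs
      rw [solCoeffs, eq_div_iff (h s hs), ← ih (by omega), eq_neg_iff_add_eq_zero]
      exact hc s hs

/-- At s + 1 = l the recursion loses its unknown and becomes the constraint c_{l-1} defect(l-1) = 0.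
It can be met exactly when the chain starting from c_0 = 1 is broken by a vanishing defect of index
s < l, where h = k - s. -/
theorem exists_isProjQuantization_iff_of_resonance {k l : ℕ} {lam mu : ℝ} (o : Fin n) (hl : 1 ≤ l)
    (hlk : l ≤ k) (h : resonance n k l (mu - lam) = 0) :
    (∃ Q : Symb n k →ₗ[ℝ] (Smooth n →ₗ[ℝ] Smooth n), IsProjQuantization k lam mu Q) ↔
      ∃ h : ℕ, k - l < h ∧ h ≤ k ∧ lam = (1 - (h : ℝ)) / ((n : ℝ) + 1) := by
  have hn : (n : ℝ) + 1 ≠ 0 := by positivity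
  have hdef : ∀ s ≤ k, defect n k s lam = 0 ↔ lam = (1 - ((k - s : ℕ) : ℝ)) / ((n : ℝ) + 1) := by
    intro s hs
    rw [eq_div_iff hn, Nat.cast_sub hs, defect]
    constructor <;> intro h <;> linarith
  have hres : ∀ s, s + 1 ≠ l → resonance n k (s + 1) (mu - lam) ≠ 0 := fun s hs h' =>
    hs (resonance_unique (by omega) hl h' h)
  constructor
  · rintro ⟨Q, hQ⟩
    obtain ⟨c, hc0, hc, -⟩ := hQ.exists_coeffs o
    by_contra! hcon
    have hd : ∀ s < l, defect n k s lam ≠ 0 := fun s hs h' =>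
      hcon (k - s) (by omega) (by omega) ((hdef s (by omega)).1 h')
    -- If no defect of index below l vanishes, the recursion propagates c_0 = 1 ≠ 0 up to c_{l-1},
    -- against the constraint at l.
    have hcs : ∀ s < l, c s ≠ 0 := by
      intro s
      induction s with
      | zero => intro _; rw [hc0]; exact one_ne_zero
      | succ s ih =>
        intro hs h'
        have h1 := hc s (by omega)
        rw [h', zero_mul, zero_add] at h1
        exact mul_ne_zero (ih (by omega)) (hd s (by omega)) h1
    obtain ⟨l, rfl⟩ : ∃ l', l = l' + 1 := ⟨l - 1, by omega⟩
    have h1 := hc l (by omega)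
    rw [h, mul_zero, zero_add] at h1
    exact mul_ne_zero (hcs l (by omega)) (hd l (by omega)) h1
  · rintro ⟨m, hm, hmk, hlam⟩
    have hd : defect n k (k - m) lam = 0 := by
      rw [hdef _ (Nat.sub_le _ _), Nat.sub_sub_self hmk]
      exact hlam
    -- Once a defect vanishes all later numerators are zero. This holds across the resonance too,
    -- where the quotient by zero takes the value 0.
    have hz : ∀ s, k - m < s → solCoeffs n k lam mu s = 0 := by
      intro s
      induction s with
      | zero => intro h'; omega
      | succ s ih =>
        intro hs
        rcases Nat.lt_or_ge (k - m) s with h' | h'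
        · rw [solCoeffs, ih h', zero_mul, neg_zero, zero_div]
        · obtain rfl : s = k - m := by omega
          rw [solCoeffs, hd, mul_zero, neg_zero, zero_div]
    refine ⟨_, isProjQuantization_divQuant (c := solCoeffs n k lam mu) rfl fun s hs => ?_⟩
    by_cases hsl : s + 1 = l
    · rw [hsl, h, mul_zero, zero_add]
      rcases Nat.lt_or_ge (k - m) s with h' | h'
      · rw [hz s h', zero_mul]
      · obtain rfl : s = k - m := by omega
        rw [hd, mul_zero]
    · rw [solCoeffs, div_mul_cancel₀ _ (hres s hsl), neg_add_cancel]

/-! ### Invariant operators on densities -/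

/-- Modulo higher order, the Euler field acts on functions vanishing to order r as multiplication by
r. -/
theorem euler_sub_smul_mem (x₀ : Fin n → ℝ) (r : ℕ) : ∀ u ∈ vanishing x₀ ^ r,
    euler x₀ u - (r : ℝ) • u ∈ vanishing x₀ ^ (r + 1) := by
  induction r with
  | zero =>
    intro u _
    rw [Nat.cast_zero, zero_smul, sub_zero, zero_add, pow_one]
    exact Ideal.sum_mem _ fun i _ => Ideal.mul_mem_right _ _ (ccoord_mem_vanishing x₀ i)
  | succ r ih =>
    intro u hu
    obtain ⟨g, hg, rfl⟩ := exists_sum_of_mem_vanishing_pow_succ hu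
    rw [euler_sum, Finset.smul_sum, ← Finset.sum_sub_distrib]
    refine Ideal.sum_mem _ fun i _ => ?_
    have h : euler x₀ (ccoord x₀ i * g i) - ((r + 1 : ℕ) : ℝ) • (ccoord x₀ i * g i) =
        ccoord x₀ i * (euler x₀ (g i) - (r : ℝ) • g i) := by
      rw [euler_ccoord_mul, Nat.cast_succ, add_smul, one_smul, mul_sub, mul_smul_comm]
      abel
    rw [h, pow_succ']
    exact Ideal.mul_mem_mul (ccoord_mem_vanishing x₀ i) (ih _ (hg i))

/-- The projective inversion centred at `x₀`. -/
def centredInversion (x₀ : Fin n → ℝ) (a : Fin n) : VField n :=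
  fun j => ccoord x₀ a * ccoord x₀ j

theorem centredInversion_mem (x₀ : Fin n → ℝ) (a : Fin n) :
    centredInversion x₀ a ∈ projectiveFields n := by
  -- Expansion of (x_a - x₀_a)(x_j - x₀_j); the part linear in x consists of the Euler field and the
  -- fields x^a ∂_j.
  have h : centredInversion x₀ a = inversionField a - x₀ a • ∑ i, linearField i i -
      ∑ j, x₀ j • linearField a j + x₀ a • ∑ j, x₀ j • translationField j := by
    have hl : ∀ i j : Fin n, (linearField i i j : Smooth n) = if i = j then coord j else 0 := by
      intro i j
      rw [linearField, Pi.single_apply]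
      by_cases hij : i = j
      · subst hij; simp
      · rw [if_neg hij, if_neg (Ne.symm hij)]
    ext1 j
    simp only [centredInversion, Pi.add_apply, Pi.sub_apply, Pi.smul_apply, Finset.sum_apply, hl]
    simp only [linearField, translationField, Pi.single_apply, smul_ite, smul_zero,
      Finset.sum_ite_eq', Finset.sum_ite_eq, Finset.mem_univ, if_true, inversionField]
    simp only [ccoord, Algebra.smul_def]
    ring
  rw [h]
  refine Submodule.add_mem _ (Submodule.sub_mem _ (Submodule.sub_mem _ (inversionField_mem a)
    (Submodule.smul_mem _ _ (Submodule.sum_mem _ fun i _ => linearField_mem i i)))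
    (Submodule.sum_mem _ fun j _ => Submodule.smul_mem _ _ (linearField_mem a j)))
    (Submodule.smul_mem _ _ (Submodule.sum_mem _ fun j _ =>
      Submodule.smul_mem _ _ (translationField_mem j)))

theorem pd_centredInversion (x₀ : Fin n → ℝ) (a i j : Fin n) : pd i (centredInversion x₀ a j) =
    (if i = j then ccoord x₀ a else 0) + if i = a then ccoord x₀ j else 0 := by
  rw [centredInversion, pd_mul, pd_ccoord, pd_ccoord]
  split_ifs <;> simp

theorem densityAction_centredInversion (lam : ℝ) (x₀ : Fin n → ℝ) (a : Fin n) (f : Smooth n) :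
    densityAction lam (centredInversion x₀ a) f =
      ccoord x₀ a * (euler x₀ f + (lam * ((n : ℝ) + 1)) • f) := by
  have hv : vdiv (centredInversion x₀ a) = ((n : ℝ) + 1) • ccoord x₀ a := by
    simp only [vdiv, pd_centredInversion, Finset.sum_add_distrib, if_true, Finset.sum_const,
      Finset.card_univ, Fintype.card_fin, Finset.sum_ite_eq', Finset.mem_univ]
    rw [add_smul, one_smul, Nat.cast_smul_eq_nsmul]
  rw [densityAction_apply, hv, mul_add, euler, Finset.mul_sum]
  congr 1
  · exact Finset.sum_congr rfl fun i _ => mul_assoc _ _ _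
  · rw [smul_mul_assoc, smul_smul, mul_smul_comm]

/-- The field and its first derivatives vanish at x₀, and the action on sections involves nothing
else of it, whatever ρ is. -/
theorem evalAt_sectionAction_centredInversion {d : ℕ}
    (rho : Matrix (Fin n) (Fin n) ℝ →ₗ[ℝ] Matrix (Fin d) (Fin d) ℝ) (x₀ : Fin n → ℝ) (a : Fin n)
    (s : Sections n d) (b : Fin d) :
    evalAt x₀ (sectionAction rho (centredInversion x₀ a) s b) = 0 := by
  have h0 : ∀ i, evalAt x₀ (ccoord x₀ i) = 0 := fun i => by rw [evalAt_ccoord, sub_self]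
  have h1 : ∀ i j, evalAt x₀ (pd i (centredInversion x₀ a j)) = 0 := by
    intro i j
    rw [pd_centredInversion, map_add]
    split_ifs <;> simp [h0]
  have h2 : ∀ j, evalAt x₀ (centredInversion x₀ a j) = 0 := by
    intro j
    rw [centredInversion, map_mul, h0, zero_mul]
  rw [sectionAction, map_sub, map_sum, map_sum]
  simp only [map_sum, map_mul, h1, h2, zero_mul, Finset.sum_const_zero, sub_zero]

/-- With h = r + 1, the inversion centred at x sends u, vanishing to order r at x, to (r + λ(n+1))
times a centred coordinate times u, modulo order h + 1. Invariance makes A of this vanish at x, so a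
non-zero scalar would force the order of A below h. -/
theorem HasInvariantOperator.eq_of_one_le {lam : ℝ} {h : ℕ} (hh : 1 ≤ h)
    (hop : HasInvariantOperator n lam h) : lam = (1 - (h : ℝ)) / ((n : ℝ) + 1) := by
  obtain ⟨d, rho, A, -, ⟨hle, hlt⟩, hinv⟩ := hop
  obtain ⟨r, rfl⟩ : ∃ r, h = r + 1 := ⟨h - 1, by omega⟩
  have hn : (n : ℝ) + 1 ≠ 0 := by positivity
  by_contra hne
  have hr : (r : ℝ) + lam * ((n : ℝ) + 1) ≠ 0 := by
    intro h0
    apply hne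
    rw [eq_div_iff hn]
    push_cast
    linarith
  refine hlt (orderLT_pi_iff.2 fun b => orderLT_iff_vanishing.2 fun x g hg => ?_)
  have hA : ∀ u ∈ vanishing x ^ (r + 1 + 1), evalAt x (A u b) = 0 :=
    orderLT_iff_vanishing.1 (orderLT_pi_iff.1 hle b) x
  obtain ⟨u, hu, rfl⟩ := exists_sum_of_mem_vanishing_pow_succ hg
  rw [map_sum, map_sum]
  refine Finset.sum_eq_zero fun i _ => ?_
  have h1 := congrArg (evalAt x) (congrFun (hinv _ (centredInversion_mem x i) (u i)) b)
  rw [evalAt_sectionAction_centredInversion, densityAction_centredInversion] at h1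
  -- The first summand vanishes to order r + 2, so A, being of order at most r + 1, sends it to zero
  -- at x.
  have h2 : ccoord x i * (euler x (u i) + (lam * ((n : ℝ) + 1)) • u i) =
      ccoord x i * (euler x (u i) - (r : ℝ) • u i) +
        ((r : ℝ) + lam * ((n : ℝ) + 1)) • (ccoord x i * u i) := by
    rw [mul_sub, mul_add, add_smul, mul_smul_comm, mul_smul_comm]
    abel
  have h3 := hA (ccoord x i * (euler x (u i) - (r : ℝ) • u i)) (by
    rw [pow_succ' _ (r + 1)]
    exact Ideal.mul_mem_mul (ccoord_mem_vanishing x i) (euler_sub_smul_mem x r _ (hu i)))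
  rw [h2, map_add, map_smul, Pi.add_apply, Pi.smul_apply, map_add, h3, zero_add, map_smul] at h1
  exact (smul_eq_zero.1 h1.symm).resolve_left hr

/-! ### The powers of the gradient -/

theorem gradientOp_apply (P : FibrePoly n) :
    gradientOp n P = ∑ i, MvPolynomial.X i * baseD i P := by
  simp [gradientOp, LinearMap.sum_apply]

theorem gradientOp_coord_smul (a : Fin n) (P : FibrePoly n) :
    gradientOp n (coord a • P) = coord a • gradientOp n P + MvPolynomial.X a * P := by
  simp only [gradientOp_apply, baseD_smul, pd_coord, mul_add, Finset.sum_add_distrib,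
    Finset.smul_sum, mul_smul_comm]
  simp [ite_smul]

theorem gradientOp_X_mul (a : Fin n) (P : FibrePoly n) :
    gradientOp n (MvPolynomial.X a * P) = MvPolynomial.X a * gradientOp n P := by
  simp only [gradientOp_apply, baseD_mul, baseD_X, mul_zero, add_zero, Finset.mul_sum,
    mul_left_comm]

theorem gradientOp_baseD (a : Fin n) (P : FibrePoly n) :
    gradientOp n (baseD a P) = baseD a (gradientOp n P) := by
  simp only [gradientOp_apply, map_sum, baseD_mul, baseD_X, mul_zero, add_zero, baseD_comm a]

theorem gradientOp_fibreD (a : Fin n) (P : FibrePoly n) :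
    gradientOp n (fibreD a P) = fibreD a (gradientOp n P) - baseD a P := by
  simp only [gradientOp_apply, map_sum, fibreD_mul, fibreD_X, Finset.sum_add_distrib,
    baseD_fibreD_comm]
  simp

theorem gradientOp_mem {k : ℕ} {P : FibrePoly n} (hP : P ∈ Symb n k) :
    gradientOp n P ∈ Symb n (k + 1) := by
  rw [gradientOp_apply]
  refine Submodule.sum_mem _ fun i _ => ?_
  have := (MvPolynomial.isHomogeneous_X (Smooth n) i).mul
    ((MvPolynomial.mem_homogeneousSubmodule _ _).1 (baseD_mem i hP))
  rwa [add_comm] at this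

theorem gradientOp_pow_C_mem (h : ℕ) (f : Smooth n) :
    (gradientOp n ^ h) (MvPolynomial.C f) ∈ Symb n h := by
  induction h with
  | zero => exact MvPolynomial.isHomogeneous_C _ _
  | succ h ih =>
    rw [pow_succ', Module.End.mul_apply]
    exact gradientOp_mem ih

theorem cosymbolAction_apply (lam : ℝ) (X : VField n) (P : FibrePoly n) :
    cosymbolAction lam X P = ∑ i, X i • baseD i P +
      ∑ i, ∑ j, (MvPolynomial.X i * MvPolynomial.C (pd i (X j)) : FibrePoly n) * fibreD j P +
      lam • (vdiv X • P) := by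
  simp [cosymbolAction, LinearMap.sum_apply, mul_assoc]

theorem cosymbolAction_C (lam : ℝ) (X : VField n) (f : Smooth n) :
    cosymbolAction lam X (MvPolynomial.C f) = MvPolynomial.C (densityAction lam X f) := by
  rw [← symbolAction_C, symbolAction_apply, cosymbolAction_apply]
  simp only [fibreD_C, mul_zero, Finset.sum_const_zero, sub_zero, add_zero]

theorem cosymbolAction_add_field (lam : ℝ) (X Y : VField n) :
    cosymbolAction lam (X + Y) = cosymbolAction lam X + cosymbolAction lam Y := by
  refine LinearMap.ext fun P => ?_
  simp only [LinearMap.add_apply, cosymbolAction_apply, vdiv_add, Pi.add_apply, map_add, add_smul,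
    smul_add, mul_add, add_mul, Finset.sum_add_distrib]
  abel

theorem cosymbolAction_smul_field (lam c : ℝ) (X : VField n) :
    cosymbolAction lam (c • X) = c • cosymbolAction lam X := by
  refine LinearMap.ext fun P => ?_
  simp only [LinearMap.smul_apply, cosymbolAction_apply, vdiv_smul, Pi.smul_apply, map_smul,
    smul_add, Finset.smul_sum, smul_assoc]
  have h : ∀ f : Smooth n, (MvPolynomial.C (c • f) : FibrePoly n) = c • MvPolynomial.C f := by
    intro f
    rw [Algebra.smul_def, map_mul, Algebra.smul_def, MvPolynomial.algebraMap_apply]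
  simp only [h, mul_smul_comm, smul_mul_assoc, smul_comm lam c]

theorem cosymbolAction_translationField (lam : ℝ) (b : Fin n) (P : FibrePoly n) :
    cosymbolAction lam (translationField b) P = baseD b P := by
  have h : ∀ i j, pd i (translationField b j : Smooth n) = 0 := by
    intro i j
    rw [translationField, Pi.single_apply]
    split_ifs <;> simp [pd_one]
  have h1 := symbolAction_translationField lam b P
  rw [symbolAction_apply] at h1
  rw [cosymbolAction_apply]
  simpa [h] using h1

theorem cosymbolAction_linearField (lam : ℝ) (a b : Fin n) (P : FibrePoly n) :
    cosymbolAction lam (linearField a b) P = coord a • baseD b P + MvPolynomial.X a * fibreD b P +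
      (if a = b then lam else 0) • P := by
  have h3 : ∀ Q : Fin n → Fin n → FibrePoly n, ∑ i, ∑ j,
      Q i j * MvPolynomial.C (pd i (linearField a b j)) = Q a b := by
    intro Q
    rw [Finset.sum_eq_single a, Finset.sum_eq_single b]
    · simp [pd_linearField]
    · intro j _ hj
      simp [pd_linearField, hj]
    · simp
    · intro i _ hi
      simp [pd_linearField, hi]
    · simp
  have h1 := symbolAction_linearField lam a b P
  have h4 := h3 fun i j => MvPolynomial.X j * fibreD i P
  have h5 := h3 fun i j => MvPolynomial.X i * fibreD j P
  simp only [mul_right_comm _ (fibreD _ P)] at h4 h5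
  rw [symbolAction_apply, h4, sub_add_eq_add_sub, sub_add_eq_add_sub, sub_left_inj] at h1
  rw [cosymbolAction_apply, h5, add_right_comm, h1]
  abel

theorem cosymbolAction_inversionField (lam : ℝ) (a : Fin n) (P : FibrePoly n) :
    cosymbolAction lam (inversionField a) P = coord a • (∑ i, coord i • baseD i P +
      ∑ i, MvPolynomial.X i * fibreD i P + (lam * ((n : ℝ) + 1)) • P) +
        MvPolynomial.X a * ∑ j, coord j • fibreD j P := by
  have h1 : ∀ i j, (MvPolynomial.X i * MvPolynomial.C (pd i (inversionField a j)) : FibrePoly n) *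
      fibreD j P = (if i = j then coord a • (MvPolynomial.X i * fibreD i P) else 0) +
        if i = a then MvPolynomial.X i * coord j • fibreD j P else 0 := by
    intro i j
    rw [pd_inversionField]
    by_cases h : i = j
    · subst h
      by_cases h' : i = a
      · simp only [h', if_true, MvPolynomial.smul_eq_C_mul, map_add]; ring
      · simp only [h', if_true, if_false, MvPolynomial.smul_eq_C_mul, add_zero]; ring
    · by_cases h' : i = a
      · subst h'
        simp only [h, if_true, if_false, MvPolynomial.smul_eq_C_mul, zero_add]; ring
      · simp [h, h']
  rw [cosymbolAction_apply, vdiv_inversionField]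
  simp only [h1, Finset.sum_add_distrib, Finset.sum_ite_eq, Finset.mem_univ, if_true]
  rw [Finset.sum_comm (f := fun i j => if i = a then
    MvPolynomial.X i * coord j • fibreD j P else 0)]
  simp only [Finset.sum_ite_eq', Finset.mem_univ, if_true, smul_add, Finset.smul_sum,
    Finset.mul_sum, inversionField, mul_smul (coord _)]
  rw [smul_assoc ((n : ℝ) + 1), smul_smul lam, smul_comm (lam * ((n : ℝ) + 1))]
  abel

theorem gradientOp_cosymbolAction_inversionField {k : ℕ} (lam : ℝ) (a : Fin n) {P : FibrePoly n}
    (hP : P ∈ Symb n k) :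
    gradientOp n (cosymbolAction lam (inversionField a) P) =
      cosymbolAction lam (inversionField a) (gradientOp n P) +
        ((k : ℝ) + k + lam * ((n : ℝ) + 1)) • (MvPolynomial.X a * P) := by
  have hE : gradientOp n (∑ i, coord i • baseD i P) =
      ∑ i, coord i • baseD i (gradientOp n P) + gradientOp n P := by
    rw [map_sum]
    simp only [gradientOp_coord_smul, gradientOp_baseD, Finset.sum_add_distrib]
    rw [gradientOp_apply P]
  have hEp : gradientOp n (∑ i, MvPolynomial.X i * fibreD i P) =
      ∑ i, MvPolynomial.X i * fibreD i (gradientOp n P) - gradientOp n P := by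
    rw [map_sum]
    simp only [gradientOp_X_mul, gradientOp_fibreD, mul_sub, Finset.sum_sub_distrib]
    rw [gradientOp_apply P]
  have hxp : gradientOp n (∑ j, coord j • fibreD j P) =
      ∑ j, coord j • fibreD j (gradientOp n P) - ∑ j, coord j • baseD j P +
        ∑ j, MvPolynomial.X j * fibreD j P := by
    rw [map_sum]
    simp only [gradientOp_coord_smul, gradientOp_fibreD, smul_sub, Finset.sum_add_distrib,
      Finset.sum_sub_distrib]
  rw [cosymbolAction_inversionField, cosymbolAction_inversionField, map_add, gradientOp_coord_smul,
    map_add (gradientOp n), map_add (gradientOp n), hE, hEp, gradientOp_X_mul, hxp, map_smul,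
    sum_X_mul_fibreD hP]
  simp only [mul_add (MvPolynomial.X a : FibrePoly n), mul_sub (MvPolynomial.X a : FibrePoly n),
    mul_smul_comm]
  module

/-- G commutes with multiplication by p̄^a, so the defects 2k + λ(n+1) of the single steps in
degrees k = 0, …, h add up to (h + 1)(h + λ(n+1)). -/
theorem gradientOp_pow_cosymbolAction_inversionField (lam : ℝ) (a : Fin n) (f : Smooth n) (h : ℕ) :
    (gradientOp n ^ (h + 1)) (cosymbolAction lam (inversionField a) (MvPolynomial.C f)) =
      cosymbolAction lam (inversionField a) ((gradientOp n ^ (h + 1)) (MvPolynomial.C f)) +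
        (((h : ℝ) + 1) * (h + lam * ((n : ℝ) + 1))) •
          (MvPolynomial.X a * (gradientOp n ^ h) (MvPolynomial.C f)) := by
  induction h with
  | zero =>
    simp only [zero_add, pow_one, pow_zero, Module.End.one_apply]
    rw [gradientOp_cosymbolAction_inversionField (k := 0) lam a
      (MvPolynomial.isHomogeneous_C _ _)]
    congr 2
    push_cast
    ring
  | succ h ih =>
    rw [pow_succ', Module.End.mul_apply, ih, map_add, map_smul,
      gradientOp_cosymbolAction_inversionField lam a (gradientOp_pow_C_mem (h + 1) f),
      gradientOp_X_mul, ← Module.End.mul_apply (gradientOp n), ← pow_succ',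
      ← Module.End.mul_apply (gradientOp n), ← pow_succ', add_assoc, ← add_smul]
    congr 2
    push_cast
    ring

theorem gradientPowInvariant_of_eq {lam : ℝ} {h : ℕ} (hh : 1 ≤ h)
    (hlam : lam = (1 - (h : ℝ)) / ((n : ℝ) + 1)) : GradientPowInvariant n lam h := by
  obtain ⟨r, rfl⟩ : ∃ r, h = r + 1 := ⟨h - 1, by omega⟩
  have hn : (n : ℝ) + 1 ≠ 0 := by positivity
  have hr : (r : ℝ) + lam * ((n : ℝ) + 1) = 0 := by
    rw [eq_div_iff hn] at hlam
    push_cast at hlam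
    linarith
  refine projectiveFields_induction ?_ ?_ ?_ ?_ ?_ ?_
  · intro b f
    rw [← cosymbolAction_C, cosymbolAction_translationField, cosymbolAction_translationField]
    -- Commutation with the translations holds for every power of G; λ plays a role only for
    -- inversions.
    generalize r + 1 = s
    induction s with
    | zero => rfl
    | succ s ih =>
      rw [pow_succ', Module.End.mul_apply, Module.End.mul_apply, ← ih, gradientOp_baseD]
  · intro a b f
    rw [← cosymbolAction_C]
    generalize r + 1 = s
    induction s with
    | zero => rfl
    | succ s ih =>
      rw [pow_succ', Module.End.mul_apply, Module.End.mul_apply, ← ih, cosymbolAction_linearField,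
        cosymbolAction_linearField, map_add, map_add,
        map_smul (gradientOp n) (if a = b then lam else 0), gradientOp_coord_smul,
        gradientOp_X_mul, gradientOp_fibreD, gradientOp_baseD, mul_sub]
      abel
  · intro a f
    rw [← cosymbolAction_C, gradientOp_pow_cosymbolAction_inversionField, hr, mul_zero, zero_smul,
      add_zero]
  · intro f
    have h0 : cosymbolAction lam (0 : VField n) = 0 := by
      rw [← zero_smul ℝ (0 : VField n), cosymbolAction_smul_field, zero_smul]
    rw [h0, densityAction_zero_field, LinearMap.zero_apply, LinearMap.zero_apply, map_zero,
      map_zero]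
  · intro X Y hX hY f
    rw [cosymbolAction_add_field, densityAction_add_field, LinearMap.add_apply, hX, hY,
      LinearMap.add_apply, map_add, map_add]
  · intro c X hX f
    rw [cosymbolAction_smul_field, LinearMap.smul_apply, hX, ← cosymbolAction_C,
      ← cosymbolAction_C, cosymbolAction_smul_field, LinearMap.smul_apply, map_smul]

/-! ### The representation of `gl_n` on homogeneous polynomials -/

section PolynomialRep

open MvPolynomial

/-- The derivation `B_{ji} X_i ∂_j` of the polynomial ring. -/
def matDerivation (B : Matrix (Fin n) (Fin n) ℝ) :
    Derivation ℝ (MvPolynomial (Fin n) ℝ) (MvPolynomial (Fin n) ℝ) :=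
  mkDerivation ℝ fun j => ∑ i, B j i • X i

theorem matDerivation_X (B : Matrix (Fin n) (Fin n) ℝ) (j : Fin n) :
    matDerivation B (X j) = ∑ i, B j i • X i := mkDerivation_X _ _ _

theorem matDerivation_add (B C : Matrix (Fin n) (Fin n) ℝ) :
    matDerivation (B + C) = matDerivation B + matDerivation C := by
  refine derivation_ext fun j => ?_
  simp [matDerivation_X, add_smul, Finset.sum_add_distrib]

theorem matDerivation_smul (c : ℝ) (B : Matrix (Fin n) (Fin n) ℝ) :
    matDerivation (c • B) = c • matDerivation B := by
  refine derivation_ext fun j => ?_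
  simp [matDerivation_X, mul_smul, Finset.smul_sum]

theorem matDerivation_single (i j : Fin n) (Q : MvPolynomial (Fin n) ℝ) :
    matDerivation (Matrix.single j i 1) Q = X i * pderiv j Q := by
  have h : matDerivation (Matrix.single j i 1) = (X i : MvPolynomial (Fin n) ℝ) • pderiv j := by
    refine derivation_ext fun k => ?_
    rw [matDerivation_X, Derivation.smul_apply, pderiv_X, Finset.sum_eq_single i]
    · by_cases hjk : j = k
      · subst hjk; simp
      · simp [hjk]
    · intro b _ hb
      simp [Ne.symm hb]
    · simp
  rw [h]
  rfl

/-- Both sides are derivations, so the generators suffice. The minus sign is the reason why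
`matAction` involves the negative of `matDerivation`. -/
theorem matDerivation_commutator (B C : Matrix (Fin n) (Fin n) ℝ) (Q : MvPolynomial (Fin n) ℝ) :
    matDerivation B (matDerivation C Q) - matDerivation C (matDerivation B Q) =
      -matDerivation (B * C - C * B) Q := by
  have hX : ∀ (B C : Matrix (Fin n) (Fin n) ℝ) (j : Fin n),
      matDerivation B (matDerivation C (X j)) = ∑ r, (C * B) j r • X r := by
    intro B C j
    simp only [matDerivation_X, map_sum, Derivation.map_smul, Matrix.mul_apply, Finset.sum_smul,
      Finset.smul_sum, smul_smul]
    exact Finset.sum_comm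
  have h : ⁅matDerivation B, matDerivation C⁆ = -matDerivation (B * C - C * B) := by
    refine derivation_ext fun j => ?_
    rw [Derivation.commutator_apply, hX, hX, Derivation.neg_apply, matDerivation_X,
      ← Finset.sum_sub_distrib, ← Finset.sum_neg_distrib]
    refine Finset.sum_congr rfl fun r _ => ?_
    rw [Matrix.sub_apply, ← sub_smul, ← neg_smul, neg_sub]
  rw [← Derivation.commutator_apply, h]
  rfl

/-- The action of `gl_n` on polynomials, twisted by a multiple of the trace. -/
def matAction (lam : ℝ) (B : Matrix (Fin n) (Fin n) ℝ) :
    MvPolynomial (Fin n) ℝ →ₗ[ℝ] MvPolynomial (Fin n) ℝ :=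
  -(matDerivation B).toLinearMap - (lam * B.trace) • LinearMap.id

theorem matAction_apply (lam : ℝ) (B : Matrix (Fin n) (Fin n) ℝ) (Q : MvPolynomial (Fin n) ℝ) :
    matAction lam B Q = -matDerivation B Q - (lam * B.trace) • Q := rfl

theorem matAction_commutator (lam : ℝ) (B C : Matrix (Fin n) (Fin n) ℝ)
    (Q : MvPolynomial (Fin n) ℝ) :
    matAction lam (B * C - C * B) Q =
      matAction lam B (matAction lam C Q) - matAction lam C (matAction lam B Q) := by
  have h := matDerivation_commutator B C Q
  have ht : (B * C - C * B).trace = 0 := by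
    rw [Matrix.trace_sub, Matrix.trace_mul_comm, sub_self]
  simp only [matAction_apply, ht, mul_zero, zero_smul, sub_zero, map_sub, map_neg,
    Derivation.map_smul]
  rw [← h]
  module

theorem matDerivation_mem {h : ℕ} (B : Matrix (Fin n) (Fin n) ℝ) {Q : MvPolynomial (Fin n) ℝ}
    (hQ : Q ∈ homogeneousSubmodule (Fin n) ℝ h) :
    matDerivation B Q ∈ homogeneousSubmodule (Fin n) ℝ h := by
  have hB : B = ∑ j, ∑ i, B j i • Matrix.single j i (1 : ℝ) := by
    conv_lhs => rw [Matrix.matrix_eq_sum_single B]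
    simp [Matrix.smul_single]
  have hsum : matDerivation B Q = ∑ j, ∑ i, B j i • (X i * pderiv j Q) := by
    let L : Matrix (Fin n) (Fin n) ℝ →ₗ[ℝ] MvPolynomial (Fin n) ℝ :=
      { toFun := fun B => matDerivation B Q
        map_add' := fun B C => by rw [matDerivation_add]; rfl
        map_smul' := fun c B => by rw [matDerivation_smul]; rfl }
    change L B = _
    conv_lhs => rw [hB]
    simp only [map_sum, map_smul]
    exact Finset.sum_congr rfl fun j _ => Finset.sum_congr rfl fun i _ =>
      congrArg _ (matDerivation_single i j Q)
  rw [hsum]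
  refine Submodule.sum_mem _ fun j _ => Submodule.sum_mem _ fun i _ => Submodule.smul_mem _ _ ?_
  rw [mem_homogeneousSubmodule] at hQ ⊢
  rcases h with _ | h
  · rw [totalDegree_eq_zero_iff_eq_C.mp (Nat.le_zero.mp hQ.totalDegree_le), pderiv_C, mul_zero]
    exact isHomogeneous_zero _ _ _
  · have := (isHomogeneous_X ℝ i).mul (hQ.pderiv (i := j))
    rwa [Nat.add_sub_cancel, add_comm] at this

theorem matAction_mem {h : ℕ} (lam : ℝ) (B : Matrix (Fin n) (Fin n) ℝ)
    {Q : MvPolynomial (Fin n) ℝ} (hQ : Q ∈ homogeneousSubmodule (Fin n) ℝ h) :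
    matAction lam B Q ∈ homogeneousSubmodule (Fin n) ℝ h :=
  Submodule.sub_mem _ (Submodule.neg_mem _ (matDerivation_mem B hQ)) (Submodule.smul_mem _ _ hQ)

/-- A non-zero subspace stable under the operators `X_i ∂_j` contains all homogeneous
polynomials. -/
theorem homogeneousSubmodule_le_of_stable {h : ℕ} (o : Fin n)
    (T : Submodule ℝ (MvPolynomial (Fin n) ℝ))
    (hT : ∀ Q ∈ T, Q ∈ homogeneousSubmodule (Fin n) ℝ h → ∀ i j, X i * pderiv j Q ∈ T)
    {Q : MvPolynomial (Fin n) ℝ} (hQT : Q ∈ T) (hQ : Q ∈ homogeneousSubmodule (Fin n) ℝ h)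
    (hQ0 : Q ≠ 0) : homogeneousSubmodule (Fin n) ℝ h ≤ T := by
  refine homogeneousSubmodule_le_of_lowering o T ?_ fun Q hQT hQ j _ => hT Q hQT hQ j o
  have hdeg : ∀ Q ∈ homogeneousSubmodule (Fin n) ℝ h, ∀ m, coeff m Q ≠ 0 → m.degree = h := by
    intro Q hQ m hm
    have := ((mem_homogeneousSubmodule _ _).1 hQ) hm
    rwa [Finsupp.degree_eq_weight_one]
  have hle : ∀ m : Fin n →₀ ℕ, m o ≤ m.degree := by
    intro m
    have := Finset.single_le_sum (f := m) (fun _ _ => Nat.zero_le _) (Finset.mem_univ o)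
    rwa [← Finsupp.degree_eq_sum] at this
  -- All exponents of X_o in Q exceed h - r. Each non-zero X_o ∂_j Q with j ≠ o raises these
  -- exponents, and the process can stop only at a multiple of X_o^h.
  have key : ∀ r : ℕ, ∀ Q ∈ T, Q ∈ homogeneousSubmodule (Fin n) ℝ h → Q ≠ 0 →
      (∀ m, coeff m Q ≠ 0 → h < m o + r) → X o ^ h ∈ T := by
    intro r
    induction r with
    | zero =>
      intro Q _ hQ hQ0 hr
      obtain ⟨m, hm⟩ := ne_zero_iff.1 hQ0
      have h1 := hr m hm
      have h2 := hle m
      rw [hdeg Q hQ m hm] at h2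
      omega
    | succ r ih =>
      intro Q hQT hQ hQ0 hr
      by_cases hd : ∃ j, j ≠ o ∧ pderiv j Q ≠ 0
      · obtain ⟨j, hj, hjQ⟩ := hd
        refine ih (X o * pderiv j Q) (hT Q hQT hQ o j) ?_ (mul_ne_zero (X_ne_zero o) hjQ) ?_
        · rw [← matDerivation_single]
          exact matDerivation_mem _ hQ
        · intro m hm
          rw [coeff_X_mul'] at hm
          split_ifs at hm with ho
          · obtain ⟨m', rfl⟩ : ∃ m', m = m' + Finsupp.single o 1 :=
              ⟨_, (tsub_add_cancel_of_le (Finsupp.single_le_iff.2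
                (Nat.one_le_iff_ne_zero.2 (Finsupp.mem_support_iff.1 ho)))).symm⟩
            rw [add_tsub_cancel_right, coeff_pderiv] at hm
            have h1 := hr _ (left_ne_zero_of_mul hm)
            rw [Finsupp.add_apply, Finsupp.single_eq_of_ne (Ne.symm hj)] at h1
            rw [Finsupp.add_apply, Finsupp.single_eq_same]
            omega
          · exact absurd rfl hm
      -- If every ∂_j Q with j ≠ o vanishes, Q involves X_o alone.
      · push Not at hd
        obtain ⟨m, hm⟩ := ne_zero_iff.1 hQ0
        have hsupp : ∀ m, coeff m Q ≠ 0 → m = Finsupp.single o h := by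
          intro m hm
          have hma : ∀ a, a ≠ o → m a = 0 := by
            intro a ha
            by_contra hma
            have hle' : Finsupp.single a 1 ≤ m := by
              rw [Finsupp.single_le_iff]; omega
            have h1 := congrArg (coeff (m - Finsupp.single a 1)) (hd a ha)
            rw [coeff_pderiv, tsub_add_cancel_of_le hle', coeff_zero] at h1
            exact (mul_ne_zero hm (by positivity)) h1
          have h1 : m = Finsupp.single o (m o) := by
            ext i
            rw [Finsupp.single_apply]
            split_ifs with hi
            · rw [hi]
            · exact hma i (Ne.symm hi)
          have h2 := hdeg Q hQ m hm
          rw [h1, Finsupp.degree_single] at h2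
          rw [h1, h2]
        have hQeq : Q = coeff (Finsupp.single o h) Q • X o ^ h := by
          ext m'
          rw [coeff_smul, X_pow_eq_monomial, coeff_monomial, smul_eq_mul]
          split_ifs with hm'
          · rw [hm', mul_one]
          · rw [mul_zero]
            by_contra hne
            exact hm' (hsupp m' hne).symm
        rw [hQeq] at hQT
        refine (T.smul_mem_iff ?_).1 hQT
        rwa [← hsupp m hm]
  exact key (h + 1) Q hQT hQ hQ0 fun m _ => by omega

/-- An enumeration of the monomials of degree `h`. -/
structure IsMonomialEnum {n : ℕ} (h : ℕ) {d : ℕ} (mon : Fin d → Fin n →₀ ℕ) : Prop where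
  inj : Function.Injective mon
  exists_iff : ∀ m, (∃ a, mon a = m) ↔ m.degree = h

theorem exists_isMonomialEnum (n h : ℕ) :
    ∃ (d : ℕ) (mon : Fin d → Fin n →₀ ℕ), IsMonomialEnum h mon := by
  classical
  let s : Finset (Fin n →₀ ℕ) := Finset.finsuppAntidiag Finset.univ h
  refine ⟨s.card, fun a => (s.equivFin.symm a : Fin n →₀ ℕ), fun a b hab => ?_, fun m => ?_⟩
  · exact s.equivFin.symm.injective (Subtype.ext hab)
  · have hs : m ∈ s ↔ m.degree = h := by
      rw [Finset.mem_finsuppAntidiag, Finsupp.degree_eq_sum]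
      simp
    rw [← hs]
    constructor
    · rintro ⟨a, rfl⟩
      exact Subtype.property _
    · exact fun hm => ⟨s.equivFin ⟨m, hm⟩, by simp⟩

variable {d h : ℕ} {mon : Fin d → Fin n →₀ ℕ}

/-- The polynomial with given coefficients. -/
def ofCoeffs (mon : Fin d → Fin n →₀ ℕ) : (Fin d → ℝ) →ₗ[ℝ] MvPolynomial (Fin n) ℝ :=
  ∑ b, LinearMap.toSpanSingleton ℝ _ (monomial (mon b) 1) ∘ₗ LinearMap.proj b

theorem ofCoeffs_apply (mon : Fin d → Fin n →₀ ℕ) (v : Fin d → ℝ) :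
    ofCoeffs mon v = ∑ b, v b • monomial (mon b) 1 := by
  simp [ofCoeffs, LinearMap.sum_apply]

/-- The vector of coefficients of a polynomial. -/
def toCoeffs (mon : Fin d → Fin n →₀ ℕ) : MvPolynomial (Fin n) ℝ →ₗ[ℝ] (Fin d → ℝ) :=
  LinearMap.pi fun a => lcoeff ℝ (mon a)

theorem toCoeffs_apply (mon : Fin d → Fin n →₀ ℕ) (Q : MvPolynomial (Fin n) ℝ) (a : Fin d) :
    toCoeffs mon Q a = coeff (mon a) Q := rfl

namespace IsMonomialEnum

theorem degree (hm : IsMonomialEnum h mon) (a : Fin d) : (mon a).degree = h :=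
  (hm.exists_iff _).1 ⟨a, rfl⟩

theorem ofCoeffs_mem (hm : IsMonomialEnum h mon) (v : Fin d → ℝ) :
    ofCoeffs mon v ∈ homogeneousSubmodule (Fin n) ℝ h := by
  rw [ofCoeffs_apply]
  exact Submodule.sum_mem _ fun b _ => Submodule.smul_mem _ _
    ((mem_homogeneousSubmodule _ _).2 (isHomogeneous_monomial _ (hm.degree b)))

theorem toCoeffs_ofCoeffs (hm : IsMonomialEnum h mon) (v : Fin d → ℝ) :
    toCoeffs mon (ofCoeffs mon v) = v := by
  ext a
  rw [toCoeffs_apply, ofCoeffs_apply, coeff_sum, Finset.sum_eq_single a]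
  · simp
  · intro b _ hb
    rw [coeff_smul, coeff_monomial, if_neg fun h' => hb (hm.inj h'), smul_zero]
  · simp

theorem eq_sum {R : Type} [CommRing R] (hm : IsMonomialEnum h mon) {P : MvPolynomial (Fin n) R}
    (hP : P ∈ homogeneousSubmodule (Fin n) R h) :
    P = ∑ b, monomial (mon b) (coeff (mon b) P) := by
  ext m
  rw [coeff_sum]
  by_cases hmd : m.degree = h
  · obtain ⟨a, rfl⟩ := (hm.exists_iff m).2 hmd
    rw [Finset.sum_eq_single a]
    · simp
    · intro b _ hb
      rw [coeff_monomial, if_neg fun h' => hb (hm.inj h')]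
    · simp
  · rw [Finset.sum_eq_zero]
    · by_contra hne
      apply hmd
      have := ((mem_homogeneousSubmodule _ _).1 hP) hne
      rwa [Finsupp.degree_eq_weight_one]
    · intro b _
      rw [coeff_monomial, if_neg]
      rintro rfl
      exact hmd (hm.degree b)

theorem ofCoeffs_toCoeffs (hm : IsMonomialEnum h mon) {Q : MvPolynomial (Fin n) ℝ}
    (hQ : Q ∈ homogeneousSubmodule (Fin n) ℝ h) : ofCoeffs mon (toCoeffs mon Q) = Q := by
  conv_rhs => rw [hm.eq_sum hQ]
  rw [ofCoeffs_apply]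
  refine Finset.sum_congr rfl fun b _ => ?_
  rw [toCoeffs_apply, smul_monomial, smul_eq_mul, mul_one]

end IsMonomialEnum

/-! ### The representation in the basis of monomials. -/

theorem matAction_add (lam : ℝ) (B C : Matrix (Fin n) (Fin n) ℝ) :
    matAction lam (B + C) = matAction lam B + matAction lam C := by
  refine LinearMap.ext fun Q => ?_
  rw [LinearMap.add_apply, matAction_apply, matAction_apply, matAction_apply, matDerivation_add,
    Derivation.add_apply, Matrix.trace_add, mul_add, add_smul]
  abel

theorem matAction_smul (lam c : ℝ) (B : Matrix (Fin n) (Fin n) ℝ) :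
    matAction lam (c • B) = c • matAction lam B := by
  refine LinearMap.ext fun Q => ?_
  rw [LinearMap.smul_apply, matAction_apply, matAction_apply, matDerivation_smul,
    Derivation.smul_apply, Matrix.trace_smul, smul_eq_mul, smul_sub, smul_neg, smul_smul,
    mul_left_comm]

/-- The matrices of the representation of `gl_n` on homogeneous polynomials. -/
def polyRep (lam : ℝ) (mon : Fin d → Fin n →₀ ℕ) :
    Matrix (Fin n) (Fin n) ℝ →ₗ[ℝ] Matrix (Fin d) (Fin d) ℝ where
  toFun B := LinearMap.toMatrix' (toCoeffs mon ∘ₗ matAction lam B ∘ₗ ofCoeffs mon)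
  map_add' B C := by
    rw [matAction_add, LinearMap.add_comp, LinearMap.comp_add, map_add]
  map_smul' c B := by
    rw [matAction_smul, LinearMap.smul_comp, LinearMap.comp_smul, map_smul, RingHom.id_apply]

theorem polyRep_mulVec (lam : ℝ) (mon : Fin d → Fin n →₀ ℕ) (B : Matrix (Fin n) (Fin n) ℝ)
    (v : Fin d → ℝ) :
    (polyRep lam mon B).mulVec v = toCoeffs mon (matAction lam B (ofCoeffs mon v)) := by
  change (LinearMap.toMatrix' (toCoeffs mon ∘ₗ matAction lam B ∘ₗ ofCoeffs mon)).mulVec v = _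
  rw [LinearMap.toMatrix'_mulVec]
  rfl

theorem polyRep_apply (lam : ℝ) (mon : Fin d → Fin n →₀ ℕ) (B : Matrix (Fin n) (Fin n) ℝ)
    (a b : Fin d) :
    polyRep lam mon B a b = coeff (mon a) (matAction lam B (monomial (mon b) 1)) := by
  have h := congrFun (polyRep_mulVec lam mon B (Pi.single b 1)) a
  rw [Matrix.mulVec_single_one] at h
  rw [toCoeffs_apply, ofCoeffs_apply, Finset.sum_eq_single b, Pi.single_eq_same, one_smul] at h
  · exact h
  · intro c _ hc
    rw [Pi.single_eq_of_ne hc, zero_smul]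
  · simp

theorem isGLRep_polyRep (lam : ℝ) (hm : IsMonomialEnum h mon) : IsGLRep (polyRep lam mon) := by
  intro B C
  refine Matrix.ext_of_mulVec_single fun b => ?_
  have hc : ∀ B C : Matrix (Fin n) (Fin n) ℝ, ∀ v,
      (polyRep lam mon B * polyRep lam mon C).mulVec v =
        toCoeffs mon (matAction lam B (matAction lam C (ofCoeffs mon v))) := by
    intro B C v
    rw [← Matrix.mulVec_mulVec, polyRep_mulVec, polyRep_mulVec,
      hm.ofCoeffs_toCoeffs (matAction_mem lam C (hm.ofCoeffs_mem v))]
  rw [Matrix.sub_mulVec, hc, hc, polyRep_mulVec, matAction_commutator, map_sub]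

/-- The elementary matrices act by -X_i ∂_j up to scalars, so an invariant subspace is stable under
all X_i ∂_j. A non-zero one therefore contains every homogeneous polynomial. -/
theorem isIrreducibleRep_polyRep (lam : ℝ) (o : Fin n) (hm : IsMonomialEnum h mon) :
    IsIrreducibleRep (polyRep lam mon) := by
  refine ⟨?_, fun W hW => ?_⟩
  · rintro rfl
    obtain ⟨a, -⟩ := (hm.exists_iff (Finsupp.single o h)).2 (Finsupp.degree_single o h)
    exact a.elim0
  · by_cases hbot : W = ⊥
    · exact Or.inl hbot
    refine Or.inr (eq_top_iff.2 fun v _ => ?_)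
    obtain ⟨w, hwW, hw0⟩ := (Submodule.ne_bot_iff W).1 hbot
    have hle : homogeneousSubmodule (Fin n) ℝ h ≤ W.comap (toCoeffs mon) := by
      refine homogeneousSubmodule_le_of_stable o _ ?_ (Q := ofCoeffs mon w) ?_
        (hm.ofCoeffs_mem w) ?_
      · intro Q hQW hQ i j
        have h1 := hW (Matrix.single j i 1) _ hQW
        rw [polyRep_mulVec, hm.ofCoeffs_toCoeffs hQ, matAction_apply, map_sub, map_neg,
          map_smul, matDerivation_single] at h1
        have h2 := W.add_mem h1 (W.smul_mem (lam * (Matrix.single j i (1 : ℝ)).trace) hQW)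
        rw [sub_add_cancel] at h2
        exact (W.neg_mem_iff).1 h2
      · rw [Submodule.mem_comap, hm.toCoeffs_ofCoeffs]
        exact hwW
      · intro h0
        apply hw0
        rw [← hm.toCoeffs_ofCoeffs w, h0, map_zero]
    have h3 := hle (hm.ofCoeffs_mem v)
    rwa [Submodule.mem_comap, hm.toCoeffs_ofCoeffs] at h3

/-- Passage from real matrices to symbols with smooth coefficients: ρ(E_{ji}) acts as -p̄^i ∂_{p̄^j}
- λ δ_{ij}. The signs match those in `sectionAction`, so that the latter becomes `cosymbolAction`.
-/
theorem sum_polyRep_smul_coeff (lam : ℝ) (hm : IsMonomialEnum h mon) {P : FibrePoly n}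
    (hP : P ∈ Symb n h) (i j : Fin n) (a : Fin d) :
    ∑ b, polyRep lam mon (Matrix.single j i 1) a b • coeff (mon b) P =
      -coeff (mon a) (X i * fibreD j P) - (if i = j then lam else 0) • coeff (mon a) P := by
  have ht : (Matrix.single j i (1 : ℝ)).trace = if i = j then 1 else 0 := by
    by_cases hij : i = j
    · subst hij; simp
    · rw [if_neg hij, Matrix.trace_single_eq_of_ne _ _ _ (Ne.symm hij)]
  -- The operators involved are C^∞-linear, so they are determined by the monomials with coefficient
  -- 1, where the real computation applies.
  have hsum : ∀ L : FibrePoly n →ₗ[Smooth n] Smooth n,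
      L P = ∑ b, coeff (mon b) P * L (monomial (mon b) 1) := by
    intro L
    conv_lhs => rw [hm.eq_sum hP]
    rw [map_sum]
    refine Finset.sum_congr rfl fun b _ => ?_
    rw [← smul_eq_mul, ← map_smul, smul_monomial, smul_eq_mul, mul_one]
  have h1 := hsum (lcoeff (Smooth n) (mon a) ∘ₗ LinearMap.mulLeft (Smooth n) (X i) ∘ₗ
    (pderiv j : Derivation (Smooth n) (FibrePoly n) (FibrePoly n)).toLinearMap)
  have h2 := hsum (lcoeff (Smooth n) (mon a))
  change coeff (mon a) (X i * fibreD j P) = ∑ b, coeff (mon b) P *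
    coeff (mon a) (X i * pderiv j (monomial (mon b) 1)) at h1
  change coeff (mon a) P = ∑ b, coeff (mon b) P * coeff (mon a) (monomial (mon b) 1) at h2
  rw [h1]
  conv_rhs => rw [h2]
  rw [Finset.smul_sum, ← Finset.sum_neg_distrib, ← Finset.sum_sub_distrib]
  refine Finset.sum_congr rfl fun b _ => ?_
  have h3 : ∀ Q : MvPolynomial (Fin n) ℝ, algebraMap ℝ (Smooth n) (coeff (mon a) Q) =
      coeff (mon a) (MvPolynomial.map (algebraMap ℝ (Smooth n)) Q) := fun Q => (coeff_map _ _ _).symm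
  have h4 : MvPolynomial.map (algebraMap ℝ (Smooth n)) (monomial (mon b) 1) = monomial (mon b) 1 := by
    rw [map_monomial, map_one]
  have h5 : algebraMap ℝ (Smooth n) (coeff (mon a) (X i * pderiv j (monomial (mon b) 1))) =
      coeff (mon a) (X i * pderiv j (monomial (mon b) 1)) := by
    rw [h3, map_mul, map_X, ← pderiv_map, h4]
  have h6 := h3 (monomial (mon b) 1)
  rw [h4] at h6
  rw [polyRep_apply, matAction_apply, matDerivation_single, ht, coeff_sub, coeff_neg, coeff_smul,
    smul_eq_mul, Algebra.smul_def, Algebra.smul_def, map_sub, map_neg, map_mul, h5, h6]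
  split_ifs
  · rw [mul_one]; ring
  · rw [mul_zero, map_zero]; ring

end PolynomialRep

/-! ### The invariant operator built on the powers of the gradient -/

/-- The vector of coefficients of `G^h f`. -/
def gradientSections {d : ℕ} (h : ℕ) (mon : Fin d → Fin n →₀ ℕ) : Smooth n →ₗ[ℝ] Sections n d :=
  LinearMap.pi fun a => (MvPolynomial.lcoeff (Smooth n) (mon a)).restrictScalars ℝ ∘ₗ
    (gradientOp n ^ h) ∘ₗ (Algebra.linearMap (Smooth n) (FibrePoly n)).restrictScalars ℝ

theorem gradientSections_apply {d : ℕ} (h : ℕ) (mon : Fin d → Fin n →₀ ℕ) (f : Smooth n)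
    (a : Fin d) : gradientSections h mon f a =
      MvPolynomial.coeff (mon a) ((gradientOp n ^ h) (MvPolynomial.C f)) := rfl

theorem orderLE_gradientOp_pow (h : ℕ) : OrderLE n h (gradientOp n ^ h) := by
  have hG : OrderLE n 1 (gradientOp n) := by
    refine orderLT_sum _ fun i _ => ?_
    refine OrderLT.comp (a := 0) (b := 1) ?_ ?_
    · exact orderLE_zero_of_linear (LinearMap.mulLeft (Smooth n) (MvPolynomial.X i : FibrePoly n))
    · intro f
      have h : opComm (baseD i) f =
          (Algebra.lsmul (Smooth n) (Smooth n) (FibrePoly n) (pd i f)).restrictScalars ℝ := by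
        refine LinearMap.ext fun P => ?_
        rw [opComm_apply, baseD_smul, add_sub_cancel_left]
        rfl
      rw [h]
      exact orderLE_zero_of_linear _
  induction h with
  | zero => exact orderLE_zero_of_linear (LinearMap.id : FibrePoly n →ₗ[Smooth n] FibrePoly n)
  | succ h ih =>
    rw [pow_succ]
    exact OrderLT.comp ih hG

theorem gradientOp_pow_polySymb_X_pow (o : Fin n) (h : ℕ) : ∀ b : ℕ, ∃ c : ℝ, 0 < c ∧
    (gradientOp n ^ h) (polySymb (MvPolynomial.X o ^ h) (MvPolynomial.X o ^ b)) =
      c • polySymb 1 (MvPolynomial.X o ^ (b + h)) := by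
  induction h with
  | zero => exact fun b => ⟨1, one_pos, by simp⟩
  | succ h ih =>
    intro b
    obtain ⟨c, hc, hG⟩ := ih (b + 1)
    refine ⟨((h : ℝ) + 1) * c, by positivity, ?_⟩
    have h1 : gradientOp n (polySymb (MvPolynomial.X o ^ (h + 1)) (MvPolynomial.X o ^ b)) =
        ((h : ℝ) + 1) • polySymb (MvPolynomial.X o ^ h) (MvPolynomial.X o ^ (b + 1)) := by
      rw [gradientOp_apply, Finset.sum_eq_single o]
      · have hp : MvPolynomial.pderiv o (MvPolynomial.X o ^ (h + 1) : MvPolynomial (Fin n) ℝ) =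
            ((h : ℝ) + 1) • MvPolynomial.X o ^ h := by
          rw [MvPolynomial.pderiv_pow, MvPolynomial.pderiv_X_self, add_tsub_cancel_right, mul_one,
            MvPolynomial.smul_eq_C_mul]
          simp
        rw [baseD_polySymb, X_mul_polySymb, hp, polySymb_smul_left, ← pow_succ']
      · intro i _ hi
        rw [baseD_polySymb, MvPolynomial.pderiv_pow, MvPolynomial.pderiv_X_of_ne (Ne.symm hi),
          mul_zero, polySymb, map_zero, zero_smul, mul_zero]
      · simp
    rw [pow_succ, Module.End.mul_apply, h1, map_smul, hG, smul_smul, add_assoc, add_comm 1 h]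

theorem orderEq_gradientSections {d h : ℕ} {mon : Fin d → Fin n →₀ ℕ} (o : Fin n)
    (hm : IsMonomialEnum h mon) : OrderEq n h (gradientSections h mon) := by
  refine ⟨orderLT_pi_iff.2 fun a => ?_, fun hlt => ?_⟩
  · have h1 := OrderLT.comp (a := h) (b := 0) (orderLE_gradientOp_pow (n := n) h)
      (orderLE_zero_of_linear (Algebra.linearMap (Smooth n) (FibrePoly n)))
    have h2 := OrderLT.comp (a := 0)
      (orderLE_zero_of_linear (MvPolynomial.lcoeff (Smooth n) (mon a))) h1
    rw [zero_add] at h2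
    exact h2
  · obtain ⟨a, ha⟩ := (hm.exists_iff (Finsupp.single o h)).2 (Finsupp.degree_single o h)
    -- The order is not smaller than h: x_o^h vanishes to order h at 0, while G^h sends it to a
    -- positive multiple of p̄_o^h.
    have hmem : polyFun n (MvPolynomial.X o ^ h) ∈ vanishing (0 : Fin n → ℝ) ^ h := by
      rw [map_pow, polyFun_X]
      exact Ideal.pow_mem_pow rfl h
    have h1 := orderLT_iff_vanishing.1 (orderLT_pi_iff.1 hlt a) 0 _ hmem
    obtain ⟨c, hc, hG⟩ := gradientOp_pow_polySymb_X_pow o h 0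
    have h2 : polySymb (MvPolynomial.X o ^ h) (1 : MvPolynomial (Fin n) ℝ) =
        MvPolynomial.C (polyFun n (MvPolynomial.X o ^ h)) := by
      rw [← MvPolynomial.C_1, MvPolynomial.C_apply, polySymb_monomial, MvPolynomial.C_apply]
    have h3 : polySymb (1 : MvPolynomial (Fin n) ℝ) (MvPolynomial.X o ^ h) =
        MvPolynomial.monomial (Finsupp.single o h) 1 := by
      rw [MvPolynomial.X_pow_eq_monomial, polySymb_monomial, map_one]
    rw [pow_zero, zero_add, h2, h3] at hG
    rw [LinearMap.comp_apply, LinearMap.proj_apply, gradientSections_apply,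
      hG, ha, MvPolynomial.coeff_smul, MvPolynomial.coeff_monomial,
      if_pos rfl, map_smul, map_one, smul_eq_mul, mul_one] at h1
    exact hc.ne' h1

theorem sectionInvariant_gradientSections {d h : ℕ} {mon : Fin d → Fin n →₀ ℕ} {lam : ℝ}
    (hm : IsMonomialEnum h mon) (hG : GradientPowInvariant n lam h) :
    SectionInvariant lam (polyRep lam mon) (gradientSections h mon) := by
  intro X hX f
  ext1 a
  rw [gradientSections_apply, ← hG X hX f, sectionAction]
  have hP := gradientOp_pow_C_mem h f
  simp only [gradientSections_apply, sum_polyRep_smul_coeff lam hm hP]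
  generalize (gradientOp n ^ h) (MvPolynomial.C f) = P
  rw [cosymbolAction_apply, MvPolynomial.coeff_add, MvPolynomial.coeff_add,
    MvPolynomial.coeff_sum, MvPolynomial.coeff_sum]
  have h1 : ∀ i, MvPolynomial.coeff (mon a) (X i • baseD i P) =
      X i * pd i (MvPolynomial.coeff (mon a) P) := by
    intro i
    rw [MvPolynomial.coeff_smul, baseD, coeff_coeffMap, smul_eq_mul]
  have h2 : ∀ i, MvPolynomial.coeff (mon a) (∑ j,
      (MvPolynomial.X i * MvPolynomial.C (pd i (X j)) : FibrePoly n) * fibreD j P) =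
      ∑ j, pd i (X j) * MvPolynomial.coeff (mon a) (MvPolynomial.X i * fibreD j P) := by
    intro i
    rw [MvPolynomial.coeff_sum]
    refine Finset.sum_congr rfl fun j _ => ?_
    rw [mul_comm (MvPolynomial.X i), mul_assoc, MvPolynomial.coeff_C_mul]
  have h3 : MvPolynomial.coeff (mon a) (lam • (vdiv X • P)) =
      ∑ i, ∑ j, pd i (X j) * ((if i = j then lam else 0) • MvPolynomial.coeff (mon a) P) := by
    simp only [ite_smul, zero_smul, mul_ite, mul_zero, Finset.sum_ite_eq, Finset.mem_univ, if_true]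
    rw [MvPolynomial.coeff_smul, MvPolynomial.coeff_smul, smul_eq_mul, vdiv, Finset.sum_mul,
      Finset.smul_sum]
    simp only [mul_smul_comm]
  simp only [h1, h2, h3, mul_sub, mul_neg, Finset.sum_sub_distrib, Finset.sum_neg_distrib]
  abel

theorem hasIrreducibleInvariantOperator_of_gradient (o : Fin n) {lam : ℝ} {h : ℕ}
    (hG : GradientPowInvariant n lam h) : HasIrreducibleInvariantOperator n lam h := by
  obtain ⟨d, mon, hm⟩ := exists_isMonomialEnum n h
  exact ⟨d, polyRep lam mon, gradientSections h mon, isGLRep_polyRep lam hm,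
    isIrreducibleRep_polyRep lam o hm, orderEq_gradientSections o hm,
    sectionInvariant_gradientSections hm hG⟩

theorem tfae_invariantOperator (o : Fin n) (lam : ℝ) {h : ℕ} (hh : 1 ≤ h) : List.TFAE
    [HasInvariantOperator n lam h, HasIrreducibleInvariantOperator n lam h,
      GradientPowInvariant n lam h, lam = (1 - (h : ℝ)) / ((n : ℝ) + 1)] := by
  tfae_have 1 → 4 := fun h' => h'.eq_of_one_le hh
  tfae_have 4 → 3 := gradientPowInvariant_of_eq hh
  tfae_have 3 → 2 := hasIrreducibleInvariantOperator_of_gradient o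
  tfae_have 2 → 1 := fun ⟨d, rho, A, h1, _, h3, h4⟩ => ⟨d, rho, A, h1, h3, h4⟩
  tfae_finish

end ProjQuant

end

open ProjQuant in
/-- Existence and uniqueness of the projectively equivariant quantization on `S^δ_k`, `δ = μ - λ`,
and its resonances. -/
theorem theorem3p2 (n : ℕ) (hn : 1 ≤ n) (k : ℕ) (lam mu : ℝ) :
    ((∃! Q : Symb n k →ₗ[ℝ] (Smooth n →ₗ[ℝ] Smooth n), IsProjQuantization k lam mu Q) ↔
      ¬ ∃ l : ℕ, 1 ≤ l ∧ l ≤ k ∧ ∃ A : Symb n k →ₗ[ℝ] Symb n (k - l),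
        IsDiffOp n A ∧ SymbInvariant (mu - lam) A ∧ A ≠ 0) ∧
    (∀ l : ℕ, 1 ≤ l → l ≤ k → ∀ A : Symb n k →ₗ[ℝ] Symb n (k - l),
      IsDiffOp n A → SymbInvariant (mu - lam) A → A ≠ 0 →
        (∃ c : ℝ, c ≠ 0 ∧ ∀ P : Symb n k, (A P : FibrePoly n) = c • (divergenceOp n ^ l) P) ∧
        ((∃ Q : Symb n k →ₗ[ℝ] (Smooth n →ₗ[ℝ] Smooth n), IsProjQuantization k lam mu Q) ↔
          ∃ h : ℕ, k - l < h ∧ h ≤ k ∧ HasInvariantOperator n lam h) ∧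
        ((∃ Q : Symb n k →ₗ[ℝ] (Smooth n →ₗ[ℝ] Smooth n), IsProjQuantization k lam mu Q) ↔
          ∃ h : ℕ, k - l < h ∧ h ≤ k ∧ lam = (1 - (h : ℝ)) / ((n : ℝ) + 1))) ∧
    (∀ h : ℕ, 1 ≤ h → List.TFAE
      [HasInvariantOperator n lam h,
        HasIrreducibleInvariantOperator n lam h,
        GradientPowInvariant n lam h,
        lam = (1 - (h : ℝ)) / ((n : ℝ) + 1)]) := by
  -- A distinguished direction, on which the test symbols and the extremal weight vectors are built.
  let o : Fin n := ⟨0, hn⟩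
  refine ⟨⟨?_, fun hno => existsUnique_of_no_resonance o fun s hs hres => ?_⟩, ?_,
    fun h hh => tfae_invariantOperator o lam hh⟩
  · rintro huniq ⟨l, hl, hlk, A, -, hA, hA0⟩
    obtain ⟨l, rfl⟩ : ∃ l', l = l' + 1 := ⟨l - 1, by omega⟩
    obtain ⟨-, -, -, hres⟩ := resonance_eq_zero_of_invariant hlk o hA hA0
    exact not_existsUnique_of_resonance o hl hlk hres huniq
  · refine hno ⟨s + 1, by omega, hs, divergencePow n k (s + 1), isDiffOp_divergencePow k (s + 1),
      symbInvariant_divergencePow hs hres, fun h0 => ?_⟩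
    -- D^{s+1} is a non-zero map, as its value on x_o^{s+1} p_o^k shows.
    refine divergenceOp_pow_testSymbol_ne_zero (k := k) (s := s + 1) o hs ?_
    have h1 := congrArg Subtype.val (LinearMap.congr_fun h0 ⟨_, testSymbol_mem k o (s + 1)⟩)
    exact h1
  · intro l hl hlk A _ hA hA0
    obtain ⟨l, rfl⟩ : ∃ l', l = l' + 1 := ⟨l - 1, by omega⟩
    obtain ⟨c, hc, hAc, hres⟩ := resonance_eq_zero_of_invariant hlk o hA hA0
    have hiff := exists_isProjQuantization_iff_of_resonance (lam := lam) (mu := mu) o hl hlk hres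
    refine ⟨⟨c, hc, hAc⟩, hiff.trans (exists_congr fun h => ?_), hiff⟩
    refine and_congr_right fun h1 => and_congr_right fun _ => ?_
    exact ((tfae_invariantOperator o lam (h := h) (by omega)).out 0 3).symm
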